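/- Let $N\ge 1$ be an integer and let $\alpha_1,\dots,\alpha_N,\beta_1,\dots,\beta_N>0$ (not necessarily distinct). Let $\{W_{i,j}: i,j\ge 1,\ i+j\le 2N+1\}$ be independent random variables with exponential distributions $$ W_{i,j}\sim\begin{cases} \mathrm{Exp}(\alpha_i+\beta_j), & 1\le i,j\le N,\\ \mathrm{Exp}(\alpha_i+\alpha_{2N-j+1}), & 1\le i\le N,\ N<j\le 2N-i+1,\\ \mathrm{Exp}(\beta_{2N-i+1}+\beta_j), & 1\le j\le N,\ N<i\le 2N-j+1, \end{cases} $$ where $\mathrm{Exp}(r)$ has rate $r$. Let $$\tau_{2N}=\max_{\pi}\sum_{(i,j)\in\pi}W_{i,j},$$ the maximum being over all lattice paths $\pi$ with $2N$ vertices that start at $(1,1)$, have steps $(1,0)$ and $(0,1)$, and end on the line $i+j=2N+1$. Let $\Gamma_1,\Gamma_2\subset\{z\in\mathbb C:\operatorname{Re} z>0\}$ be any positively oriented simple closed (piecewise $C^1$) contours such that $\Gamma_1$ encloses $\alpha_1,\dots,\alpha_N$, and $\Gamma_2$ encloses $\beta_1,\dots,\beta_N$ as well as the whole of $\Gamma_1$.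 For $u>0$ and $\lambda,\xi>0$ put $$ K_{N,u}(\lambda,\xi)=\frac{1}{(2\pi\mathrm i)^2}\int_{\Gamma_1}dz\int_{\Gamma_2}dw\;e^{-\lambda z-\xi w}\,\widehat H_u(z,w)\prod_{m=1}^N\frac{(z+\beta_m)(w+\alpha_m)}{(z-\alpha_m)(w-\beta_m)}, $$ $$ \widehat H_u(z,w)=\frac{e^{-2uz}}{w-z}+\frac{e^{-2uw}}{z-w}+\frac{e^{-2u(z+w)}}{z+w}. $$ Then, for every $u>0$, the kernel $K_{N,u}$ defines a bounded integral operator on $L^2(\mathbb R_+)$, the multiple integrals and the series in $$ \det(I-K_{N,u})_{L^2(\mathbb R_+)}:=1+\sum_{n=1}^\infty\frac{(-1)^n}{n!}\int_{(0,\infty)^n}\det\big(K_{N,u}(\lambda_i,\lambda_j)\big)_{i,j=1}^n\,d\lambda_1\cdots d\lambda_n $$ converge absolutely, and $$\mathbb P(\tau_{2N}\le u)=\det(I-K_{N,u})_{L^2(\mathbb R_+)}.$$ -/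

import Mathlib

open MeasureTheory ProbabilityTheory Set
open scoped BigOperators

/-! ### Point-to-line directed last passage percolation -/

/-- Directed (down-right) lattice paths with `M` vertices `π 0, …, π (M - 1)`, starting at `(1, 1)`
and ending on the line `i + j = M + 1`. -/
structure IsPointToLinePath (M : ℕ) (π : Fin M → ℕ × ℕ) : Prop where
  start : ∀ h : 0 < M, π ⟨0, h⟩ = (1, 1)
  step : ∀ (k : ℕ) (h : k + 1 < M),
    π ⟨k + 1, h⟩ = ((π ⟨k, by omega⟩).1 + 1, (π ⟨k, by omega⟩).2) ∨
    π ⟨k + 1, h⟩ = ((π ⟨k, by omega⟩).1, (π ⟨k, by omega⟩).2 + 1)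
  finish : ∀ h : 0 < M, (π ⟨M - 1, by omega⟩).1 + (π ⟨M - 1, by omega⟩).2 = M + 1

/-- The point-to-line last passage time `max_π ∑_{(i,j) ∈ π} w (i, j)` over the directed paths with
`M` vertices. (For `1 ≤ M` this is a maximum over a finite non-empty set, see
`isGreatest_pointToLineTime`.) -/
noncomputable def pointToLineTime (M : ℕ) (w : ℕ × ℕ → ℝ) : ℝ :=
  sSup {s : ℝ | ∃ π : Fin M → ℕ × ℕ, IsPointToLinePath M π ∧ s = ∑ k, w (π k)}

theorem IsPointToLinePath.le {M : ℕ} {π : Fin M → ℕ × ℕ} (hπ : IsPointToLinePath M π) :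
    ∀ (k : ℕ) (h : k < M), (π ⟨k, h⟩).1 ≤ k + 1 ∧ (π ⟨k, h⟩).2 ≤ k + 1 := by
  intro k
  induction k with
  | zero => intro h; simp [hπ.start h]
  | succ k ih =>
    intro h
    have := ih (by omega)
    rcases hπ.step k h with h1 | h1 <;> rw [h1] <;> simp only <;> omega

theorem isGreatest_pointToLineTime (M : ℕ) (hM : 1 ≤ M) (w : ℕ × ℕ → ℝ) :
    IsGreatest {s : ℝ | ∃ π : Fin M → ℕ × ℕ, IsPointToLinePath M π ∧ s = ∑ k, w (π k)}
      (pointToLineTime M w) := by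
  have hfin : {π : Fin M → ℕ × ℕ | IsPointToLinePath M π}.Finite := by
    apply (Set.Finite.pi' (t := fun _ : Fin M => Set.Icc (0 : ℕ × ℕ) (M, M))
      (fun _ => Set.finite_Icc _ _)).subset
    intro π hπ k
    have h1 : (π k).1 ≤ k + 1 ∧ (π k).2 ≤ k + 1 := IsPointToLinePath.le hπ k.1 k.2
    have hk := k.2
    refine ⟨bot_le, ?_, ?_⟩ <;> simp only <;> omega
  have himg : {s : ℝ | ∃ π : Fin M → ℕ × ℕ, IsPointToLinePath M π ∧ s = ∑ k, w (π k)} =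
      (fun π : Fin M → ℕ × ℕ => ∑ k, w (π k)) '' {π | IsPointToLinePath M π} := by
    ext s
    exact exists_congr fun π => and_congr_right fun _ => eq_comm
  have hne : {π : Fin M → ℕ × ℕ | IsPointToLinePath M π}.Nonempty :=
    ⟨fun k => (1, k.1 + 1), fun _ => rfl, fun _ _ => Or.inr rfl, fun _ => by simp only; omega⟩
  have hfin' := hfin.image (fun π : Fin M → ℕ × ℕ => ∑ k, w (π k))
  have hne' := hne.image (fun π : Fin M → ℕ × ℕ => ∑ k, w (π k))
  unfold pointToLineTime
  rw [himg]
  exact ⟨hne'.csSup_mem hfin', fun x hx => le_csSup hfin'.bddAbove hx⟩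

/-- The triangular array of sites `(i, j)` with `i, j ≥ 1` and `i + j ≤ 2N + 1`. -/
def triangle (N : ℕ) : Set (ℕ × ℕ) :=
  {p | 1 ≤ p.1 ∧ 1 ≤ p.2 ∧ p.1 + p.2 ≤ 2 * N + 1}

/-- The rate of the exponential weight at the site `p = (i, j)` of the triangular array:
`α_i + β_j` if `i, j ≤ N`, `α_i + α_{2N-j+1}` if `i ≤ N < j`, and `β_{2N-i+1} + β_j` if `N < i`
(then `j ≤ N` on the triangle). -/
def weightRate (N : ℕ) (α β : ℕ → ℝ) (p : ℕ × ℕ) : ℝ :=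
  if p.1 ≤ N then
    if p.2 ≤ N then α p.1 + β p.2 else α p.1 + α (2 * N + 1 - p.2)
  else β (2 * N + 1 - p.1) + β p.2

/-! ### Contours in the complex plane -/

/-- A simple closed contour: a curve `γ : [0, 1] → ℂ` that is continuous, piecewise continuously
differentiable, closed, and injective apart from `γ 0 = γ 1`. -/
structure IsSimpleClosedContour (γ : ℝ → ℂ) : Prop where
  continuousOn : ContinuousOn γ (Icc 0 1)
  piecewise : ∃ (k : ℕ) (t : ℕ → ℝ), t 0 = 0 ∧ t k = 1 ∧
    ∀ i < k, t i < t (i + 1) ∧ ContDiffOn ℝ 1 γ (Icc (t i) (t (i + 1)))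
  closed : γ 0 = γ 1
  injOn : InjOn γ (Ico 0 1)

/-- The trace of a contour. -/
def contourTrace (γ : ℝ → ℂ) : Set ℂ := γ '' Icc 0 1

/-- The contour integral `∫_γ f(z) dz`. -/
noncomputable def contourIntegral (γ : ℝ → ℂ) (f : ℂ → ℂ) : ℂ :=
  ∫ t in (0 : ℝ)..1, f (γ t) * deriv γ t

/-- The contour `γ` encloses the point `p`: `p` lies off the contour, in a bounded connected
component of its complement. -/
def Encloses (γ : ℝ → ℂ) (p : ℂ) : Prop :=
  p ∉ contourTrace γ ∧ Bornology.IsBounded (connectedComponentIn (contourTrace γ)ᶜ p)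

/-- `γ` is positively oriented: it winds exactly once, counterclockwise, around every point that it
encloses. -/
def IsPositivelyOriented (γ : ℝ → ℂ) : Prop :=
  ∀ p, Encloses γ p →
    1 / (2 * (Real.pi : ℂ) * Complex.I) * contourIntegral γ (fun z => 1 / (z - p)) = 1

/-! ### Integral operators and Fredholm determinants -/

/-- `T` is the operator on `L²(μ)` defined through the integral kernel `K`:
`(T h)(x) = ∫ K(x, y) h(y) μ(dy)`, the integral being absolutely convergent for a.e. `x`. -/
def IsIntegralOperator {X : Type*} [MeasurableSpace X] (μ : Measure X) (K : X → X → ℂ)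
    (T : Lp ℂ 2 μ →L[ℂ] Lp ℂ 2 μ) : Prop :=
  ∀ h : Lp ℂ 2 μ, (∀ᵐ x ∂μ, Integrable (fun y => K x y * h y) μ) ∧
    T h =ᵐ[μ] fun x => ∫ y, K x y * h y ∂μ

/-- The `n`-th term `(1 / n!) ∫ det (K(x_i, x_j))_{i,j=1}^n μ(dx_1) ⋯ μ(dx_n)` of the Fredholm
expansion of `det (I + K)`; it is `1` for `n = 0`. -/
noncomputable def fredholmTerm {X : Type*} [MeasurableSpace X] (μ : Measure X) (K : X → X → ℂ)
    (n : ℕ) : ℂ :=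
  1 / (n.factorial : ℂ) *
    ∫ x : Fin n → X, (Matrix.of fun i j => K (x i) (x j)).det ∂(Measure.pi fun _ => μ)

/-- All multiple integrals in the Fredholm expansion of `det (I + K)` and the series of their values
converge absolutely. -/
def FredholmConverges {X : Type*} [MeasurableSpace X] (μ : Measure X) (K : X → X → ℂ) : Prop :=
  (∀ n : ℕ, Integrable (fun x : Fin n → X => (Matrix.of fun i j => K (x i) (x j)).det)
    (Measure.pi fun _ => μ)) ∧ Summable (fredholmTerm μ K)

/-- The Fredholm determinant `det (I + K)` on `L²(μ)`, through its series expansion. -/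
noncomputable def fredholmDet {X : Type*} [MeasurableSpace X] (μ : Measure X) (K : X → X → ℂ) : ℂ :=
  ∑' n, fredholmTerm μ K n

/-! ### The kernel -/

/-- `Ĥ_u(z, w) = e^{-2uz} / (w - z) + e^{-2uw} / (z - w) + e^{-2u(z+w)} / (z + w)`. -/
noncomputable def flatHhat (u : ℝ) (z w : ℂ) : ℂ :=
  Complex.exp (-2 * u * z) / (w - z) + Complex.exp (-2 * u * w) / (z - w) +
    Complex.exp (-2 * u * (z + w)) / (z + w)

/-- The kernel `K_{N,u}(x, y)` as a double contour integral over `Γ₁` (variable `z`) and `Γ₂`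
(variable `w`). -/
noncomputable def flatKernel (N : ℕ) (α β : ℕ → ℝ) (Γ₁ Γ₂ : ℝ → ℂ) (u : ℝ) (x y : ℝ) : ℂ :=
  1 / (2 * (Real.pi : ℂ) * Complex.I) ^ 2 *
    contourIntegral Γ₁ fun z => contourIntegral Γ₂ fun w =>
      Complex.exp (-x * z - y * w) * flatHhat u z w *
        ∏ m ∈ Finset.Icc 1 N, ((z + β m) * (w + α m)) / ((z - α m) * (w - β m))

/-!
Write `a = (α_1, …, α_N, β_N, …, β_1)`. After relabelling, the weights form a staircase in which the
site in row `i` and column `k`, `i ≤ k`, has rate `a_i + a_k`.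

*Distribution of the last passage time.* The last passage times from the sites along the frontier
of a partly built staircase form a vector, and adding one site replaces one coordinate `V_i` by
`w + max V_i V_{i+1}` with an independent exponential `w`. On ordered thresholds this turns the joint
distribution function `F` into a convolution of `F` with an exponential density, along thresholds
cut off at a common level `y` from index `i` on (`measureReal_update_le`). The determinants `cdfDet`
obey the same recursion (`exp_mul_cdfDet`): when `y` moves, all rows `j > i` with threshold above `y`
move as well, but the derivative of such a row is proportional to the row above it, so only row `i`
contributes, and it satisfies a first order linear differential equation. By induction over the
sites (`measureReal_stairTime_le`), for distinct parameters,
`P(τ ≤ u) = e^{-u ∑ a_i} W(u) / V`, where `W` is the Wronskian of the functions `2 sinh (a_l x)` and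
`V` is the Vandermonde determinant of the `a_l`.

*Halving the size of the determinant.* Splitting polynomials into even and odd parts turns both
determinants into `2N × 2N` double Vandermonde determinants in the squares of the parameters. A Schur
complement, with Lagrange interpolation of the `α` nodes at the `β` nodes, reduces them to size `N`
(`det_double_vandermonde`). Thus `P(τ ≤ u)` is the ratio of
`det (1 / (α_k + β_j) - Ĥ_u(α_k, β_j))` and the Cauchy determinant
(`measureReal_pointToLineTime_mul_det`).

*The kernel.* For distinct parameters, the residue theorem shows that the kernel has rank at most `N`
(`flatKernel_eq_sum`); inside the half-plane, Cauchy's theorem is needed only for curves in a disc.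
The Fredholm expansion is then a finite sum of principal minors by Andréief's identity
(`sum_fredholmTerm_of_finite_rank`). As the residues are the factors in the inverse of the Cauchy
matrix (`sum_cauchy_mul_cauchyWeight`), its value is the same ratio (`fredholmTerm_flatKernel`).

*Equal parameters.* The parameters are perturbed to distinct ones. The kernel decays exponentially,
uniformly for parameters near the given ones (`exists_norm_flatKernel_le`), which makes it a bounded
operator with absolutely convergent expansion and lets every term of the expansion pass to the limit
(`tendsto_fredholmTerm`); the terms of order above `N` vanish throughout. On the probability side,
the weights with different rates are coupled by scaling
(`exists_tendsto_measureReal_pointToLineTime`).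
-/

/-! ### Determinants evolving under exponential smoothing -/

/-- The derivative of a determinant is the sum over the rows of the determinants in which that row
has been differentiated. -/
theorem hasDerivWithinAt_det {n : Type*} [Fintype n] [DecidableEq n] (A : ℝ → Matrix n n ℝ)
    (A' : Matrix n n ℝ) (s : Set ℝ) (y : ℝ)
    (h : ∀ i j, HasDerivWithinAt (fun t => A t i j) (A' i j) s y) :
    HasDerivWithinAt (fun t => (A t).det) (∑ i, ((A y).updateRow i (A' i)).det) s y := by
  simp only [← Matrix.det_transpose (A _), ← Matrix.det_transpose (Matrix.updateRow _ _ _)]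
  simp only [Matrix.det_apply', Matrix.transpose_apply]
  rw [Finset.sum_comm]
  refine HasDerivWithinAt.fun_sum fun σ _ => ?_
  simp only [← Finset.mul_sum]
  refine HasDerivWithinAt.const_mul _ ?_
  have := HasDerivWithinAt.fun_finsetProd (u := Finset.univ) (f := fun i t => A t i (σ i))
    (f' := fun i => A' i (σ i)) (s := s) (x := y) (fun i _ => h i (σ i))
  refine this.congr_deriv (Finset.sum_congr rfl fun i _ => ?_)
  rw [← Finset.prod_erase_mul _ _ (Finset.mem_univ i), Matrix.updateRow_self, smul_eq_mul]
  congr 1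
  refine Finset.prod_congr rfl fun j hj => ?_
  rw [Matrix.updateRow_ne (Finset.ne_of_mem_erase hj)]

/-- A square matrix in which `k + 1` rows are supported in `k` columns is singular. -/
theorem det_eq_zero_of_rows_supported {M : ℕ} (A : Matrix (Fin M) (Fin M) ℝ) (k : ℕ) (hk : k < M)
    (h : ∀ i j : Fin M, (i : ℕ) ≤ k → k ≤ (j : ℕ) → A i j = 0) : A.det = 0 := by
  rw [← Matrix.det_transpose, Matrix.det_apply]
  refine Finset.sum_eq_zero fun σ _ => ?_
  obtain ⟨i, hi, hi'⟩ : ∃ i : Fin M, (i : ℕ) ≤ k ∧ k ≤ (σ i : ℕ) := by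
    by_contra! hcon
    have hinj : Function.Injective (fun i : Fin (k + 1) =>
        (⟨σ ⟨i, by omega⟩, hcon ⟨i, by omega⟩ (by simp only; omega)⟩ : Fin k)) := by
      intro i j hij
      have h := σ.injective (Fin.ext (by simpa using hij))
      simpa [Fin.ext_iff] using h
    simpa using Fintype.card_le_of_injective _ hinj
  rw [Finset.prod_eq_zero (Finset.mem_univ i), smul_zero]
  exact h _ _ hi hi'

open Polynomial in
/-- `p(b) e^{bx} - p(-b) e^{-bx}`, the result of applying the differential operator `p(d/dx)` to
`2 sinh (b x)`. -/
noncomputable def polySinh (p : ℝ[X]) (b x : ℝ) : ℝ :=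
  p.eval b * Real.exp (b * x) - p.eval (-b) * Real.exp (-b * x)

open Polynomial in
theorem hasDerivAt_exp_mul_polySinh (p : ℝ[X]) (c b x : ℝ) :
    HasDerivAt (fun x => Real.exp (-(c * x)) * polySinh p b x)
      (Real.exp (-(c * x)) * polySinh ((X - C c) * p) b x) x := by
  have h1 : HasDerivAt (fun x => Real.exp (-(c * x))) (Real.exp (-(c * x)) * (-(c * 1))) x :=
    ((hasDerivAt_id' x).const_mul c).neg.exp
  have h2 : ∀ b : ℝ, HasDerivAt (fun x => Real.exp (b * x)) (Real.exp (b * x) * (b * 1)) x :=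
    fun b => ((hasDerivAt_id' x).const_mul b).exp
  have h3 := h1.mul (((h2 b).const_mul (p.eval b)).sub ((h2 (-b)).const_mul (p.eval (-b))))
  refine h3.congr_deriv ?_
  simp only [polySinh, eval_mul, eval_sub, eval_X, eval_C, Pi.sub_apply]
  ring

open Polynomial in
/-- The operator symbol of row `j` of the determinant describing the last passage times, when row
`j` of the array has been processed up to (not including) column `c`. -/
noncomputable def rowPoly (M : ℕ) (a : ℕ → ℝ) (j c : ℕ) : ℝ[X] :=
  (∏ m ∈ Finset.Ioo j M, (X - C (a m))) * ∏ m ∈ Finset.Ico c M, (X + C (a m))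

/-- The diagonal entry of a row that has not been processed yet. -/
noncomputable def idleEntry (M : ℕ) (a : ℕ → ℝ) (j : ℕ) : ℝ :=
  2 * a j * ∏ m ∈ Finset.Ioo j M, (a j ^ 2 - a m ^ 2)

/-- Entry `(j, l)` of the determinant describing the joint law of the last passage times, when row
`j` of the array has been processed up to (not including) column `c`. The row is idle, that is
constant, as long as `c ≤ j`. -/
noncomputable def cdfRow (M : ℕ) (a : ℕ → ℝ) (c j l : ℕ) (x : ℝ) : ℝ :=
  if c ≤ j then (if l = j then idleEntry M a j else 0)
  else Real.exp (-(a j * x)) * polySinh (rowPoly M a j c) (a l) x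

/-- The derivative of `cdfRow`. -/
noncomputable def cdfRowDeriv (M : ℕ) (a : ℕ → ℝ) (c j l : ℕ) (x : ℝ) : ℝ :=
  if c ≤ j then 0
  else Real.exp (-(a j * x)) *
    polySinh ((Polynomial.X - Polynomial.C (a j)) * rowPoly M a j c) (a l) x

theorem hasDerivAt_cdfRow (M : ℕ) (a : ℕ → ℝ) (c j l : ℕ) (x : ℝ) :
    HasDerivAt (cdfRow M a c j l) (cdfRowDeriv M a c j l x) x := by
  unfold cdfRow cdfRowDeriv
  split_ifs
  · exact hasDerivAt_const _ _
  · exact hasDerivAt_const _ _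
  · exact hasDerivAt_exp_mul_polySinh _ _ _ _

theorem continuous_cdfRow (M : ℕ) (a : ℕ → ℝ) (c j l : ℕ) : Continuous (cdfRow M a c j l) :=
  continuous_iff_continuousAt.2 fun x => (hasDerivAt_cdfRow M a c j l x).continuousAt

open Polynomial in
theorem X_sub_mul_rowPoly {M : ℕ} (a : ℕ → ℝ) {j : ℕ} (hj : j + 1 < M) (c : ℕ) :
    (X - C (a (j + 1))) * rowPoly M a (j + 1) c = rowPoly M a j c := by
  have : Finset.Ioo j M = insert (j + 1) (Finset.Ioo (j + 1) M) := by
    ext m; simp only [Finset.mem_Ioo, Finset.mem_insert]; omega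
  rw [rowPoly, rowPoly, this, Finset.prod_insert (by simp), mul_assoc]

open Polynomial in
theorem X_add_mul_rowPoly {M : ℕ} (a : ℕ → ℝ) (j : ℕ) {k : ℕ} (hk : k < M) :
    (X + C (a k)) * rowPoly M a j (k + 1) = rowPoly M a j k := by
  have : Finset.Ico k M = insert k (Finset.Ico (k + 1) M) := by
    ext m; simp only [Finset.mem_Ico, Finset.mem_insert]; omega
  rw [rowPoly, rowPoly, this, Finset.prod_insert (by simp)]
  ring

/-- The reflecting boundary condition: the derivative of an active row is proportional to the row
above it. -/
theorem cdfRowDeriv_succ {M : ℕ} (a : ℕ → ℝ) {c j : ℕ} (hj : j + 1 < M) (hc : j + 1 < c) (l : ℕ)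
    (y : ℝ) : cdfRowDeriv M a c (j + 1) l y =
      (Real.exp (-(a (j + 1) * y)) * Real.exp (a j * y)) * cdfRow M a c j l y := by
  rw [cdfRowDeriv, cdfRow, if_neg (by omega), if_neg (by omega), X_sub_mul_rowPoly a hj, mul_assoc,
    ← mul_assoc (Real.exp (a j * y)), ← Real.exp_add]
  simp

open Polynomial in
theorem eval_rowPoly (M : ℕ) (a : ℕ → ℝ) (j c : ℕ) (b : ℝ) : (rowPoly M a j c).eval b =
    (∏ m ∈ Finset.Ioo j M, (b - a m)) * ∏ m ∈ Finset.Ico c M, (b + a m) := by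
  simp [rowPoly, eval_prod]

/-- An active row that has been processed up to column `k` is supported in the first `k` columns. -/
theorem cdfRow_eq_zero {M : ℕ} (a : ℕ → ℝ) {j k l : ℕ} (hj : j < k) (hl : k ≤ l) (hlM : l < M)
    (y : ℝ) : cdfRow M a k j l y = 0 := by
  have h1 : (rowPoly M a j k).eval (a l) = 0 := by
    rw [eval_rowPoly, Finset.prod_eq_zero (i := l) (by simp; omega) (by ring), zero_mul]
  have h2 : (rowPoly M a j k).eval (-a l) = 0 := by
    rw [eval_rowPoly, Finset.prod_eq_zero (s := Finset.Ico k M) (i := l) (by simp; omega) (by ring),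
      mul_zero]
  rw [cdfRow, if_neg (by omega), polySinh, h1, h2]
  ring

/-- The differential equation satisfied by a row when one more column is processed. -/
theorem cdfRowDeriv_update {M : ℕ} (a : ℕ → ℝ) {i k : ℕ} (hk : k < M) (hi : i < k) (l : ℕ)
    (y : ℝ) : cdfRowDeriv M a (k + 1) i l y =
      cdfRow M a k i l y - (a i + a k) * cdfRow M a (k + 1) i l y := by
  rw [cdfRowDeriv, cdfRow, cdfRow, if_neg (by omega), if_neg (by omega), if_neg (by omega),
    ← X_add_mul_rowPoly a i hk]
  simp only [polySinh, Polynomial.eval_mul, Polynomial.eval_sub, Polynomial.eval_add,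
    Polynomial.eval_X, Polynomial.eval_C]
  ring

/-- The differential equation satisfied by a row when it is activated; it holds only up to a vector
supported in the columns of the rows that are active already. -/
theorem cdfRowDeriv_activate {M : ℕ} (a : ℕ → ℝ) {k l : ℕ} (hk : k < M) (hl : k ≤ l) (hlM : l < M)
    (y : ℝ) : cdfRowDeriv M a (k + 1) k l y =
      cdfRow M a k k l y - (a k + a k) * cdfRow M a (k + 1) k l y := by
  have hIco : Finset.Ico (k + 1) M = Finset.Ioo k M := by
    ext m; simp only [Finset.mem_Ico, Finset.mem_Ioo]; omega
  have hsq : ∀ b, (∏ m ∈ Finset.Ioo k M, (b - a m)) * ∏ m ∈ Finset.Ioo k M, (b + a m) =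
      ∏ m ∈ Finset.Ioo k M, (b ^ 2 - a m ^ 2) := fun b => by
    rw [← Finset.prod_mul_distrib]; exact Finset.prod_congr rfl fun m _ => by ring
  rw [cdfRowDeriv, cdfRow, cdfRow, if_pos le_rfl, if_neg (show ¬ k + 1 ≤ k by omega),
    if_neg (show ¬ k + 1 ≤ k by omega)]
  simp only [polySinh, Polynomial.eval_mul, Polynomial.eval_sub,
    Polynomial.eval_X, Polynomial.eval_C, eval_rowPoly, hIco, hsq, neg_sq]
  split_ifs with h
  · subst h
    have : Real.exp (-(a l * y)) * Real.exp (a l * y) = 1 := by rw [← Real.exp_add]; simp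
    rw [idleEntry]
    linear_combination (2 * a l * ∏ m ∈ Finset.Ioo l M, (a l ^ 2 - a m ^ 2)) * this
  · rw [Finset.prod_eq_zero (i := l) (by simp; omega) (by ring)]
    ring

theorem cdfRow_diag_zero (M : ℕ) (a : ℕ → ℝ) (k l : ℕ) : cdfRow M a (k + 1) k l 0 = 0 := by
  have hIco : Finset.Ico (k + 1) M = Finset.Ioo k M := by
    ext m; simp only [Finset.mem_Ico, Finset.mem_Ioo]; omega
  have hsq : ∀ b, (∏ m ∈ Finset.Ioo k M, (b - a m)) * ∏ m ∈ Finset.Ioo k M, (b + a m) =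
      ∏ m ∈ Finset.Ioo k M, (b ^ 2 - a m ^ 2) := fun b => by
    rw [← Finset.prod_mul_distrib]; exact Finset.prod_congr rfl fun m _ => by ring
  rw [cdfRow, if_neg (by omega)]
  simp only [polySinh, eval_rowPoly, hIco, hsq, neg_sq]
  simp

/-- The determinant which, up to a constant, is the joint distribution function at `x` of the last
passage times, when row `j` of the array has been processed up to column `c j`. -/
noncomputable def cdfDet (M : ℕ) (a : ℕ → ℝ) (c : ℕ → ℕ) (x : ℕ → ℝ) : ℝ :=
  (Matrix.of fun j l : Fin M => cdfRow M a (c j) j l (x j)).det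

/-- The thresholds `x`, with those from index `i` on cut off at level `y`. -/
def cutAt (i : ℕ) (y : ℝ) (x : ℕ → ℝ) (j : ℕ) : ℝ := if j < i then x j else min (x j) y

theorem continuous_cutAt (i : ℕ) (x : ℕ → ℝ) (j : ℕ) : Continuous fun y => cutAt i y x j := by
  unfold cutAt; split_ifs <;> fun_prop

theorem continuous_cdfDet_cutAt (M : ℕ) (a : ℕ → ℝ) (c : ℕ → ℕ) (i : ℕ) (x : ℕ → ℝ) :
    Continuous fun y => cdfDet M a c (cutAt i y x) := by
  refine Continuous.matrix_det ?_
  exact continuous_matrix fun j l => (continuous_cdfRow _ _ _ _ _).comp (continuous_cutAt _ _ _)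

theorem cutAt_self {x : ℕ → ℝ} (hx : Antitone x) (i : ℕ) : cutAt i (x i) x = x := by
  funext j
  unfold cutAt
  split_ifs with h
  · rfl
  · exact min_eq_left (hx (not_lt.1 h))

theorem antitone_cutAt {x : ℕ → ℝ} (hx : Antitone x) {i : ℕ} {y : ℝ} : Antitone (cutAt i y x) := by
  intro j j' h
  unfold cutAt
  split_ifs
  · exact hx h
  · exact absurd h (by omega)
  · exact (min_le_left _ _).trans (hx h)
  · exact min_le_min_right _ (hx h)

theorem hasDerivWithinAt_cutAt (i : ℕ) (x : ℕ → ℝ) (j : ℕ) (y : ℝ) :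
    HasDerivWithinAt (fun y => cutAt i y x j) (if i ≤ j ∧ y < x j then 1 else 0) (Ioi y) y := by
  unfold cutAt
  by_cases hj : j < i
  · simp only [hj, if_true, not_le.2 hj, false_and, if_false]
    exact hasDerivWithinAt_const _ _ _
  · simp only [hj, if_false, not_lt.1 hj, true_and]
    split_ifs with hy
    · refine HasDerivAt.hasDerivWithinAt ((hasDerivAt_id' y).congr_of_eventuallyEq ?_)
      filter_upwards [eventually_lt_nhds hy] with t ht using min_eq_right ht.le
    · rw [not_lt] at hy
      exact (hasDerivWithinAt_const y _ (x j)).congr (fun t ht => min_eq_left (hy.trans ht.le))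
        (min_eq_left hy)

/-- Processing the site in row `i` and column `k` convolves the determinant with an exponential
density of rate `a i + a k`. The mechanism: in the right derivative of the left-hand side along
the cut-off thresholds, rows `j > i` contribute nothing by the reflecting boundary condition, so
that only row `i` contributes. -/
theorem exp_mul_cdfDet {M : ℕ} (a : ℕ → ℝ) {i k : ℕ} (hik : i ≤ k) (hk : k < M) {x : ℕ → ℝ}
    (hx : Antitone x) (hx0 : ∀ j, 0 ≤ x j) :
    Real.exp ((a i + a k) * x i) * cdfDet M a (fun j => if i ≤ j then k + 1 else k) x =
      ∫ y in (0 : ℝ)..x i, Real.exp ((a i + a k) * y) *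
        cdfDet M a (fun j => if i + 1 ≤ j then k + 1 else k) (cutAt i y x) := by
  set c : ℕ → ℕ := fun j => if i + 1 ≤ j then k + 1 else k with hc
  set c' : ℕ → ℕ := fun j => if i ≤ j then k + 1 else k with hc'
  set r := a i + a k with hr
  have hexp : ∀ y, HasDerivAt (fun y => Real.exp (r * y)) (Real.exp (r * y) * (r * 1)) y :=
    fun y => ((hasDerivAt_id' y).const_mul r).exp
  have key : ∀ y ∈ Ioo 0 (x i), HasDerivWithinAt
      (fun y => Real.exp (r * y) * cdfDet M a c' (cutAt i y x))
      (Real.exp (r * y) * cdfDet M a c (cutAt i y x)) (Ioi y) y := by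
    intro y hy
    set A : Matrix (Fin M) (Fin M) ℝ :=
      Matrix.of fun j l : Fin M => cdfRow M a (c' j) j l (cutAt i y x j) with hA
    set B : Matrix (Fin M) (Fin M) ℝ :=
      Matrix.of fun j l : Fin M => cdfRowDeriv M a (c' j) j l (cutAt i y x j) *
        (if i ≤ (j : ℕ) ∧ y < x j then 1 else 0) with hB
    have hdet := hasDerivWithinAt_det
      (fun y => Matrix.of fun j l : Fin M => cdfRow M a (c' j) j l (cutAt i y x j)) B (Ioi y) y
      (fun j l => (hasDerivAt_cdfRow M a (c' j) j l _).comp_hasDerivWithinAt y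
        (hasDerivWithinAt_cutAt i x j y))
    have hcutge : ∀ j, i ≤ j → y < x j → cutAt i y x j = y := fun j hj hyj => by
      rw [cutAt, if_neg (not_lt.2 hj), min_eq_right hyj.le]
    have hzero : ∀ j : Fin M, j ≠ ⟨i, by omega⟩ → (A.updateRow j (B j)).det = 0 := by
      intro j hj
      have hji : (j : ℕ) ≠ i := fun h => hj (Fin.ext h)
      by_cases hact : i ≤ (j : ℕ) ∧ y < x j
      · obtain ⟨j', hj'⟩ : ∃ j', (j : ℕ) = j' + 1 := ⟨j - 1, by omega⟩
        have hjM := j.2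
        by_cases hjk : (j : ℕ) < k + 1
        · have hy' : y < x j' := hact.2.trans_le (hx (by omega))
          have hrow : B j = (Real.exp (-(a (j' + 1) * y)) * Real.exp (a j' * y)) •
              A ⟨j', by omega⟩ := by
            funext l
            simp only [hB, hA, Matrix.of_apply, if_pos hact, Pi.smul_apply, smul_eq_mul, mul_one]
            rw [hcutge _ hact.1 hact.2, hcutge j' (by omega) hy', hj', hc']
            simp only [show i ≤ j' + 1 by omega, show i ≤ j' by omega, if_true]
            exact cdfRowDeriv_succ a (by omega) (by omega) _ _
          rw [hrow, Matrix.det_updateRow_smul]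
          refine mul_eq_zero_of_right _ (Matrix.det_zero_of_row_eq (i := j) (j := ⟨j', by omega⟩)
            (by simp [Fin.ext_iff, hj']) ?_)
          rw [Matrix.updateRow_self, Matrix.updateRow_ne (by simp [Fin.ext_iff, hj'])]
        · refine Matrix.det_eq_zero_of_row_eq_zero j fun l => ?_
          rw [Matrix.updateRow_self]
          simp only [hB, Matrix.of_apply, hc', if_pos hact.1]
          rw [cdfRowDeriv, if_pos (by omega), zero_mul]
      · refine Matrix.det_eq_zero_of_row_eq_zero j fun l => ?_
        rw [Matrix.updateRow_self]
        simp only [hB, Matrix.of_apply, if_neg hact, mul_zero]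
    have hmain : (A.updateRow ⟨i, by omega⟩ (B ⟨i, by omega⟩)).det =
        cdfDet M a c (cutAt i y x) - r * cdfDet M a c' (cutAt i y x) := by
      have hcut : cutAt i y x i = y := hcutge i le_rfl hy.2
      set i' : Fin M := ⟨i, by omega⟩
      set O : Fin M → ℝ := fun l => cdfRow M a k i l y with hO
      have hOdet : (A.updateRow i' O).det = cdfDet M a c (cutAt i y x) := by
        rw [cdfDet]
        congr 1
        ext j l
        by_cases hj : j = i'
        · subst hj
          rw [Matrix.updateRow_self]
          simp [hO, hc, i', hcut]
        · have : (j : ℕ) ≠ i := fun h => hj (Fin.ext h)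
          rw [Matrix.updateRow_ne hj]
          simp only [hA, hc, hc', Matrix.of_apply]
          congr 2
          simp only [eq_iff_iff]
          omega
      have hAdet : (A.updateRow i' (A i')).det = cdfDet M a c' (cutAt i y x) := by
        rw [Matrix.updateRow_eq_self]; rfl
      have hBrow : B i' = O + (-r) • A i' + (B i' - O + r • A i') := by
        rw [neg_smul]; abel
      rw [hBrow, Matrix.det_updateRow_add, Matrix.det_updateRow_add, Matrix.det_updateRow_smul,
        hOdet, hAdet]
      have hV : ∀ l : Fin M, (i < k ∨ k ≤ l) → (B i' - O + r • A i') l = 0 := by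
        intro l hl
        simp only [hB, hA, hO, Pi.add_apply, Pi.sub_apply, Pi.smul_apply, smul_eq_mul,
          Matrix.of_apply, i', hcut, hc', le_refl, if_true, true_and, hy.2, mul_one]
        rcases hl with hl | hl
        · rw [cdfRowDeriv_update a hk hl]; ring
        · rcases hik.lt_or_eq with hl' | hl'
          · rw [cdfRowDeriv_update a hk hl']; ring
          · subst hl'
            rw [cdfRowDeriv_activate a hk hl l.2]; ring
      have hVdet : (A.updateRow i' (B i' - O + r • A i')).det = 0 := by
        rcases hik.lt_or_eq with hlt | heq
        · refine Matrix.det_eq_zero_of_row_eq_zero i' fun l => ?_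
          rw [Matrix.updateRow_self]
          exact hV l (Or.inl hlt)
        · refine det_eq_zero_of_rows_supported _ k hk fun j l hj hl => ?_
          by_cases hji : j = i'
          · rw [hji, Matrix.updateRow_self]
            exact hV l (Or.inr hl)
          · have : (j : ℕ) ≠ i := fun h => hji (Fin.ext h)
            rw [Matrix.updateRow_ne hji]
            simp only [hA, hc', Matrix.of_apply, if_neg (show ¬ i ≤ (j : ℕ) by omega)]
            exact cdfRow_eq_zero a (by omega) hl l.2 _
      rw [hVdet]; ring
    refine ((hexp y).hasDerivWithinAt.mul hdet).congr_deriv ?_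
    rw [Finset.sum_eq_single (⟨i, by omega⟩ : Fin M) (fun j _ hj => hzero j hj) (by simp), hmain]
    change _ * cdfDet M a c' (cutAt i y x) + _ = _
    ring
  have hcont : ∀ c, Continuous fun y => Real.exp (r * y) * cdfDet M a c (cutAt i y x) := fun c =>
    (by fun_prop : Continuous fun y => Real.exp (r * y)).mul (continuous_cdfDet_cutAt _ _ _ _ _)
  rw [intervalIntegral.integral_eq_sub_of_hasDeriv_right (hcont c').continuousOn
    (by rwa [min_eq_left (hx0 i), max_eq_right (hx0 i)]) ((hcont c).intervalIntegrable _ _),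
    cutAt_self hx]
  have : cdfDet M a c' (cutAt i 0 x) = 0 := by
    refine Matrix.det_eq_zero_of_row_eq_zero (⟨k, hk⟩ : Fin M) fun l => ?_
    have : cutAt i 0 x k = 0 := by
      rw [cutAt, if_neg (not_lt.2 hik), min_eq_right (hx0 k)]
    simp only [Matrix.of_apply, this, hc', if_pos hik]
    exact cdfRow_diag_zero M a k l
  rw [this]; ring

theorem cdfDet_zero (M : ℕ) (a : ℕ → ℝ) (x : ℕ → ℝ) :
    cdfDet M a (fun _ => 0) x = ∏ j ∈ Finset.range M, idleEntry M a j := by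
  have : (Matrix.of fun j l : Fin M => cdfRow M a 0 j l (x j)) =
      Matrix.diagonal fun j : Fin M => idleEntry M a j := by
    ext j l
    simp only [cdfRow, Matrix.of_apply, Nat.zero_le, if_true, Matrix.diagonal_apply, Fin.ext_iff,
      eq_comm]
  rw [cdfDet, this, Matrix.det_diagonal, Finset.prod_range]

/-! ### Last passage times to a line -/

/-- The last passage time over directed paths with `n` vertices starting at the site `p`. -/
def lppTime : ℕ → (ℕ × ℕ → ℝ) → ℕ × ℕ → ℝ
  | 0, _, _ => 0
  | n + 1, w, p => w p + max (lppTime n w (p.1 + 1, p.2)) (lppTime n w (p.1, p.2 + 1))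

theorem sum_le_lppTime (w : ℕ × ℕ → ℝ) (n : ℕ) : ∀ π : ℕ → ℕ × ℕ,
    (∀ k, k + 1 < n → π (k + 1) = ((π k).1 + 1, (π k).2) ∨ π (k + 1) = ((π k).1, (π k).2 + 1)) →
    ∑ k ∈ Finset.range n, w (π k) ≤ lppTime n w (π 0) := by
  induction n with
  | zero => intro π _; simp [lppTime]
  | succ n ih =>
    intro π hπ
    rw [Finset.sum_range_succ', add_comm, lppTime]
    refine add_le_add_right ?_ _
    have h := ih (fun k => π (k + 1)) fun k hk => hπ (k + 1) (by omega)
    refine h.trans ?_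
    rcases n.eq_zero_or_pos with rfl | hn
    · simp [lppTime]
    · rcases hπ 0 (by omega) with h0 | h0 <;> simp only [zero_add] at h0 ⊢ <;> rw [h0]
      · exact le_max_left _ _
      · exact le_max_right _ _

theorem exists_sum_eq_lppTime (w : ℕ × ℕ → ℝ) (n : ℕ) : ∀ p : ℕ × ℕ, ∃ π : ℕ → ℕ × ℕ, π 0 = p ∧
    (∀ k, π (k + 1) = ((π k).1 + 1, (π k).2) ∨ π (k + 1) = ((π k).1, (π k).2 + 1)) ∧
    ∑ k ∈ Finset.range n, w (π k) = lppTime n w p := by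
  induction n with
  | zero => exact fun p => ⟨fun k => (p.1, p.2 + k), by simp, fun k => Or.inr rfl, by simp [lppTime]⟩
  | succ n ih =>
    intro p
    obtain ⟨q, hq, hq'⟩ : ∃ q : ℕ × ℕ, (q = (p.1 + 1, p.2) ∨ q = (p.1, p.2 + 1)) ∧
        lppTime n w q = max (lppTime n w (p.1 + 1, p.2)) (lppTime n w (p.1, p.2 + 1)) := by
      rcases max_choice (lppTime n w (p.1 + 1, p.2)) (lppTime n w (p.1, p.2 + 1)) with h | h
      · exact ⟨_, Or.inl rfl, h.symm⟩
      · exact ⟨_, Or.inr rfl, h.symm⟩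
    obtain ⟨π, h0, hs, hsum⟩ := ih q
    refine ⟨fun k => Nat.casesOn k p π, rfl, ?_, ?_⟩
    · rintro (_ | k)
      · simpa [h0] using hq
      · exact hs k
    · rw [Finset.sum_range_succ', lppTime, ← hq', ← hsum, add_comm]
      rfl

theorem pointToLineTime_eq_lppTime {M : ℕ} (hM : 1 ≤ M) (w : ℕ × ℕ → ℝ) :
    pointToLineTime M w = lppTime M w (1, 1) := by
  refine (isGreatest_pointToLineTime M hM w).unique ⟨?_, ?_⟩
  · obtain ⟨π, h0, hs, hsum⟩ := exists_sum_eq_lppTime w M (1, 1)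
    have hlen : ∀ k, (π k).1 + (π k).2 = k + 2 := by
      intro k
      induction k with
      | zero => simp [h0]
      | succ k ih => rcases hs k with h | h <;> rw [h] <;> simp only <;> omega
    refine ⟨fun k => π k, ⟨fun _ => h0, fun k _ => hs k, fun _ => ?_⟩, ?_⟩
    · rw [hlen]; simp only; omega
    · rw [← hsum, Finset.sum_range]
  · rintro s ⟨π, hπ, rfl⟩
    have h := sum_le_lppTime w M (fun k => if h : k < M then π ⟨k, h⟩ else 0) (by
      intro k hk
      simpa [hk, show k < M by omega] using hπ.step k hk)
    rw [Finset.sum_range] at h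
    simpa [show 0 < M by omega, hπ.start] using h

theorem lppTime_congr {w w' : ℕ × ℕ → ℝ} (n : ℕ) : ∀ p : ℕ × ℕ,
    (∀ q : ℕ × ℕ, p.1 ≤ q.1 → p.2 ≤ q.2 → q.1 + q.2 < p.1 + p.2 + n → w q = w' q) →
    lppTime n w p = lppTime n w' p := by
  induction n with
  | zero => intro p _; rfl
  | succ n ih =>
    intro p h
    rw [lppTime, lppTime, h p le_rfl le_rfl (by omega), ih, ih]
    · exact fun q h1 h2 h3 => h q (by simpa using h1) (by simp only at h2; omega)
        (by simp only at h3; omega)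
    · exact fun q h1 h2 h3 => h q (by simp only at h1; omega) (by simpa using h2)
        (by simp only at h3; omega)

theorem lppTime_nonneg {w : ℕ × ℕ → ℝ} (hw : ∀ q, 0 ≤ w q) (n : ℕ) (p : ℕ × ℕ) :
    0 ≤ lppTime n w p := by
  induction n generalizing p with
  | zero => exact le_rfl
  | succ n ih => exact add_nonneg (hw p) ((ih _).trans (le_max_left _ _))

theorem measurable_lppTime {E : Type*} [MeasurableSpace E] {w : E → ℕ × ℕ → ℝ}
    (hw : ∀ q, Measurable fun v => w v q) (n : ℕ) (p : ℕ × ℕ) :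
    Measurable fun v => lppTime n (w v) p := by
  induction n generalizing p with
  | zero => exact measurable_const
  | succ n ih => exact (hw p).add ((ih _).max (ih _))

/-- The last passage time from row `i + 1` when the last `c` columns of a staircase of size `M` have
been taken into account. -/
def stairTime (M : ℕ) (w : ℕ × ℕ → ℝ) (c i : ℕ) : ℝ := lppTime (c - i) w (i + 1, M + 1 - c)

theorem stairTime_succ (M : ℕ) (w : ℕ × ℕ → ℝ) {i k : ℕ} (hik : i ≤ k) (hk : k < M) :
    stairTime M w (k + 1) i =
      w (i + 1, M - k) + max (stairTime M w k i) (stairTime M w (k + 1) (i + 1)) := by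
  rw [stairTime, stairTime, stairTime, show k + 1 - i = (k - i) + 1 by omega, lppTime,
    show M + 1 - (k + 1) = M - k by omega, show k + 1 - (i + 1) = k - i by omega,
    show M + 1 - k = M - k + 1 by omega, max_comm]

theorem stairTime_eq_zero (M : ℕ) (w : ℕ × ℕ → ℝ) {c i : ℕ} (h : c ≤ i) : stairTime M w c i = 0 := by
  rw [stairTime, Nat.sub_eq_zero_of_le h, lppTime]

theorem stairTime_antitone {M c : ℕ} (hc : c ≤ M) {w : ℕ × ℕ → ℝ} (hw : ∀ q, 0 ≤ w q) :
    Antitone (stairTime M w c) := by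
  refine antitone_nat_of_succ_le fun i => ?_
  rcases le_or_gt c i with h | h
  · rw [stairTime_eq_zero _ _ h, stairTime_eq_zero _ _ (by omega)]
  · obtain ⟨k, rfl⟩ : ∃ k, c = k + 1 := ⟨c - 1, by omega⟩
    rw [stairTime_succ M w (by omega : i ≤ k) (by omega)]
    exact (le_max_right _ _).trans (le_add_of_nonneg_left (hw _))

/-! ### The joint distribution of last passage times -/

theorem cutAt_le {i j : ℕ} (hij : i ≤ j) {y : ℝ} {x : ℕ → ℝ} : cutAt i y x j ≤ y := by
  rw [cutAt, if_neg (not_lt.2 hij)]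
  exact min_le_right _ _

theorem cutAt_nonneg {i : ℕ} {y : ℝ} (hy : 0 ≤ y) {x : ℕ → ℝ} (hx : ∀ j, 0 ≤ x j) (j : ℕ) :
    0 ≤ cutAt i y x j := by
  unfold cutAt
  split_ifs
  exacts [hx j, le_min (hx j) hy]

/-- The distribution function after one coordinate `V i` has been replaced by
`w + max (V i) (V (i + 1))`, with an independent exponential variable `w`. -/
theorem measureReal_update_le {Ω : Type*} [MeasurableSpace Ω] {P : Measure Ω}
    [IsProbabilityMeasure P] {V : Ω → ℕ → ℝ} {w : Ω → ℝ} {r : ℝ} (hr : 0 < r) (hV : Measurable V)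
    (hw : Measurable w) (hind : IndepFun V w P) (hlaw : P.map w = expMeasure r) (i : ℕ)
    (hV0 : ∀ ω j, 0 ≤ V ω j) (hVi : ∀ ω j, i + 1 ≤ j → V ω j ≤ V ω (i + 1)) {x : ℕ → ℝ}
    (hx0 : ∀ j, 0 ≤ x j) :
    P.real {ω | ∀ j, Function.update (V ω) i (w ω + max (V ω i) (V ω (i + 1))) j ≤ x j} =
      r * Real.exp (-(r * x i)) *
        ∫ y in (0 : ℝ)..x i, Real.exp (r * y) * P.real {ω | ∀ j, V ω j ≤ cutAt i y x j} := by
  have : IsProbabilityMeasure (expMeasure r) := isProbabilityMeasure_expMeasure hr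
  set S : Set ((ℕ → ℝ) × ℝ) :=
    {q | ∀ j, Function.update q.1 i (q.2 + max (q.1 i) (q.1 (i + 1))) j ≤ x j} with hS
  have hSm : MeasurableSet S := by
    rw [hS, ofPred_forall]
    refine MeasurableSet.iInter fun j => measurableSet_le ?_ measurable_const
    by_cases hj : j = i
    · subst hj; simp only [Function.update_self]; fun_prop
    · simp only [Function.update_of_ne hj]; fun_prop
  set h : ℝ → ℝ := fun t => P.real {ω | (V ω, t) ∈ S} with hh
  have h1 : P.real {ω | (V ω, w ω) ∈ S} = ∫ t, h t ∂(expMeasure r) := by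
    have e1 : P {ω | (V ω, w ω) ∈ S} = ((P.map V).prod (expMeasure r)) S := by
      rw [← hlaw, ← (indepFun_iff_map_prod_eq_prod_map_map hV.aemeasurable hw.aemeasurable).1 hind,
        Measure.map_apply (hV.prodMk hw) hSm]
      rfl
    have e2 : ∀ t, (P.map V) ((fun v => (v, t)) ⁻¹' S) = P {ω | (V ω, t) ∈ S} := fun t => by
      rw [Measure.map_apply hV (measurable_prodMk_right hSm)]; rfl
    have : IsProbabilityMeasure (P.map V) := Measure.isProbabilityMeasure_map hV.aemeasurable
    rw [Measure.real, e1, Measure.prod_apply_symm hSm, ← integral_toReal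
      (measurable_measure_prodMk_right hSm).aemeasurable (Filter.Eventually.of_forall fun t =>
        measure_lt_top _ _)]
    exact integral_congr_ae (Filter.Eventually.of_forall fun t => by simp only [e2, hh, Measure.real])
  have h2 : ∫ t, h t ∂(expMeasure r) = ∫ t in Icc 0 (x i), r * Real.exp (-(r * t)) * h t := by
    have : expMeasure r = volume.withDensity (exponentialPDF r) := rfl
    rw [this, integral_withDensity_eq_integral_toReal_smul (by unfold exponentialPDF; fun_prop)
      (Filter.Eventually.of_forall fun t => by simp [exponentialPDF]),
      ← integral_indicator measurableSet_Icc]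
    refine integral_congr_ae (Filter.Eventually.of_forall fun t => ?_)
    simp only [smul_eq_mul, exponentialPDF_eq]
    by_cases ht : 0 ≤ t
    · rw [if_pos ht, ENNReal.toReal_ofReal (by positivity)]
      by_cases ht' : t ≤ x i
      · rw [indicator_of_mem (show t ∈ Icc 0 (x i) from ⟨ht, ht'⟩)]
      · rw [indicator_of_notMem fun h => ht' h.2]
        have : {ω | (V ω, t) ∈ S} = ∅ := by
          refine eq_empty_of_forall_notMem fun ω hω => ht' ?_
          have h1 := hω i
          simp only [Function.update_self] at h1
          have h2 := le_max_left (V ω i) (V ω (i + 1))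
          have h3 := hV0 ω i
          linarith
        simp [hh, this]
    · rw [if_neg ht, indicator_of_notMem fun h => ht h.1]; simp
  have h3 : ∀ t ∈ Icc 0 (x i), h t = P.real {ω | ∀ j, V ω j ≤ cutAt i (x i - t) x j} := by
    intro t ht
    simp only [hh]
    congr 1
    ext ω
    simp only [hS, mem_ofPred_eq]
    refine ⟨fun hv j => ?_, fun hv j => ?_⟩
    · have hi := hv i
      simp only [Function.update_self] at hi
      have hi1 := le_max_left (V ω i) (V ω (i + 1))
      have hi2 := le_max_right (V ω i) (V ω (i + 1))
      have ht0 := ht.1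
      unfold cutAt
      split_ifs with hj
      · simpa [Function.update_of_ne hj.ne] using hv j
      · rcases eq_or_ne j i with rfl | hji
        · exact le_min (by linarith) (by linarith)
        · refine le_min (by simpa [Function.update_of_ne hji] using hv j) ?_
          have := hVi ω j (by omega)
          linarith
    · rcases eq_or_ne j i with rfl | hji
      · rw [Function.update_self]
        have h1 := (hv j).trans (cutAt_le le_rfl)
        have h2 := (hv (j + 1)).trans (cutAt_le (by omega : j ≤ j + 1))
        have := max_le h1 h2
        linarith
      · rw [Function.update_of_ne hji]
        refine (hv j).trans ?_
        unfold cutAt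
        split_ifs
        exacts [le_rfl, min_le_left _ _]
  have h4 := intervalIntegral.integral_comp_sub_left (a := 0) (b := x i)
    (fun y => Real.exp (r * y) * P.real {ω | ∀ j, V ω j ≤ cutAt i y x j}) (x i)
  rw [sub_self, sub_zero] at h4
  refine h1.trans (h2.trans ?_)
  rw [← h4, ← intervalIntegral.integral_const_mul, intervalIntegral.integral_of_le (hx0 i),
    integral_Icc_eq_integral_Ioc]
  refine setIntegral_congr_fun measurableSet_Ioc fun t ht => ?_
  rw [h3 t ⟨ht.1.le, ht.2⟩, show -(r * t) = -(r * x i) + r * (x i - t) by ring, Real.exp_add]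
  ring

/-- The sites of the staircase of size `M`. -/
def staircase (M : ℕ) : Set (ℕ × ℕ) := {p | 1 ≤ p.1 ∧ 1 ≤ p.2 ∧ p.1 + p.2 ≤ M + 1}

theorem finite_staircase (M : ℕ) : (staircase M).Finite :=
  (Set.finite_Icc (0 : ℕ × ℕ) (M + 1, M + 1)).subset fun p hp => by
    obtain ⟨_, _, h⟩ := hp
    exact ⟨bot_le, by simp only; omega, by simp only; omega⟩

/-- The last passage times along the frontier, when column `k` has been processed from the bottom up
to (and including) row `m`. -/
def frontierTime (M k m : ℕ) (w : ℕ × ℕ → ℝ) (j : ℕ) : ℝ :=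
  stairTime M w (if m ≤ j then k + 1 else k) j

theorem frontierTime_eq_update (M : ℕ) (w : ℕ × ℕ → ℝ) {i k : ℕ} (hik : i ≤ k) (hk : k < M) :
    frontierTime M k i w = Function.update (frontierTime M k (i + 1) w) i
      (w (i + 1, M - k) +
        max (frontierTime M k (i + 1) w i) (frontierTime M k (i + 1) w (i + 1))) := by
  funext j
  rcases eq_or_ne j i with rfl | hj
  · rw [Function.update_self]
    simp only [frontierTime, le_refl, if_true, if_neg (show ¬ j + 1 ≤ j by omega)]
    exact stairTime_succ M w hik hk
  · rw [Function.update_of_ne hj]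
    simp only [frontierTime]
    congr 2
    simp only [eq_iff_iff]
    omega

/-- The frontier before the site in row `i` and column `k` is processed does not involve the weight
of that site, nor weights outside the staircase. -/
theorem frontierTime_congr {M i k : ℕ} (hik : i ≤ k) (hk : k < M) {w w' : ℕ × ℕ → ℝ}
    (h : ∀ q ∈ staircase M, q ≠ (i + 1, M - k) → w q = w' q) :
    frontierTime M k (i + 1) w = frontierTime M k (i + 1) w' := by
  funext j
  unfold frontierTime stairTime
  refine lppTime_congr _ _ fun q h1 h2 h3 => h q ?_ ?_
  · split_ifs at h1 h2 h3 <;> simp only at h1 h2 h3 <;> refine ⟨?_, ?_, ?_⟩ <;> omega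
  · rintro rfl
    split_ifs at h1 h2 h3 <;> simp only at h1 h2 h3 <;> omega

theorem indepFun_frontierTime {Ω : Type*} [MeasurableSpace Ω] {P : Measure Ω} {M : ℕ}
    {W : ℕ × ℕ → Ω → ℝ} (hWm : ∀ p, Measurable (W p))
    (hind : iIndepFun (fun p : staircase M => W p) P) {i k : ℕ} (hik : i ≤ k) (hk : k < M) :
    IndepFun (fun ω => frontierTime M k (i + 1) fun p => W p ω) (W (i + 1, M - k)) P := by
  classical
  have := (finite_staircase M).fintype
  have hp0 : (i + 1, M - k) ∈ staircase M := ⟨by simp, by simp only; omega, by simp only; omega⟩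
  set p0 : staircase M := ⟨_, hp0⟩ with hp0d
  have h := hind.indepFun_finset (Finset.univ.erase p0) {p0} (by simp) fun p => hWm p
  set φ : (↥(Finset.univ.erase p0) → ℝ) → ℕ → ℝ := fun v =>
    frontierTime M k (i + 1) fun q =>
      if h : ∃ hq : q ∈ staircase M, (⟨q, hq⟩ : staircase M) ∈ Finset.univ.erase p0 then
        v ⟨⟨q, h.1⟩, h.2⟩ else 0 with hφ
  have hφm : Measurable φ := by
    refine measurable_pi_lambda _ fun j => measurable_lppTime (fun q => ?_) _ _
    split_ifs
    · exact measurable_pi_apply _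
    · exact measurable_const
  have h2 := h.comp hφm
    (measurable_pi_apply (⟨p0, by simp⟩ : ({p0} : Finset (staircase M))))
  refine h2.congr (Filter.Eventually.of_forall fun ω => ?_) (Filter.Eventually.of_forall fun ω => rfl)
  simp only [Function.comp, hφ]
  refine frontierTime_congr hik hk fun q hq hne => ?_
  rw [dif_pos ⟨hq, by simp [hp0d, Subtype.ext_iff, hne]⟩]

theorem cdfDet_congr {M : ℕ} (a : ℕ → ℝ) {c c' : ℕ → ℕ}
    (h : ∀ j < M, c j = c' j ∨ (c j ≤ j ∧ c' j ≤ j)) (x : ℕ → ℝ) :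
    cdfDet M a c x = cdfDet M a c' x := by
  unfold cdfDet
  congr 1
  ext j l
  rcases h j j.2 with h | ⟨h, h'⟩
  · simp [h]
  · simp [cdfRow, h, h']

/-- The joint distribution function of the last passage times from one column of the staircase, on
ordered thresholds, is a determinant. The sites are added one at a time, column by column and from
bottom to top within a column. -/
theorem measureReal_stairTime_le {Ω : Type*} [MeasurableSpace Ω] {P : Measure Ω}
    [IsProbabilityMeasure P] {M : ℕ} {a : ℕ → ℝ} (ha : ∀ i < M, 0 < a i) {W : ℕ × ℕ → Ω → ℝ}
    (hWm : ∀ p, Measurable (W p)) (hW0 : ∀ p ω, 0 ≤ W p ω)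
    (hind : iIndepFun (fun p : staircase M => W p) P)
    (hlaw : ∀ i k, i ≤ k → k < M → P.map (W (i + 1, M - k)) = expMeasure (a i + a k))
    (k : ℕ) : k ≤ M → ∀ x : ℕ → ℝ, Antitone x → (∀ j, 0 ≤ x j) →
      P.real {ω | ∀ j, stairTime M (fun p => W p ω) k j ≤ x j} *
        ∏ j ∈ Finset.range M, idleEntry M a j =
      (∏ k' ∈ Finset.range k, ∏ i ∈ Finset.range (k' + 1), (a i + a k')) *
        cdfDet M a (fun _ => k) x := by
  induction k with
  | zero =>
    intro _ x _ hx0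
    have : {ω | ∀ j, stairTime M (fun p => W p ω) 0 j ≤ x j} = univ :=
      eq_univ_of_forall fun ω j => by rw [stairTime_eq_zero _ _ (Nat.zero_le j)]; exact hx0 j
    rw [this, cdfDet_zero]
    simp
  | succ k ihk =>
    intro hkM
    have inner : ∀ d ≤ k + 1, ∀ x : ℕ → ℝ, Antitone x → (∀ j, 0 ≤ x j) →
        P.real {ω | ∀ j, frontierTime M k (k + 1 - d) (fun p => W p ω) j ≤ x j} *
          ∏ j ∈ Finset.range M, idleEntry M a j =
        (∏ k' ∈ Finset.range k, ∏ i ∈ Finset.range (k' + 1), (a i + a k')) *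
          (∏ i ∈ Finset.Ico (k + 1 - d) (k + 1), (a i + a k)) *
          cdfDet M a (fun j => if k + 1 - d ≤ j then k + 1 else k) x := by
      intro d
      induction d with
      | zero =>
        intro _ x hx hx0
        have h1 : ∀ w, frontierTime M k (k + 1 - 0) w = stairTime M w k := fun w => by
          funext j
          unfold frontierTime
          split_ifs with h
          · rw [stairTime_eq_zero _ _ (by omega), stairTime_eq_zero _ _ (by omega)]
          · rfl
        have h2 : cdfDet M a (fun j => if k + 1 - 0 ≤ j then k + 1 else k) x =
            cdfDet M a (fun _ => k) x := by
          refine cdfDet_congr a (fun j _ => ?_) x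
          by_cases h : k + 1 ≤ j
          · right; rw [Nat.sub_zero, if_pos h]; omega
          · left; rw [Nat.sub_zero, if_neg h]
        simp only [h1, h2]
        rw [ihk (by omega) x hx hx0]
        simp
      | succ d ihd =>
        intro hd x hx hx0
        obtain ⟨i, hi, hik⟩ : ∃ i, k + 1 - d = i + 1 ∧ i ≤ k := ⟨k - d, by omega, by omega⟩
        have hi' : k + 1 - (d + 1) = i := by omega
        rw [hi] at ihd
        rw [hi']
        have hr : 0 < a i + a k := add_pos (ha i (by omega)) (ha k (by omega))
        have hVm : Measurable fun ω => frontierTime M k (i + 1) fun p => W p ω :=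
          measurable_pi_lambda _ fun j => measurable_lppTime (fun q => hWm q) _ _
        have hstep := measureReal_update_le hr hVm (hWm (i + 1, M - k))
          (indepFun_frontierTime hWm hind hik (by omega)) (hlaw i k hik (by omega)) i
          (fun ω j => lppTime_nonneg (fun q => hW0 q ω) _ _)
          (fun ω j hj => by
            simp only [frontierTime, if_pos hj, le_refl, if_true]
            exact stairTime_antitone (by omega) (fun q => hW0 q ω) hj) hx0
        simp only [← frontierTime_eq_update M _ hik (show k < M by omega)] at hstep
        have hint : (∫ y in (0 : ℝ)..x i, Real.exp ((a i + a k) * y) *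
              P.real {ω | ∀ j, frontierTime M k (i + 1) (fun p => W p ω) j ≤ cutAt i y x j}) *
              ∏ j ∈ Finset.range M, idleEntry M a j =
            (∏ k' ∈ Finset.range k, ∏ i ∈ Finset.range (k' + 1), (a i + a k')) *
              (∏ i ∈ Finset.Ico (i + 1) (k + 1), (a i + a k)) *
              (Real.exp ((a i + a k) * x i) *
                cdfDet M a (fun j => if i ≤ j then k + 1 else k) x) := by
          rw [exp_mul_cdfDet a hik (by omega) hx hx0, ← intervalIntegral.integral_mul_const,
            ← intervalIntegral.integral_const_mul]
          refine intervalIntegral.integral_congr fun y hy => ?_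
          rw [uIcc_of_le (hx0 i)] at hy
          have := ihd (by omega) (cutAt i y x) (antitone_cutAt hx) (cutAt_nonneg hy.1 hx0)
          rw [mul_assoc, this]
          ring
        rw [hstep, mul_assoc, hint, Finset.prod_eq_prod_Ico_succ_bot (by omega : i < k + 1)]
        have he : Real.exp (-((a i + a k) * x i)) * Real.exp ((a i + a k) * x i) = 1 := by
          rw [← Real.exp_add]; simp
        generalize (∏ k' ∈ Finset.range k, ∏ i ∈ Finset.range (k' + 1), (a i + a k')) = R
        generalize (∏ i ∈ Finset.Ico (i + 1) (k + 1), (a i + a k)) = R'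
        generalize cdfDet M a (fun j => if i ≤ j then k + 1 else k) x = D
        linear_combination ((a i + a k) * R * R' * D) * he
    intro x hx hx0
    have h := inner (k + 1) le_rfl x hx hx0
    simp only [Nat.sub_self, Nat.zero_le, if_true, frontierTime] at h
    rw [h, Finset.prod_range_succ, ← Finset.range_eq_Ico]

theorem measureReal_lppTime_le {Ω : Type*} [MeasurableSpace Ω] {P : Measure Ω}
    [IsProbabilityMeasure P] {M : ℕ} {a : ℕ → ℝ} (ha : ∀ i < M, 0 < a i) {W : ℕ × ℕ → Ω → ℝ}
    (hWm : ∀ p, Measurable (W p)) (hW0 : ∀ p ω, 0 ≤ W p ω)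
    (hind : iIndepFun (fun p : staircase M => W p) P)
    (hlaw : ∀ i k, i ≤ k → k < M → P.map (W (i + 1, M - k)) = expMeasure (a i + a k))
    {u : ℝ} (hu : 0 ≤ u) :
    P.real {ω | lppTime M (fun p => W p ω) (1, 1) ≤ u} *
        ∏ j ∈ Finset.range M, idleEntry M a j =
      (∏ k ∈ Finset.range M, ∏ i ∈ Finset.range (k + 1), (a i + a k)) *
        cdfDet M a (fun _ => M) (fun _ => u) := by
  rw [← measureReal_stairTime_le ha hWm hW0 hind hlaw M le_rfl (fun _ => u) antitone_const
    fun _ => hu]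
  congr 3
  ext ω
  have h0 : stairTime M (fun p => W p ω) M 0 = lppTime M (fun p => W p ω) (1, 1) := by
    simp [stairTime]
  simp only [← h0]
  exact ⟨fun h j => (stairTime_antitone le_rfl (fun q => hW0 q ω) (Nat.zero_le j)).trans h,
    fun h => h 0⟩

/-! ### From a Wronskian of size `2N` to a Cauchy-like determinant of size `N` -/

/-- The constant relating a confluent determinant of size `2N` to a Cauchy-like determinant of
size `N`. -/
noncomputable def cauchyFactor {N : ℕ} (x y : Fin N → ℝ) : ℝ :=
  (∏ k, (Lagrange.nodal Finset.univ y).eval (x k)) *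
    (∏ j, Lagrange.nodalWeight Finset.univ y j) * (Matrix.vandermonde y).det ^ 2

/-- A determinant whose rows are `(f v(x), g v(x))`, where `v(x) = (1, x, …, x ^ (N - 1))`, taken at
the `2N` nodes `x` and `y`. Expressing `v(x k)` through the `v(y j)` by Lagrange interpolation makes
the two lower blocks diagonal, and leaves a Schur complement. -/
theorem det_double_vandermonde {N : ℕ} (x y f g f' g' : Fin N → ℝ) (hy : Function.Injective y)
    (hxy : ∀ k j, x k ≠ y j) (hg' : ∀ j, g' j ≠ 0) :
    (Matrix.fromBlocks (Matrix.of fun k p : Fin N => f k * x k ^ (p : ℕ))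
      (Matrix.of fun k p : Fin N => g k * x k ^ (p : ℕ))
      (Matrix.of fun j p : Fin N => f' j * y j ^ (p : ℕ))
      (Matrix.of fun j p : Fin N => g' j * y j ^ (p : ℕ))).det =
    cauchyFactor x y *
      (Matrix.of fun k j : Fin N => (f k * g' j - g k * f' j) / (x k - y j)).det := by
  set L : Matrix (Fin N) (Fin N) ℝ := Matrix.of fun k j =>
    (Lagrange.nodal Finset.univ y).eval (x k) *
      (Lagrange.nodalWeight Finset.univ y j * (x k - y j)⁻¹) with hL
  set V := Matrix.vandermonde y with hV
  have hLV : ∀ k p : Fin N, (L * V) k p = x k ^ (p : ℕ) := by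
    intro k p
    have h1 := Lagrange.eq_interpolate (s := Finset.univ) (v := y) (f := Polynomial.X ^ (p : ℕ))
      hy.injOn (by
        rw [Polynomial.degree_X_pow, Finset.card_univ, Fintype.card_fin]
        exact_mod_cast p.2)
    have h2 := congrArg (Polynomial.eval (x k)) h1
    rw [Lagrange.eval_interpolate_not_at_node _ (fun i _ => hxy k i)] at h2
    simp only [Polynomial.eval_pow, Polynomial.eval_X] at h2
    rw [h2, Matrix.mul_apply, Finset.mul_sum]
    refine Finset.sum_congr rfl fun j _ => ?_
    simp only [hL, hV, Matrix.of_apply, Matrix.vandermonde_apply]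
    ring
  have hfact : Matrix.fromBlocks (Matrix.of fun k p : Fin N => f k * x k ^ (p : ℕ))
      (Matrix.of fun k p : Fin N => g k * x k ^ (p : ℕ))
      (Matrix.of fun j p : Fin N => f' j * y j ^ (p : ℕ))
      (Matrix.of fun j p : Fin N => g' j * y j ^ (p : ℕ)) =
      Matrix.fromBlocks (Matrix.diagonal f * L) (Matrix.diagonal g * L) (Matrix.diagonal f')
        (Matrix.diagonal g') * Matrix.fromBlocks V 0 0 V := by
    rw [Matrix.fromBlocks_multiply]
    simp only [Matrix.mul_zero, add_zero, zero_add, Matrix.mul_assoc]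
    congr 1 <;> ext k p
    · simp [Matrix.diagonal_mul, hLV]
    · simp [Matrix.diagonal_mul, hLV]
    · simp [Matrix.diagonal_mul, hV, Matrix.vandermonde_apply]
    · simp [Matrix.diagonal_mul, hV, Matrix.vandermonde_apply]
  have hdet : (Matrix.fromBlocks (Matrix.diagonal f * L) (Matrix.diagonal g * L)
      (Matrix.diagonal f') (Matrix.diagonal g')).det =
      (Matrix.of fun k j : Fin N => L k j * (f k * g' j - g k * f' j)).det := by
    have : Invertible g' := ⟨fun j => (g' j)⁻¹, funext fun j => inv_mul_cancel₀ (hg' j),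
      funext fun j => mul_inv_cancel₀ (hg' j)⟩
    have : Invertible (Matrix.diagonal g') := Matrix.diagonalInvertible g'
    rw [Matrix.det_fromBlocks₂₂, mul_comm, ← Matrix.det_mul]
    congr 1
    rw [sub_mul, Matrix.mul_assoc _ (Matrix.diagonal f'),
      show Matrix.diagonal f' * Matrix.diagonal g' = Matrix.diagonal g' * Matrix.diagonal f' by
        rw [Matrix.diagonal_mul_diagonal, Matrix.diagonal_mul_diagonal]; simp [mul_comm],
      ← Matrix.mul_assoc, Matrix.mul_assoc _ (⅟(Matrix.diagonal g')), invOf_mul_self,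
      Matrix.mul_one]
    ext k j
    simp only [Matrix.sub_apply, Matrix.mul_diagonal, Matrix.diagonal_mul, Matrix.of_apply]
    ring
  rw [hfact, Matrix.det_mul, hdet, Matrix.det_fromBlocks_zero₁₂, cauchyFactor]
  have h3 : (Matrix.of fun k j : Fin N => L k j * (f k * g' j - g k * f' j)) =
      Matrix.of fun k j => (Lagrange.nodal Finset.univ y).eval (x k) *
        (Matrix.of fun k j => Lagrange.nodalWeight Finset.univ y j *
          (Matrix.of fun k j : Fin N => (f k * g' j - g k * f' j) / (x k - y j)) k j) k j := by
    ext k j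
    simp only [hL, Matrix.of_apply, div_eq_mul_inv]
    ring
  rw [h3, Matrix.det_mul_column, Matrix.det_mul_row]
  ring

/-- The function `Ĥ` at real arguments. -/
noncomputable def realHhat (u x y : ℝ) : ℝ :=
  Real.exp (-2 * u * x) / (y - x) + Real.exp (-2 * u * y) / (x - y) +
    Real.exp (-2 * u * (x + y)) / (x + y)

open Polynomial in
/-- Splitting a polynomial into its even and its odd part. -/
theorem eval_eq_sum_even_odd {N : ℕ} {q : ℝ[X]} (hq : q.natDegree < 2 * N) (b : ℝ) :
    q.eval b = ∑ p : Fin N, q.coeff (2 * p) * (b ^ 2) ^ (p : ℕ) +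
      ∑ p : Fin N, q.coeff (2 * p + 1) * ((b ^ 2) ^ (p : ℕ) * b) := by
  have hsplit : ∀ (n : ℕ) (f : ℕ → ℝ), ∑ i ∈ Finset.range (2 * n), f i =
      ∑ p ∈ Finset.range n, f (2 * p) + ∑ p ∈ Finset.range n, f (2 * p + 1) := by
    intro n f
    induction n with
    | zero => simp
    | succ n ih =>
      rw [show 2 * (n + 1) = 2 * n + 1 + 1 by ring, Finset.sum_range_succ, Finset.sum_range_succ,
        ih, Finset.sum_range_succ, Finset.sum_range_succ]
      ring
  rw [eval_eq_sum_range' hq, hsplit, Finset.sum_range, Finset.sum_range]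
  simp only [pow_succ, pow_mul]

open Polynomial in
/-- If a number is the ratio of a Wronskian of the `2 sinh (a_i u)` to a Vandermonde determinant, up
to exponential factors, then it is a ratio of Cauchy-like determinants. -/
theorem mul_det_cauchy_eq {N : ℕ} {α β : Fin N → ℝ} (hα : ∀ k, 0 < α k) (hβ : ∀ j, 0 < β j)
    (hβi : Function.Injective β) (hαβ : ∀ k j, α k ≠ β j) {a : Fin N ⊕ Fin N → ℝ}
    (hal : ∀ k, a (Sum.inl k) = α k) (har : ∀ j, a (Sum.inr j) = β j)
    {q : Fin N ⊕ Fin N → ℝ[X]} (hq : ∀ i, (q i).natDegree < 2 * N) {u prob : ℝ}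
    (hne : (Matrix.of fun i l => (q i).eval (a l)).det ≠ 0)
    (h : prob * (Matrix.of fun i l => (q i).eval (a l)).det =
      Real.exp (-(u * ∑ i, a i)) * (Matrix.of fun i l => polySinh (q i) (a l) u).det) :
    prob * (Matrix.of fun k j => 1 / (α k + β j)).det =
      (Matrix.of fun k j => 1 / (α k + β j) - realHhat u (α k) (β j)).det := by
  set T : Matrix (Fin N ⊕ Fin N) (Fin N ⊕ Fin N) ℝ := Matrix.of fun i =>
    Sum.elim (fun p : Fin N => (q i).coeff (2 * p)) (fun p : Fin N => (q i).coeff (2 * p + 1))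
    with hT
  set Z : (ℝ → ℝ) → (ℝ → ℝ) → Matrix (Fin N ⊕ Fin N) (Fin N ⊕ Fin N) ℝ := fun f g =>
    Matrix.fromBlocks (Matrix.of fun k p : Fin N => f (α k) * (α k ^ 2) ^ (p : ℕ))
      (Matrix.of fun k p : Fin N => g (α k) * (α k ^ 2) ^ (p : ℕ))
      (Matrix.of fun j p : Fin N => f (β j) * (β j ^ 2) ^ (p : ℕ))
      (Matrix.of fun j p : Fin N => g (β j) * (β j ^ 2) ^ (p : ℕ)) with hZ
  have hZa : ∀ f g i l, (T * (Z f g).transpose) i l =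
      ∑ p : Fin N, (q i).coeff (2 * p) * (f (a l) * (a l ^ 2) ^ (p : ℕ)) +
      ∑ p : Fin N, (q i).coeff (2 * p + 1) * (g (a l) * (a l ^ 2) ^ (p : ℕ)) := by
    intro f g i l
    rw [Matrix.mul_apply, Fintype.sum_sum_type]
    rcases l with k | j <;> simp [hT, hZ, hal, har]
  have hZdet : ∀ f g : ℝ → ℝ, (∀ j, g (β j) ≠ 0) → (T * (Z f g).transpose).det =
      T.det * (cauchyFactor (fun k => α k ^ 2) (fun j => β j ^ 2) *
        (Matrix.of fun k j : Fin N =>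
          (f (α k) * g (β j) - g (α k) * f (β j)) / (α k ^ 2 - β j ^ 2)).det) := by
    intro f g hg
    rw [Matrix.det_mul, Matrix.det_transpose, hZ]
    simp only
    rw [det_double_vandermonde (fun k => α k ^ 2) (fun j => β j ^ 2) (fun k => f (α k))
      (fun k => g (α k)) (fun k => f (β k)) (fun k => g (β k)) _ _ hg]
    · intro i j hij
      exact hβi ((pow_left_inj₀ (hβ i).le (hβ j).le two_ne_zero).1 hij)
    · intro k j hkj
      exact hαβ k j ((pow_left_inj₀ (hα k).le (hβ j).le two_ne_zero).1 hkj)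
  clear_value Z T
  have hmat : ∀ (f g : ℝ → ℝ) (F : Fin N ⊕ Fin N → Fin N ⊕ Fin N → ℝ), (∀ i l, F i l =
      ∑ p : Fin N, (q i).coeff (2 * p) * (f (a l) * (a l ^ 2) ^ (p : ℕ)) +
      ∑ p : Fin N, (q i).coeff (2 * p + 1) * (g (a l) * (a l ^ 2) ^ (p : ℕ))) →
      Matrix.of F = T * (Z f g).transpose := fun f g F hF => by
    ext i l
    exact (hF i l).trans (hZa f g i l).symm
  have hA : (Matrix.of fun i l => (q i).eval (a l)) =
      T * (Z (fun _ => 1) fun b => b).transpose := by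
    refine hmat _ _ _ fun i l => ?_
    rw [eval_eq_sum_even_odd (hq i)]
    simp [mul_comm]
  have hB : (Matrix.of fun i l => polySinh (q i) (a l) u) =
      T * (Z (fun b => Real.exp (b * u) - Real.exp (-b * u))
        fun b => b * (Real.exp (b * u) + Real.exp (-b * u))).transpose := by
    refine hmat _ _ _ fun i l => ?_
    rw [polySinh, eval_eq_sum_even_odd (hq i),
      eval_eq_sum_even_odd (hq i) (-a l), add_mul, add_mul, add_sub_add_comm]
    simp only [Finset.sum_mul, ← Finset.sum_sub_distrib, neg_sq]
    congr 1 <;> refine Finset.sum_congr rfl fun p _ => by ring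
  rw [hA, hZdet _ _ (fun j => (hβ j).ne')] at hne
  rw [hA, hB, hZdet _ _ (fun j => (hβ j).ne'), hZdet _ _ (fun j => by
    have := hβ j; positivity)] at h
  have hc : T.det * cauchyFactor (fun k => α k ^ 2) (fun j => β j ^ 2) ≠ 0 := fun h0 => hne (by
    rw [← mul_assoc, h0, zero_mul])
  have hexp : Real.exp (-(u * ∑ i, a i)) =
      (∏ k, Real.exp (-(u * α k))) * ∏ j, Real.exp (-(u * β j)) := by
    rw [← Real.exp_sum, ← Real.exp_sum, ← Real.exp_add, Fintype.sum_sum_type]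
    simp [hal, har, Finset.mul_sum, mul_add]
    ring
  have h1 : (Matrix.of fun k j : Fin N => (1 * β j - α k * 1) / (α k ^ 2 - β j ^ 2)) =
      -(Matrix.of fun k j => 1 / (α k + β j)) := by
    ext k j
    have e1 := sub_ne_zero.2 (hαβ k j)
    have e2 := (add_pos (hα k) (hβ j)).ne'
    simp only [Matrix.of_apply, Matrix.neg_apply]
    rw [show α k ^ 2 - β j ^ 2 = (α k - β j) * (α k + β j) by ring]
    field_simp
    ring
  set D := Matrix.of fun k j : Fin N =>
    ((Real.exp (α k * u) - Real.exp (-α k * u)) * (β j * (Real.exp (β j * u) + Real.exp (-β j * u)))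
      - α k * (Real.exp (α k * u) + Real.exp (-α k * u)) *
        (Real.exp (β j * u) - Real.exp (-β j * u))) / (α k ^ 2 - β j ^ 2) with hD
  have h2 : (Matrix.of fun k j => Real.exp (-(u * α k)) *
      (Matrix.of fun k j => Real.exp (-(u * β j)) * D k j) k j) =
      -(Matrix.of fun k j => 1 / (α k + β j) - realHhat u (α k) (β j)) := by
    ext k j
    have e1 := sub_ne_zero.2 (hαβ k j)
    have e2 := (add_pos (hα k) (hβ j)).ne'
    have e3 := sub_ne_zero.2 (hαβ k j).symm
    have x1 : ∀ b, Real.exp (-(u * b)) * Real.exp (b * u) = 1 := fun b => by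
      rw [← Real.exp_add]; simp [mul_comm]
    have x2 : ∀ b, Real.exp (-(u * b)) * Real.exp (-b * u) = Real.exp (-2 * u * b) := fun b => by
      rw [← Real.exp_add]; ring_nf
    have x3 : Real.exp (-2 * u * (α k + β j)) =
        Real.exp (-2 * u * α k) * Real.exp (-2 * u * β j) := by
      rw [← Real.exp_add]; ring_nf
    have num : Real.exp (-(u * α k)) * (Real.exp (-(u * β j)) *
        ((Real.exp (α k * u) - Real.exp (-α k * u)) *
        (β j * (Real.exp (β j * u) + Real.exp (-β j * u)))
      - α k * (Real.exp (α k * u) + Real.exp (-α k * u)) *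
        (Real.exp (β j * u) - Real.exp (-β j * u)))) =
        (1 - Real.exp (-2 * u * α k)) * (β j * (1 + Real.exp (-2 * u * β j))) -
        α k * (1 + Real.exp (-2 * u * α k)) * (1 - Real.exp (-2 * u * β j)) := by
      rw [← x2, ← x2]
      set p := Real.exp (-(u * α k))
      set r := Real.exp (-(u * β j))
      set p' := Real.exp (-α k * u)
      set r' := Real.exp (-β j * u)
      linear_combination (β j * (r * Real.exp (β j * u) + r * r') -
          α k * (r * Real.exp (β j * u) - r * r')) * x1 (α k) +
        ((1 - p * p') * β j - α k * (1 + p * p')) * x1 (β j)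
    simp only [hD, Matrix.of_apply, Matrix.neg_apply, realHhat]
    rw [mul_div_assoc', mul_div_assoc', num, x3,
      show α k ^ 2 - β j ^ 2 = (α k - β j) * (α k + β j) by ring,
      show β j - α k = -(α k - β j) by ring]
    field_simp
    ring
  have h3 := congrArg Matrix.det h2
  rw [Matrix.det_mul_column, Matrix.det_mul_row, Matrix.det_neg] at h3
  rw [h1, hexp, Matrix.det_neg] at h
  have h4 : T.det * cauchyFactor (fun k => α k ^ 2) (fun j => β j ^ 2) *
      (-1) ^ Fintype.card (Fin N) ≠ 0 := mul_ne_zero hc (pow_ne_zero _ (by norm_num))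
  refine mul_left_cancel₀ h4 ?_
  linear_combination h + (T.det * cauchyFactor (fun k => α k ^ 2) (fun j => β j ^ 2)) * h3

/-- The parameters `α_1, …, α_N, β_N, …, β_1` in a row. The site in row `i` and column `k` of the
staircase has rate `a i + a k`. -/
def joinedRate (N : ℕ) (α β : ℕ → ℝ) (i : ℕ) : ℝ := if i < N then α (i + 1) else β (2 * N - i)

theorem weightRate_eq_joinedRate {N : ℕ} (α β : ℕ → ℝ) {i k : ℕ} (hik : i ≤ k) (hk : k < 2 * N) :
    weightRate N α β (i + 1, 2 * N - k) = joinedRate N α β i + joinedRate N α β k := by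
  unfold weightRate joinedRate
  simp only
  by_cases hi : i < N
  · by_cases hkN : k < N
    · rw [if_pos (by omega), if_neg (by omega), if_pos hi, if_pos hkN,
        show 2 * N + 1 - (2 * N - k) = k + 1 by omega]
    · rw [if_pos (by omega), if_pos (by omega), if_pos hi, if_neg hkN]
  · rw [if_neg (by omega), if_neg hi, if_neg (by omega),
      show 2 * N + 1 - (i + 1) = 2 * N - i by omega]

open Polynomial in
/-- The distribution function of the last passage time is a ratio of a Wronskian of hyperbolic sines
and a Vandermonde determinant, each written in a basis of polynomials vanishing at an increasing
set of the nodes. -/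
theorem measureReal_lppTime_mul_det {Ω : Type*} [MeasurableSpace Ω] {P : Measure Ω}
    [IsProbabilityMeasure P] {M : ℕ} {a : ℕ → ℝ} (ha : ∀ i < M, 0 < a i) {W : ℕ × ℕ → Ω → ℝ}
    (hWm : ∀ p, Measurable (W p)) (hW0 : ∀ p ω, 0 ≤ W p ω)
    (hind : iIndepFun (fun p : staircase M => W p) P)
    (hlaw : ∀ i k, i ≤ k → k < M → P.map (W (i + 1, M - k)) = expMeasure (a i + a k))
    {u : ℝ} (hu : 0 ≤ u) :
    (Matrix.of fun i l : Fin M => (∏ m ∈ Finset.Ioo (i : ℕ) M, (X - C (a m))).eval (a l)).det =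
        ∏ i ∈ Finset.range M, ∏ m ∈ Finset.Ioo i M, (a i - a m) ∧
    P.real {ω | lppTime M (fun p => W p ω) (1, 1) ≤ u} *
      (Matrix.of fun i l : Fin M => (∏ m ∈ Finset.Ioo (i : ℕ) M, (X - C (a m))).eval (a l)).det =
    Real.exp (-(u * ∑ i : Fin M, a i)) *
      (Matrix.of fun i l : Fin M => polySinh (∏ m ∈ Finset.Ioo (i : ℕ) M, (X - C (a m))) (a l) u).det
    := by
  have hdet : (Matrix.of fun i l : Fin M =>
      (∏ m ∈ Finset.Ioo (i : ℕ) M, (X - C (a m))).eval (a l)).det =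
      ∏ i ∈ Finset.range M, ∏ m ∈ Finset.Ioo i M, (a i - a m) := by
    rw [Matrix.det_of_isLowerTriangular, Finset.prod_range]
    · simp [eval_prod]
    · intro i j hij
      have hij' : i < j := hij
      rw [Matrix.of_apply, eval_prod]
      exact Finset.prod_eq_zero (i := (j : ℕ)) (by simp [hij']) (by simp)
  refine ⟨hdet, ?_⟩
  have h := measureReal_lppTime_le ha hWm hW0 hind hlaw hu
  have hidle : ∏ j ∈ Finset.range M, idleEntry M a j =
      (∏ j ∈ Finset.range M, (2 * a j * ∏ m ∈ Finset.Ioo j M, (a j + a m))) *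
        ∏ i ∈ Finset.range M, ∏ m ∈ Finset.Ioo i M, (a i - a m) := by
    rw [← Finset.prod_mul_distrib]
    refine Finset.prod_congr rfl fun j _ => ?_
    rw [idleEntry, mul_assoc (2 * a j), ← Finset.prod_mul_distrib]
    congr 1
    exact Finset.prod_congr rfl fun m _ => by ring
  have hR : (∏ k ∈ Finset.range M, ∏ i ∈ Finset.range (k + 1), (a i + a k)) =
      ∏ j ∈ Finset.range M, (2 * a j * ∏ m ∈ Finset.Ioo j M, (a j + a m)) := by
    rw [Finset.prod_comm' (s' := fun i => Finset.Ico i M) (t' := Finset.range M)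
      (by intro k i; simp only [Finset.mem_range, Finset.mem_Ico]; omega)]
    refine Finset.prod_congr rfl fun j hj => ?_
    rw [Finset.prod_eq_prod_Ico_succ_bot (Finset.mem_range.1 hj), two_mul]
    congr 1
  have hcdf : cdfDet M a (fun _ => M) (fun _ => u) = Real.exp (-(u * ∑ i : Fin M, a i)) *
      (Matrix.of fun i l : Fin M =>
        polySinh (∏ m ∈ Finset.Ioo (i : ℕ) M, (X - C (a m))) (a l) u).det := by
    have : (Matrix.of fun j l : Fin M => cdfRow M a M j l u) = Matrix.of fun j l : Fin M =>
        Real.exp (-(a j * u)) * (Matrix.of fun i l : Fin M =>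
        polySinh (∏ m ∈ Finset.Ioo (i : ℕ) M, (X - C (a m))) (a l) u) j l := by
      ext j l
      simp [cdfRow, not_le.2 j.2, rowPoly]
    rw [cdfDet, this, Matrix.det_mul_column, ← Real.exp_sum, Finset.mul_sum,
      ← Finset.sum_neg_distrib]
    simp only [mul_comm u]
  rw [hR, hidle, hcdf] at h
  have hne : (∏ j ∈ Finset.range M, (2 * a j * ∏ m ∈ Finset.Ioo j M, (a j + a m))) ≠ 0 := by
    refine Finset.prod_ne_zero_iff.2 fun j hj => ?_
    have hj' := ha j (Finset.mem_range.1 hj)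
    refine mul_ne_zero (by positivity) (Finset.prod_ne_zero_iff.2 fun m hm => ?_)
    have := ha m (Finset.mem_Ioo.1 hm).2
    positivity
  rw [hdet]
  refine mul_left_cancel₀ hne ?_
  linear_combination h

open Polynomial in
/-- For pairwise distinct parameters, the distribution function of the point-to-line last passage
time is a ratio of two Cauchy-like determinants. -/
theorem measureReal_pointToLineTime_mul_det {Ω : Type*} [MeasurableSpace Ω] {P : Measure Ω}
    [IsProbabilityMeasure P] {N : ℕ} (hN : 1 ≤ N) {α β : ℕ → ℝ}
    (hα : ∀ i ∈ Finset.Icc 1 N, 0 < α i) (hβ : ∀ j ∈ Finset.Icc 1 N, 0 < β j)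
    (hαi : InjOn α (Finset.Icc 1 N)) (hβi : InjOn β (Finset.Icc 1 N))
    (hαβ : ∀ i ∈ Finset.Icc 1 N, ∀ j ∈ Finset.Icc 1 N, α i ≠ β j)
    {W : ℕ × ℕ → Ω → ℝ} (hWm : ∀ p, Measurable (W p)) (hW0 : ∀ p ω, 0 ≤ W p ω)
    (hind : iIndepFun (fun p : triangle N => W p) P)
    (hlaw : ∀ p ∈ triangle N, P.map (W p) = expMeasure (weightRate N α β p))
    {u : ℝ} (hu : 0 ≤ u) :
    P.real {ω | pointToLineTime (2 * N) (fun p => W p ω) ≤ u} *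
        (Matrix.of fun k j : Fin N => 1 / (α (k + 1) + β (j + 1))).det =
      (Matrix.of fun k j : Fin N =>
        1 / (α (k + 1) + β (j + 1)) - realHhat u (α (k + 1)) (β (j + 1))).det := by
  set a := joinedRate N α β with ha
  have hmem : ∀ k : Fin N, (k : ℕ) + 1 ∈ Finset.Icc 1 N := fun k => by
    have := k.2; simp only [Finset.mem_Icc]; omega
  have hapos : ∀ i < 2 * N, 0 < a i := fun i hi => by
    rw [ha, joinedRate]
    split_ifs
    · exact hα _ (by simp only [Finset.mem_Icc]; omega)
    · exact hβ _ (by simp only [Finset.mem_Icc]; omega)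
  have hainj : ∀ i < 2 * N, ∀ m < 2 * N, i < m → a i - a m ≠ 0 := fun i hi m hm him => by
    rw [sub_ne_zero, ha, joinedRate, joinedRate]
    split_ifs
    · exact fun h => absurd (hαi (by simp; omega) (by simp; omega) h) (by omega)
    · exact hαβ _ (by simp; omega) _ (by simp; omega)
    · omega
    · exact fun h => absurd (hβi (by simp; omega) (by simp; omega) h) (by omega)
  obtain ⟨hV, hP⟩ := measureReal_lppTime_mul_det (M := 2 * N) hapos hWm hW0 hind
    (fun i k hik hk => by
      rw [hlaw _ ⟨by simp, by simp only; omega, by simp only; omega⟩,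
        weightRate_eq_joinedRate α β hik hk]) hu
  set q : Fin (2 * N) → ℝ[X] := fun i => ∏ m ∈ Finset.Ioo (i : ℕ) (2 * N), (X - C (a m)) with hq
  have hVne : (Matrix.of fun i l : Fin (2 * N) => (q i).eval (a l)).det ≠ 0 := by
    rw [hV]
    refine Finset.prod_ne_zero_iff.2 fun i hi => Finset.prod_ne_zero_iff.2 fun m hm => ?_
    rw [Finset.mem_Ioo] at hm
    exact hainj i (Finset.mem_range.1 hi) m hm.2 hm.1
  have hfinj : Function.Injective (Sum.elim (fun k : Fin N => (⟨k, by omega⟩ : Fin (2 * N)))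
      (fun j : Fin N => (⟨2 * N - 1 - j, by omega⟩ : Fin (2 * N)))) := by
    rintro (k | k) (j | j) h <;> simp [Fin.ext_iff] at h ⊢ <;> omega
  set e : Fin N ⊕ Fin N ≃ Fin (2 * N) := Equiv.ofBijective _
    ((Fintype.bijective_iff_injective_and_card _).2 ⟨hfinj, by simp; ring⟩) with he
  have hel : ∀ k, a (e (Sum.inl k)) = α (k + 1) := fun k => by
    simp [he, ha, joinedRate]
  have her : ∀ j, a (e (Sum.inr j)) = β (j + 1) := fun j => by
    have := j.2
    simp only [he, ha, joinedRate, Equiv.ofBijective_apply, Sum.elim_inr]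
    rw [if_neg (by omega)]
    congr 1
    omega
  have hre : ∀ F : Fin (2 * N) → Fin (2 * N) → ℝ,
      (Matrix.of fun i l => F (e i) (e l)).det = (Matrix.of F).det := fun F =>
    Matrix.det_submatrix_equiv_self e (Matrix.of F)
  simp only [pointToLineTime_eq_lppTime (show 1 ≤ 2 * N by omega)]
  refine mul_det_cauchy_eq (a := fun i => a (e i)) (q := fun i => q (e i))
    (fun k => hα _ (hmem k)) (fun j => hβ _ (hmem j)) ?_ (fun k j => hαβ _ (hmem k) _ (hmem j))
    hel her ?_ ?_ ?_
  · intro i j hij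
    have := hβi (hmem i) (hmem j) hij
    exact Fin.ext (by omega)
  · intro i
    have h1 : (q (e i)).natDegree = (Finset.Ioo ((e i : Fin (2 * N)) : ℕ) (2 * N)).card := by
      rw [hq]
      exact natDegree_finsetProd_X_sub_C_eq_card _ _
    rw [h1, Nat.card_Ioo]
    omega
  · rw [hre fun i l => (q i).eval (a l)]
    exact hVne
  · rw [hre fun i l => (q i).eval (a l), hre fun i l => polySinh (q i) (a l) u,
      Equiv.sum_comp e fun i : Fin (2 * N) => a i]
    exact hP

/-! ### Fredholm determinants of kernels of finite rank -/

theorem exists_equiv_of_image_eq {N n : ℕ} {κ : Fin n → Fin N} (hκ : Function.Injective κ)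
    {s : Finset (Fin N)} (hs : Finset.univ.image κ = s) :
    ∃ e : Fin n ≃ s, ∀ i, (e i : Fin N) = κ i := by
  refine ⟨Equiv.ofBijective
    (fun i => ⟨κ i, hs ▸ Finset.mem_image_of_mem κ (Finset.mem_univ i)⟩)
    ⟨fun i j h => hκ (congrArg Subtype.val h), fun x => ?_⟩, fun i => rfl⟩
  have hx : (x : Fin N) ∈ Finset.univ.image κ := by rw [hs]; exact x.2
  obtain ⟨i, _, hi⟩ := Finset.mem_image.1 hx
  exact ⟨i, Subtype.ext hi⟩

theorem sum_det_submatrix_eq {N : ℕ} (G : Matrix (Fin N) (Fin N) ℂ) (n : ℕ) :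
    ∑ κ : Fin n → Fin N, (G.submatrix κ κ).det = (n.factorial : ℂ) *
      ∑ s ∈ Finset.univ.powersetCard n,
        (G.submatrix (Subtype.val : s → Fin N) (Subtype.val : s → Fin N)).det := by
  classical
  have h1 : ∑ κ : Fin n → Fin N, (G.submatrix κ κ).det =
      ∑ κ ∈ Finset.univ.filter (fun κ : Fin n → Fin N => Function.Injective κ),
        (G.submatrix κ κ).det := by
    refine (Finset.sum_filter_of_ne fun κ _ hne => ?_).symm
    intro i j hij
    by_contra hne'
    exact hne (Matrix.det_zero_of_row_eq hne' (by funext l; simp [hij]))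
  rw [h1, Finset.mul_sum, ← Finset.sum_fiberwise_of_maps_to (t := Finset.univ.powersetCard n)
    (g := fun κ : Fin n → Fin N => Finset.univ.image κ)]
  · refine Finset.sum_congr rfl fun s hs => ?_
    have hcard : s.card = n := (Finset.mem_powersetCard.1 hs).2
    have hfact : n.factorial = Fintype.card (Fin n ≃ s) := by
      rw [Fintype.card_equiv (Fintype.equivFinOfCardEq (by simpa using hcard) : s ≃ Fin n).symm,
        Fintype.card_fin]
    rw [Finset.sum_congr rfl (g := fun _ =>
      (G.submatrix (Subtype.val : s → Fin N) (Subtype.val : s → Fin N)).det), Finset.sum_const,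
      nsmul_eq_mul, hfact, ← Finset.card_univ]
    · congr 2
      symm
      refine Finset.card_bij (fun (e : Fin n ≃ s) _ i => (e i : Fin N)) ?_ ?_ ?_
      · intro e _
        simp only [Finset.mem_filter, Finset.mem_univ, true_and]
        refine ⟨Subtype.val_injective.comp e.injective, ?_⟩
        ext x
        simp only [Finset.mem_image, Finset.mem_univ, true_and]
        exact ⟨fun ⟨i, hi⟩ => hi ▸ (e i).2, fun hx => ⟨e.symm ⟨x, hx⟩, by simp⟩⟩
      · intro e _ e' _ h
        ext i
        exact congrArg Fin.val (congrFun h i)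
      · intro κ hκ
        simp only [Finset.mem_filter, Finset.mem_univ, true_and] at hκ
        obtain ⟨e, he⟩ := exists_equiv_of_image_eq hκ.1 hκ.2
        exact ⟨e, Finset.mem_univ _, funext he⟩
    · intro κ hκ
      simp only [Finset.mem_filter, Finset.mem_univ, true_and] at hκ
      obtain ⟨e, he⟩ := exists_equiv_of_image_eq hκ.1 hκ.2
      rw [← Matrix.det_submatrix_equiv_self e, Matrix.submatrix_submatrix]
      congr 2 <;> exact funext fun i => (he i).symm
  · intro κ hκ
    simp only [Finset.mem_filter, Finset.mem_univ, true_and] at hκ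
    rw [Finset.mem_powersetCard]
    exact ⟨Finset.subset_univ _, by rw [Finset.card_image_of_injective _ hκ]; simp⟩

/-- Andréief's identity: the Fredholm expansion of a kernel of finite rank consists of sums of
principal minors of a matrix. -/
theorem fredholmTerm_of_finite_rank {X : Type*} [MeasurableSpace X] {μ : Measure X} [SigmaFinite μ]
    {N : ℕ} {K : X → X → ℂ} {φ ψ : Fin N → X → ℂ} (hK : ∀ x y, K x y = ∑ i, φ i x * ψ i y)
    (hint : ∀ i j, Integrable (fun x => φ i x * ψ j x) μ) (n : ℕ) :
    fredholmTerm μ K n = ∑ s ∈ Finset.univ.powersetCard n,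
      ((Matrix.of fun i j => ∫ x, φ i x * ψ j x ∂μ).submatrix (Subtype.val : s → Fin N)
        (Subtype.val : s → Fin N)).det := by
  set G : Matrix (Fin N) (Fin N) ℂ := Matrix.of fun i j => ∫ x, φ i x * ψ j x ∂μ with hG
  have h1 : ∀ x : Fin n → X, (Matrix.of fun i j => K (x i) (x j)).det =
      ∑ σ : Equiv.Perm (Fin n), ∑ κ : Fin n → Fin N,
        (Equiv.Perm.sign σ : ℂ) * ∏ b, (φ (κ b) (x b) * ψ (κ (σ b)) (x b)) := by
    intro x
    rw [Matrix.det_apply']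
    refine Finset.sum_congr rfl fun σ _ => ?_
    simp only [Matrix.of_apply, hK]
    rw [Finset.prod_univ_sum, Finset.mul_sum, Fintype.piFinset_univ]
    refine Fintype.sum_equiv (σ.arrowCongr (Equiv.refl _)) _ _ fun κ => ?_
    simp only [Equiv.arrowCongr_apply, Equiv.coe_refl, Function.comp_apply, id,
      Equiv.symm_apply_apply, Finset.prod_mul_distrib]
    rw [← Equiv.prod_comp σ fun b => φ (κ (σ.symm b)) (x b)]
    simp only [Equiv.symm_apply_apply]
  have hint' : ∀ (σ : Equiv.Perm (Fin n)) (κ : Fin n → Fin N),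
      Integrable (fun x : Fin n → X => (Equiv.Perm.sign σ : ℂ) *
        ∏ b, (φ (κ b) (x b) * ψ (κ (σ b)) (x b))) (Measure.pi fun _ => μ) := fun σ κ =>
    (Integrable.fintype_prod (f := fun b y => φ (κ b) y * ψ (κ (σ b)) y)
      fun b => hint _ _).const_mul _
  rw [fredholmTerm, integral_congr_ae (Filter.Eventually.of_forall h1),
    integral_finsetSum _ fun σ _ => integrable_finsetSum _ fun κ _ => hint' σ κ]
  simp only [integral_finsetSum _ fun κ _ => hint' _ κ, integral_const_mul]
  rw [Finset.sum_comm]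
  have h2 : ∀ κ : Fin n → Fin N, ∑ σ : Equiv.Perm (Fin n), (Equiv.Perm.sign σ : ℂ) *
      ∫ x : Fin n → X, ∏ b, (φ (κ b) (x b) * ψ (κ (σ b)) (x b)) ∂(Measure.pi fun _ => μ) =
      (G.submatrix κ κ).det := by
    intro κ
    rw [← Matrix.det_transpose, Matrix.det_apply']
    refine Finset.sum_congr rfl fun σ _ => ?_
    rw [integral_fintype_prod_eq_prod (f := fun b y => φ (κ b) y * ψ (κ (σ b)) y)]
    rfl
  simp only [h2]
  rw [sum_det_submatrix_eq, ← mul_assoc, one_div, inv_mul_cancel₀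
    (by exact_mod_cast n.factorial_ne_zero), one_mul]

theorem sum_fredholmTerm_of_finite_rank {X : Type*} [MeasurableSpace X] {μ : Measure X}
    [SigmaFinite μ] {N : ℕ} {K : X → X → ℂ} {φ ψ : Fin N → X → ℂ}
    (hK : ∀ x y, K x y = ∑ i, φ i x * ψ i y)
    (hint : ∀ i j, Integrable (fun x => φ i x * ψ j x) μ) :
    (∀ n, N < n → fredholmTerm μ K n = 0) ∧
    ∑ n ∈ Finset.range (N + 1), fredholmTerm μ K n =
      (1 + Matrix.of fun i j => ∫ x, φ i x * ψ j x ∂μ).det := by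
  set G : Matrix (Fin N) (Fin N) ℂ := Matrix.of fun i j => ∫ x, φ i x * ψ j x ∂μ with hG
  have h := fredholmTerm_of_finite_rank hK hint
  have h0 : ∀ n, N < n → fredholmTerm μ K n = 0 := fun n hn => by
    rw [h, Finset.powersetCard_eq_empty.2 (by simpa using hn), Finset.sum_empty]
  refine ⟨h0, ?_⟩
  set p := (1 + (Polynomial.X : Polynomial ℂ) • G.map Polynomial.C).det with hp
  have hc : ∀ n, fredholmTerm μ K n = p.coeff n := fun n => by
    rw [h, hp, Matrix.coeff_det_one_add_X_smul_eq_sum_minors]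
  have hdeg : p.natDegree < N + 1 := by
    rw [Nat.lt_succ_iff, Polynomial.natDegree_le_iff_coeff_eq_zero]
    exact fun n hn => by rw [← hc, h0 n hn]
  have heval : p.eval 1 = (1 + G).det := by
    rw [hp, ← Polynomial.coe_evalRingHom, RingHom.map_det]
    congr 1
    ext i j
    simp [Matrix.one_apply]
    split_ifs <;> simp
  rw [← heval, Polynomial.eval_eq_sum_range' hdeg]
  simp [hc]

/-! ### Contour integrals in the right half-plane -/

/-- The open right half-plane. -/
def rightHalfPlane : Set ℂ := {z | 0 < z.re}

theorem isOpen_rightHalfPlane : IsOpen rightHalfPlane :=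
  isOpen_lt continuous_const Complex.continuous_re

theorem exists_mem_Ioo_of_partition {k : ℕ} {t : ℕ → ℝ} {x : ℝ} (h0 : t 0 < x) (hk : x < t k)
    (hx : ∀ i, t i ≠ x) : ∃ i < k, x ∈ Ioo (t i) (t (i + 1)) := by
  classical
  have hex : ∃ i, x < t i := ⟨k, hk⟩
  obtain ⟨i, hi⟩ : ∃ i, Nat.find hex = i + 1 := Nat.exists_eq_succ_of_ne_zero fun h => by
    have := Nat.find_spec hex
    rw [h] at this
    exact absurd this h0.not_gt
  have h1 := Nat.find_spec hex
  have h2 := Nat.find_min' hex hk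
  have h3 := Nat.find_min hex (m := i) (by omega)
  rw [hi] at h1 h2
  exact ⟨i, by omega, lt_of_le_of_ne (not_lt.1 h3) (hx i), h1⟩

namespace IsSimpleClosedContour

variable {γ : ℝ → ℂ}

theorem isCompact_trace (hγ : IsSimpleClosedContour γ) : IsCompact (contourTrace γ) :=
  isCompact_Icc.image_of_continuousOn hγ.continuousOn

theorem mem_trace {t : ℝ} (ht : t ∈ Icc (0 : ℝ) 1) : γ t ∈ contourTrace γ := mem_image_of_mem γ ht

theorem exists_countable_hasDerivAt (hγ : IsSimpleClosedContour γ) :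
    ∃ s : Set ℝ, s.Countable ∧ ∀ t ∈ Ioo (0 : ℝ) 1 \ s, HasDerivAt γ (deriv γ t) t := by
  obtain ⟨k, t, h0, h1, ht⟩ := hγ.piecewise
  refine ⟨range t, countable_range t, fun x hx => ?_⟩
  obtain ⟨i, hi, hxi⟩ := exists_mem_Ioo_of_partition (k := k) (t := t) (x := x)
    (by rw [h0]; exact hx.1.1) (by rw [h1]; exact hx.1.2) fun i hi => hx.2 ⟨i, hi⟩
  exact (((ht i hi).2.contDiffAt (Icc_mem_nhds hxi.1 hxi.2)).differentiableAt
    one_ne_zero).hasDerivAt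

theorem intervalIntegrable_deriv (hγ : IsSimpleClosedContour γ) :
    IntervalIntegrable (deriv γ) volume 0 1 := by
  obtain ⟨k, t, h0, h1, ht⟩ := hγ.piecewise
  rw [← h0, ← h1]
  refine IntervalIntegrable.trans_iterate fun i hi => ?_
  obtain ⟨hlt, hcd⟩ := ht i hi
  rw [intervalIntegrable_iff_integrableOn_Ioo_of_le hlt.le]
  have hc := hcd.continuousOn_derivWithin (uniqueDiffOn_Icc hlt) le_rfl
  refine ((hc.integrableOn_Icc).mono_set Ioo_subset_Icc_self).congr_fun (fun x hx => ?_)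
    measurableSet_Ioo
  exact derivWithin_of_mem_nhds (Icc_mem_nhds hx.1 hx.2)

theorem aestronglyMeasurable_integrand (hγ : IsSimpleClosedContour γ) {f : ℂ → ℂ}
    (hf : ContinuousOn f (contourTrace γ)) :
    AEStronglyMeasurable (fun t => f (γ t) * deriv γ t) (volume.restrict (uIoc (0 : ℝ) 1)) := by
  have hc : ContinuousOn (fun t => f (γ t)) (Icc 0 1) :=
    hf.comp hγ.continuousOn fun t ht => mem_trace ht
  have h1 : AEStronglyMeasurable (fun t => f (γ t)) (volume.restrict (uIoc (0 : ℝ) 1)) := by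
    rw [uIoc_of_le zero_le_one]
    exact (hc.mono Ioc_subset_Icc_self).aestronglyMeasurable measurableSet_Ioc
  exact h1.mul (intervalIntegrable_iff.1 hγ.intervalIntegrable_deriv).aestronglyMeasurable

theorem intervalIntegrable_integrand (hγ : IsSimpleClosedContour γ) {f : ℂ → ℂ}
    (hf : ContinuousOn f (contourTrace γ)) :
    IntervalIntegrable (fun t => f (γ t) * deriv γ t) volume 0 1 := by
  obtain ⟨C, hC⟩ := hγ.isCompact_trace.exists_bound_of_continuousOn hf
  refine (hγ.intervalIntegrable_deriv.norm.const_mul C).mono_fun'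
    (hγ.aestronglyMeasurable_integrand hf) ?_
  refine (ae_restrict_mem measurableSet_uIoc).mono fun t ht => ?_
  rw [uIoc_of_le zero_le_one] at ht
  simp only [norm_mul]
  exact mul_le_mul_of_nonneg_right (hC _ (mem_trace (Ioc_subset_Icc_self ht))) (norm_nonneg _)

theorem norm_contourIntegral_le (hγ : IsSimpleClosedContour γ) {f : ℂ → ℂ} {C : ℝ}
    (hf : ∀ z ∈ contourTrace γ, ‖f z‖ ≤ C) :
    ‖contourIntegral γ f‖ ≤ C * ∫ t in (0 : ℝ)..1, ‖deriv γ t‖ := by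
  rw [contourIntegral, ← intervalIntegral.integral_const_mul]
  refine intervalIntegral.norm_integral_le_of_norm_le zero_le_one ?_
    (hγ.intervalIntegrable_deriv.norm.const_mul C)
  refine Filter.Eventually.of_forall fun t ht => ?_
  rw [norm_mul]
  exact mul_le_mul_of_nonneg_right (hf _ (mem_trace (Ioc_subset_Icc_self ht))) (norm_nonneg _)

theorem _root_.contourIntegral_congr {f g : ℂ → ℂ} (h : ∀ z ∈ contourTrace γ, f z = g z) :
    contourIntegral γ f = contourIntegral γ g := by
  refine intervalIntegral.integral_congr fun t ht => ?_
  rw [uIcc_of_le zero_le_one] at ht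
  simp only [h _ (mem_trace ht)]

theorem _root_.contourIntegral_const_mul (c : ℂ) (f : ℂ → ℂ) :
    contourIntegral γ (fun z => c * f z) = c * contourIntegral γ f := by
  rw [contourIntegral, contourIntegral, ← intervalIntegral.integral_const_mul]
  simp only [mul_assoc]

theorem contourIntegral_add (hγ : IsSimpleClosedContour γ) {f g : ℂ → ℂ}
    (hf : ContinuousOn f (contourTrace γ)) (hg : ContinuousOn g (contourTrace γ)) :
    contourIntegral γ (fun z => f z + g z) = contourIntegral γ f + contourIntegral γ g := by
  rw [contourIntegral, contourIntegral, contourIntegral, ← intervalIntegral.integral_add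
    (hγ.intervalIntegrable_integrand hf) (hγ.intervalIntegrable_integrand hg)]
  simp only [add_mul]

theorem contourIntegral_sum (hγ : IsSimpleClosedContour γ) {ι : Type*} (s : Finset ι)
    {f : ι → ℂ → ℂ} (hf : ∀ i ∈ s, ContinuousOn (f i) (contourTrace γ)) :
    contourIntegral γ (fun z => ∑ i ∈ s, f i z) = ∑ i ∈ s, contourIntegral γ (f i) := by
  simp only [contourIntegral, Finset.sum_mul]
  exact intervalIntegral.integral_finsetSum fun i hi => hγ.intervalIntegrable_integrand (hf i hi)

theorem tendsto_contourIntegral (hγ : IsSimpleClosedContour γ) {ι : Type*} {l : Filter ι}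
    [l.IsCountablyGenerated] {F : ι → ℂ → ℂ} {f : ℂ → ℂ} {C : ℝ}
    (hF : ∀ᶠ i in l, ContinuousOn (F i) (contourTrace γ))
    (hC : ∀ᶠ i in l, ∀ z ∈ contourTrace γ, ‖F i z‖ ≤ C)
    (hlim : ∀ z ∈ contourTrace γ, Filter.Tendsto (fun i => F i z) l (nhds (f z))) :
    Filter.Tendsto (fun i => contourIntegral γ (F i)) l (nhds (contourIntegral γ f)) := by
  refine intervalIntegral.tendsto_integral_filter_of_dominated_convergence
    (fun t => C * ‖deriv γ t‖) (hF.mono fun i hi => hγ.aestronglyMeasurable_integrand hi)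
    (hC.mono fun i hi => Filter.Eventually.of_forall fun t ht => ?_)
    (hγ.intervalIntegrable_deriv.norm.const_mul C)
    (Filter.Eventually.of_forall fun t ht => ?_)
  · rw [uIoc_of_le zero_le_one] at ht
    rw [norm_mul]
    exact mul_le_mul_of_nonneg_right (hi _ (mem_trace (Ioc_subset_Icc_self ht))) (norm_nonneg _)
  · rw [uIoc_of_le zero_le_one] at ht
    exact (hlim _ (mem_trace (Ioc_subset_Icc_self ht))).mul_const _

/-- Cauchy's theorem in the right half-plane: a compact subset of the half-plane lies in a disc
`|z - R| < R`, where holomorphic functions have primitives. -/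
theorem contourIntegral_eq_zero (hγ : IsSimpleClosedContour γ)
    (hr : ∀ z ∈ contourTrace γ, 0 < z.re) {f : ℂ → ℂ} (hf : DifferentiableOn ℂ f rightHalfPlane) :
    contourIntegral γ f = 0 := by
  obtain ⟨B, hB⟩ := hγ.isCompact_trace.exists_bound_of_continuousOn
    (f := fun z : ℂ => ‖z‖ ^ 2 / (2 * z.re)) (by
      refine ContinuousOn.div (by fun_prop) (by fun_prop) fun z hz => ?_
      have := hr z hz
      positivity)
  set R : ℝ := |B| + 1 with hR
  have hRpos : 0 < R := by positivity
  have hball : ∀ z : ℂ, z ∈ Metric.ball (R : ℂ) R ↔ ‖z‖ ^ 2 < 2 * R * z.re := fun z => by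
    rw [Metric.mem_ball, dist_eq_norm, ← abs_of_nonneg (norm_nonneg (z - R)),
      ← abs_of_pos hRpos, ← sq_lt_sq, abs_of_pos hRpos, Complex.sq_norm, Complex.sq_norm,
      Complex.normSq_apply, Complex.normSq_apply]
    simp
    constructor <;> intro h <;> nlinarith
  have htr : ∀ z ∈ contourTrace γ, z ∈ Metric.ball (R : ℂ) R := fun z hz => by
    have h1 := (le_abs_self _).trans (hB z hz)
    have h2 := hr z hz
    rw [div_le_iff₀ (by positivity)] at h1
    rw [hball]
    have := le_abs_self B
    nlinarith
  have hsub : Metric.ball (R : ℂ) R ⊆ rightHalfPlane := fun z hz => by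
    have h1 := (hball z).1 hz
    have h2 := sq_nonneg ‖z‖
    by_contra h3
    have h4 : z.re ≤ 0 := not_lt.1 h3
    nlinarith
  obtain ⟨F, hF⟩ := (hf.mono hsub).isExactOn_ball
  obtain ⟨s, hs, hd⟩ := hγ.exists_countable_hasDerivAt
  have hFc : ContinuousOn F (Metric.ball (R : ℂ) R) := fun z hz =>
    (hF z hz).continuousAt.continuousWithinAt
  rw [contourIntegral, MeasureTheory.integral_eq_of_hasDerivAt_off_countable (fun t => F (γ t)) _ hs]
  · rw [hγ.closed, sub_self]
  · rw [uIcc_of_le zero_le_one]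
    exact hFc.comp hγ.continuousOn fun t ht => htr _ (mem_trace ht)
  · rw [min_eq_left zero_le_one, max_eq_right zero_le_one]
    intro t ht
    exact (hF _ (htr _ (mem_trace (Ioo_subset_Icc_self ht.1)))).comp t (hd t ht)
  · exact hγ.intervalIntegrable_integrand
      ((hf.mono fun z hz => hr z hz).continuousOn)

/-- Cauchy's integral formula for a point about which the contour winds once. -/
theorem contourIntegral_div_sub (hγ : IsSimpleClosedContour γ) (hpos : IsPositivelyOriented γ)
    (hr : ∀ z ∈ contourTrace γ, 0 < z.re) {g : ℂ → ℂ} (hg : DifferentiableOn ℂ g rightHalfPlane)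
    {p : ℂ} (hp : 0 < p.re) (henc : Encloses γ p) :
    contourIntegral γ (fun z => g z / (z - p)) = 2 * (Real.pi : ℂ) * Complex.I * g p := by
  have hd : DifferentiableOn ℂ (dslope g p) rightHalfPlane :=
    (Complex.differentiableOn_dslope (isOpen_rightHalfPlane.mem_nhds hp)).2 hg
  have hne : ∀ z ∈ contourTrace γ, z ≠ p := fun z hz h => henc.1 (h ▸ hz)
  have h1 : contourIntegral γ (fun z => g z / (z - p)) =
      contourIntegral γ (fun z => dslope g p z + g p * (1 / (z - p))) := by
    refine contourIntegral_congr fun z hz => ?_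
    have := sub_ne_zero.2 (hne z hz)
    rw [dslope_of_ne _ (hne z hz), slope_def_field]
    field_simp
    ring
  have h2 := hpos p henc
  rw [h1, hγ.contourIntegral_add ((hd.mono fun z hz => hr z hz).continuousOn),
    hγ.contourIntegral_eq_zero hr hd, contourIntegral_const_mul, zero_add]
  · have h3 : (2 * (Real.pi : ℂ) * Complex.I) ≠ 0 := Complex.two_pi_I_ne_zero
    rw [one_div, inv_mul_eq_iff_eq_mul₀ h3] at h2
    rw [h2]
    ring
  · refine ContinuousOn.mul continuousOn_const (ContinuousOn.div continuousOn_const (by fun_prop)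
      fun z hz => sub_ne_zero.2 (hne z hz))

/-- The residue theorem for a function with simple poles at the points `v m`. -/
theorem contourIntegral_div_prod (hγ : IsSimpleClosedContour γ) (hpos : IsPositivelyOriented γ)
    (hr : ∀ z ∈ contourTrace γ, 0 < z.re) {g : ℂ → ℂ} (hg : DifferentiableOn ℂ g rightHalfPlane)
    {s : Finset ℕ} (hs : s.Nonempty) {v : ℕ → ℂ} (hv : InjOn v s) (hvpos : ∀ m ∈ s, 0 < (v m).re)
    (henc : ∀ m ∈ s, Encloses γ (v m)) :
    contourIntegral γ (fun z => g z / ∏ m ∈ s, (z - v m)) =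
      2 * (Real.pi : ℂ) * Complex.I * ∑ m ∈ s, Lagrange.nodalWeight s v m * g (v m) := by
  have hne : ∀ z ∈ contourTrace γ, ∀ m ∈ s, z ≠ v m := fun z hz m hm h => (henc m hm).1 (h ▸ hz)
  have h1 : contourIntegral γ (fun z => g z / ∏ m ∈ s, (z - v m)) =
      contourIntegral γ (fun z => ∑ m ∈ s, Lagrange.nodalWeight s v m * (g z / (z - v m))) := by
    refine contourIntegral_congr fun z hz => ?_
    have h2 := Lagrange.eval_interpolate_not_at_node (s := s) (v := v) 1 (hne z hz)
    rw [Lagrange.interpolate_one hv hs, Polynomial.eval_one, Lagrange.eval_nodal] at h2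
    have h3 : ∏ m ∈ s, (z - v m) ≠ 0 := fun h => by rw [h, zero_mul] at h2; exact one_ne_zero h2
    rw [div_eq_iff h3]
    calc g z = g z * 1 := (mul_one _).symm
      _ = _ := by
        rw [h2, mul_comm (∏ m ∈ s, (z - v m)), ← mul_assoc, Finset.mul_sum]
        congr 1
        refine Finset.sum_congr rfl fun m _ => ?_
        simp only [Pi.one_apply]
        ring
  have hgc := (hg.mono fun z hz => hr z hz : DifferentiableOn ℂ g (contourTrace γ)).continuousOn
  rw [h1, hγ.contourIntegral_sum, Finset.mul_sum]
  · refine Finset.sum_congr rfl fun m hm => ?_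
    rw [contourIntegral_const_mul, hγ.contourIntegral_div_sub hpos hr hg (hvpos m hm) (henc m hm)]
    ring
  · intro m hm
    exact continuousOn_const.mul (hgc.div (by fun_prop) fun z hz => sub_ne_zero.2 (hne z hz m hm))

end IsSimpleClosedContour

/-! ### The kernel for distinct parameters -/

theorem sum_Icc_one_eq_sum_fin {A : Type*} [AddCommMonoid A] (N : ℕ) (f : ℕ → A) :
    ∑ m ∈ Finset.Icc 1 N, f m = ∑ i : Fin N, f (i + 1) := by
  rw [← Finset.sum_range fun i => f (i + 1)]
  induction N with
  | zero => simp
  | succ N ih => rw [Finset.sum_Icc_succ_top (by omega), ih, Finset.sum_range_succ]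

/-- The residue at `x j` of `∏ (z + y m) / (z - x m)`. -/
noncomputable def cauchyWeight {F : Type*} [Field F] (s : Finset ℕ) (x y : ℕ → F) (j : ℕ) : F :=
  Lagrange.nodalWeight s x j * ∏ m ∈ s, (x j + y m)

/-- The inverse of a Cauchy matrix. -/
theorem sum_cauchy_mul_cauchyWeight {F : Type*} [Field F] {s : Finset ℕ} {x y : ℕ → F}
    (hx : InjOn x s) (hy : InjOn y s) (hxy : ∀ i ∈ s, ∀ l ∈ s, x i + y l ≠ 0) {i j : ℕ}
    (hi : i ∈ s) (hj : j ∈ s) :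
    ∑ l ∈ s, 1 / (x i + y l) * (cauchyWeight s x y j * cauchyWeight s y x l / (x j + y l)) =
      if i = j then 1 else 0 := by
  classical
  -- Lagrange interpolation of `∏_{m ≠ j} (w + x m)` at the nodes `y`, evaluated at `-x i`
  set p : Polynomial F := ∏ m ∈ s.erase j, (Polynomial.X + Polynomial.C (x m)) with hp
  have hdeg : p.degree < s.card := by
    rw [hp, Polynomial.degree_prod]
    simp only [Polynomial.degree_X_add_C, Finset.sum_const, Finset.card_erase_of_mem hj]
    have := Finset.card_pos.2 ⟨j, hj⟩
    rw [nsmul_one]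
    exact_mod_cast Nat.sub_lt this one_pos
  have hpe : ∀ w, p.eval w = ∏ m ∈ s.erase j, (w + x m) := fun w => by
    simp [hp, Polynomial.eval_prod]
  have h1 := congrArg (Polynomial.eval (-x i)) (Lagrange.eq_interpolate hy hdeg)
  rw [Lagrange.eval_interpolate_not_at_node _ fun l hl h => hxy i hi l hl (by rw [← h]; ring)] at h1
  set S := ∑ l ∈ s, Lagrange.nodalWeight s y l * p.eval (y l) / (x i + y l) with hS
  have h2 : ∑ l ∈ s, Lagrange.nodalWeight s y l * (-x i - y l)⁻¹ * p.eval (y l) = -S := by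
    rw [hS, ← Finset.sum_neg_distrib]
    refine Finset.sum_congr rfl fun l _ => ?_
    rw [show -x i - y l = -(x i + y l) by ring, inv_neg, div_eq_mul_inv]
    ring
  rw [h2, Lagrange.eval_nodal] at h1
  have h3 : ∑ l ∈ s, 1 / (x i + y l) * (cauchyWeight s x y j * cauchyWeight s y x l / (x j + y l)) =
      cauchyWeight s x y j * S := by
    rw [hS, Finset.mul_sum]
    refine Finset.sum_congr rfl fun l hl => ?_
    have e1 := hxy j hj l hl
    have e2 : ∏ m ∈ s, (y l + x m) = (x j + y l) * p.eval (y l) := by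
      rw [hpe, ← Finset.mul_prod_erase _ _ hj, add_comm (x j)]
    rw [show cauchyWeight s y x l = Lagrange.nodalWeight s y l * ∏ m ∈ s, (y l + x m) from rfl, e2]
    field_simp
  have hA : ∏ m ∈ s, (-x i - y m) = (-1) ^ s.card * ∏ m ∈ s, (x i + y m) := by
    rw [← Finset.prod_const, ← Finset.prod_mul_distrib]
    exact Finset.prod_congr rfl fun m _ => by ring
  have hAne : ∏ m ∈ s, (x i + y m) ≠ 0 := Finset.prod_ne_zero_iff.2 fun m hm => hxy i hi m hm
  have hsgn : ((-1 : F) ^ s.card) ≠ 0 := pow_ne_zero _ (by simp)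
  rw [h3]
  split_ifs with hij
  · subst hij
    have e1 : p.eval (-x i) * Lagrange.nodalWeight s x i = (-1) ^ (s.card - 1) := by
      rw [hpe, Lagrange.nodalWeight, ← Finset.prod_mul_distrib, ← Finset.card_erase_of_mem hi,
        ← Finset.prod_const]
      refine Finset.prod_congr rfl fun m hm => ?_
      have : x i - x m ≠ 0 := sub_ne_zero.2 fun h =>
        Finset.ne_of_mem_erase hm (hx hi (Finset.mem_of_mem_erase hm) h).symm
      rw [show -x i + x m = -(x i - x m) by ring, neg_mul, mul_inv_cancel₀ this]
    have e2 : (-1 : F) ^ s.card = -(-1) ^ (s.card - 1) := by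
      obtain ⟨n, hn⟩ : ∃ n, s.card = n + 1 :=
        ⟨s.card - 1, by have := Finset.card_pos.2 ⟨i, hi⟩; omega⟩
      rw [hn, Nat.add_sub_cancel, pow_succ]; ring
    rw [h1, hA] at e1
    refine mul_left_cancel₀ hsgn ?_
    rw [mul_one, cauchyWeight]
    linear_combination -e1 - e2
  · have e1 : p.eval (-x i) = 0 := by
      rw [hpe]
      exact Finset.prod_eq_zero (Finset.mem_erase.2 ⟨hij, hi⟩) (by ring)
    rw [e1, hA] at h1
    have : S = 0 := by
      rcases mul_eq_zero.1 h1.symm with h | h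
      · exact absurd h (mul_ne_zero hsgn hAne)
      · exact neg_eq_zero.1 h
    rw [this, mul_zero]

/-- The holomorphic extension of `flatHhat` across its removable singularity at `z = w`. -/
noncomputable def hhatExt (u : ℝ) (z w : ℂ) : ℂ :=
  -dslope (fun ζ => Complex.exp (-2 * u * ζ)) z w + Complex.exp (-2 * u * (z + w)) / (z + w)

theorem flatHhat_eq_hhatExt (u : ℝ) {z w : ℂ} (h : w ≠ z) : flatHhat u z w = hhatExt u z w := by
  have h1 := sub_ne_zero.2 h
  have h2 := sub_ne_zero.2 h.symm
  rw [flatHhat, hhatExt, dslope_of_ne _ h, slope_def_field, ← neg_sub w z]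
  field_simp
  ring

theorem hhatExt_comm (u : ℝ) (z w : ℂ) : hhatExt u z w = hhatExt u w z := by
  rcases eq_or_ne w z with rfl | h
  · rfl
  · rw [hhatExt, hhatExt, dslope_of_ne _ h, dslope_of_ne _ h.symm, slope_comm, add_comm z w]

theorem differentiableOn_hhatExt (u : ℝ) {z : ℂ} (hz : 0 < z.re) :
    DifferentiableOn ℂ (hhatExt u z) rightHalfPlane := by
  unfold hhatExt
  refine DifferentiableOn.add ?_ ?_
  · refine DifferentiableOn.neg ?_
    refine (Complex.differentiableOn_dslope (isOpen_rightHalfPlane.mem_nhds hz)).2 ?_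
    exact Differentiable.differentiableOn (by fun_prop)
  · refine DifferentiableOn.div (Differentiable.differentiableOn (by fun_prop))
      (Differentiable.differentiableOn (by fun_prop)) fun w hw h => ?_
    have : (z + w).re = 0 := by rw [h]; rfl
    rw [Complex.add_re] at this
    have hw' : 0 < w.re := hw
    linarith

theorem differentiableOn_hhatExt_left (u : ℝ) {w : ℂ} (hw : 0 < w.re) :
    DifferentiableOn ℂ (fun z => hhatExt u z w) rightHalfPlane := by
  simp only [hhatExt_comm u _ w]
  exact differentiableOn_hhatExt u hw

section Contours

variable {N : ℕ} {α β : ℕ → ℝ} {Γ₁ Γ₂ : ℝ → ℂ}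

/-- The integrand of the double contour integral defining the kernel. -/
noncomputable def flatIntegrand (N : ℕ) (α β : ℕ → ℝ) (u x y : ℝ) (z w : ℂ) : ℂ :=
  Complex.exp (-x * z - y * w) * flatHhat u z w *
    ∏ m ∈ Finset.Icc 1 N, ((z + β m) * (w + α m)) / ((z - α m) * (w - β m))

/-- The inner contour integral in the kernel, by residues at the points `β_j`. -/
theorem contourIntegral_flatIntegrand (hN : 1 ≤ N) (hβ : ∀ j ∈ Finset.Icc 1 N, 0 < β j)
    (hβi : InjOn β (Finset.Icc 1 N))
    (hΓ₂ : IsSimpleClosedContour Γ₂) (hΓ₂_pos : IsPositivelyOriented Γ₂)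
    (hΓ₂_right : ∀ w ∈ contourTrace Γ₂, 0 < w.re)
    (hΓ₂_encl : ∀ j ∈ Finset.Icc 1 N, Encloses Γ₂ (β j)) (u x y : ℝ) {z : ℂ} (hz : 0 < z.re)
    (hzΓ₂ : z ∉ contourTrace Γ₂) :
    contourIntegral Γ₂ (flatIntegrand N α β u x y z) =
      2 * (Real.pi : ℂ) * Complex.I *
        ((Complex.exp (-x * z) * ∏ m ∈ Finset.Icc 1 N, (z + β m)) *
          ∑ j ∈ Finset.Icc 1 N, cauchyWeight (Finset.Icc 1 N) (fun m => (β m : ℂ)) (fun m => α m) j *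
            (hhatExt u z (β j) * Complex.exp (-y * β j))) / ∏ m ∈ Finset.Icc 1 N, (z - α m) := by
  have h1 : contourIntegral Γ₂ (flatIntegrand N α β u x y z) = contourIntegral Γ₂ fun w =>
      (Complex.exp (-x * z) * (∏ m ∈ Finset.Icc 1 N, (z + β m)) / ∏ m ∈ Finset.Icc 1 N, (z - α m)) *
        ((Complex.exp (-y * w) * hhatExt u z w * ∏ m ∈ Finset.Icc 1 N, (w + α m)) /
          ∏ m ∈ Finset.Icc 1 N, (w - (β m : ℂ))) := by
    refine contourIntegral_congr fun w hw => ?_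
    rw [flatIntegrand, flatHhat_eq_hhatExt u (show w ≠ z from fun h => hzΓ₂ (h ▸ hw)),
      Finset.prod_div_distrib, Finset.prod_mul_distrib, Finset.prod_mul_distrib, sub_eq_add_neg, Complex.exp_add,
      neg_mul (y : ℂ)]
    simp only [div_eq_mul_inv, mul_inv]
    ring
  have hd : DifferentiableOn ℂ (fun w : ℂ =>
      Complex.exp (-y * w) * hhatExt u z w * ∏ m ∈ Finset.Icc 1 N, (w + α m)) rightHalfPlane := by
    refine DifferentiableOn.mul (DifferentiableOn.mul
      (Differentiable.differentiableOn (by fun_prop)) (differentiableOn_hhatExt u hz))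
      (Differentiable.differentiableOn (by fun_prop))
  rw [h1, contourIntegral_const_mul, hΓ₂.contourIntegral_div_prod hΓ₂_pos hΓ₂_right hd
    ⟨1, by simp [hN]⟩ (fun i hi j hj h => hβi hi hj (by exact_mod_cast h))
    (fun j hj => by simpa using hβ j hj) hΓ₂_encl]
  simp only [cauchyWeight]
  rw [div_mul_eq_mul_div]
  congr 1
  rw [mul_left_comm]
  congr 2
  refine Finset.sum_congr rfl fun j _ => ?_
  ring

/-- For distinct parameters, the kernel has finite rank. -/
theorem flatKernel_eq_sum (hN : 1 ≤ N) (hα : ∀ i ∈ Finset.Icc 1 N, 0 < α i)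
    (hβ : ∀ j ∈ Finset.Icc 1 N, 0 < β j)
    (hαi : InjOn α (Finset.Icc 1 N)) (hβi : InjOn β (Finset.Icc 1 N))
    (hΓ₁ : IsSimpleClosedContour Γ₁) (hΓ₁_pos : IsPositivelyOriented Γ₁)
    (hΓ₂ : IsSimpleClosedContour Γ₂) (hΓ₂_pos : IsPositivelyOriented Γ₂)
    (hΓ₁_right : ∀ z ∈ contourTrace Γ₁, 0 < z.re) (hΓ₂_right : ∀ w ∈ contourTrace Γ₂, 0 < w.re)
    (hΓ₁_encl : ∀ i ∈ Finset.Icc 1 N, Encloses Γ₁ (α i))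
    (hΓ₂_encl : ∀ j ∈ Finset.Icc 1 N, Encloses Γ₂ (β j))
    (hΓ : ∀ z ∈ contourTrace Γ₁, z ∉ contourTrace Γ₂) (u x y : ℝ) :
    flatKernel N α β Γ₁ Γ₂ u x y = ∑ i ∈ Finset.Icc 1 N, ∑ j ∈ Finset.Icc 1 N,
      cauchyWeight (Finset.Icc 1 N) (fun m => (α m : ℂ)) (fun m => β m) i *
        cauchyWeight (Finset.Icc 1 N) (fun m => (β m : ℂ)) (fun m => α m) j *
        hhatExt u (α i) (β j) * (Complex.exp (-x * α i) * Complex.exp (-y * β j)) := by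
  have hpi : (2 * (Real.pi : ℂ) * Complex.I) ≠ 0 := Complex.two_pi_I_ne_zero
  have h1 : flatKernel N α β Γ₁ Γ₂ u x y = 1 / (2 * (Real.pi : ℂ) * Complex.I) ^ 2 *
      contourIntegral Γ₁ fun z => contourIntegral Γ₂ (flatIntegrand N α β u x y z) := rfl
  rw [h1, contourIntegral_congr fun z hz => contourIntegral_flatIntegrand hN hβ hβi hΓ₂ hΓ₂_pos
    hΓ₂_right hΓ₂_encl u x y (hΓ₁_right z hz) (hΓ z hz),
    hΓ₁.contourIntegral_div_prod hΓ₁_pos hΓ₁_right ?_ ⟨1, by simp [hN]⟩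
      (fun i hi j hj h => hαi hi hj (by exact_mod_cast h))
      (fun j hj => by simpa using hα j hj) hΓ₁_encl]
  · rw [← mul_assoc, Finset.mul_sum]
    refine Finset.sum_congr rfl fun i _ => ?_
    rw [Finset.mul_sum, Finset.mul_sum, Finset.mul_sum, Finset.mul_sum]
    refine Finset.sum_congr rfl fun j _ => ?_
    rw [show cauchyWeight (Finset.Icc 1 N) (fun m => (α m : ℂ)) (fun m => β m) i =
      Lagrange.nodalWeight (Finset.Icc 1 N) (fun m => (α m : ℂ)) i *
        ∏ m ∈ Finset.Icc 1 N, ((α i : ℂ) + β m) from rfl]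
    field_simp
  · refine DifferentiableOn.mul (differentiableOn_const _) (DifferentiableOn.mul
      (Differentiable.differentiableOn (by fun_prop)) ?_)
    refine DifferentiableOn.fun_sum fun j hj => DifferentiableOn.mul (differentiableOn_const _)
      (DifferentiableOn.mul (differentiableOn_hhatExt_left u ?_) (differentiableOn_const _))
    simpa using hβ j hj

theorem ofReal_realHhat {u a b : ℝ} (h : a ≠ b) : ((realHhat u a b : ℝ) : ℂ) = hhatExt u a b := by
  rw [← flatHhat_eq_hhatExt u (by exact_mod_cast h.symm), realHhat, flatHhat]
  push_cast
  ring_nf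

/-- For distinct parameters, the Fredholm determinant is a ratio of Cauchy-like determinants. -/
theorem fredholmTerm_flatKernel (hN : 1 ≤ N) (hα : ∀ i ∈ Finset.Icc 1 N, 0 < α i)
    (hβ : ∀ j ∈ Finset.Icc 1 N, 0 < β j)
    (hαi : InjOn α (Finset.Icc 1 N)) (hβi : InjOn β (Finset.Icc 1 N))
    (hαβ : ∀ i ∈ Finset.Icc 1 N, ∀ j ∈ Finset.Icc 1 N, α i ≠ β j)
    (hΓ₁ : IsSimpleClosedContour Γ₁) (hΓ₁_pos : IsPositivelyOriented Γ₁)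
    (hΓ₂ : IsSimpleClosedContour Γ₂) (hΓ₂_pos : IsPositivelyOriented Γ₂)
    (hΓ₁_right : ∀ z ∈ contourTrace Γ₁, 0 < z.re) (hΓ₂_right : ∀ w ∈ contourTrace Γ₂, 0 < w.re)
    (hΓ₁_encl : ∀ i ∈ Finset.Icc 1 N, Encloses Γ₁ (α i))
    (hΓ₂_encl : ∀ j ∈ Finset.Icc 1 N, Encloses Γ₂ (β j))
    (hΓ : ∀ z ∈ contourTrace Γ₁, z ∉ contourTrace Γ₂) (u : ℝ) {p : ℝ}
    (hp : p * (Matrix.of fun k j : Fin N => 1 / (α (k + 1) + β (j + 1))).det =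
      (Matrix.of fun k j : Fin N =>
        1 / (α (k + 1) + β (j + 1)) - realHhat u (α (k + 1)) (β (j + 1))).det) :
    (∀ n, N < n → fredholmTerm (volume.restrict (Ioi (0 : ℝ)))
      (fun x y => -flatKernel N α β Γ₁ Γ₂ u x y) n = 0) ∧
    ∑ n ∈ Finset.range (N + 1), fredholmTerm (volume.restrict (Ioi (0 : ℝ)))
      (fun x y => -flatKernel N α β Γ₁ Γ₂ u x y) n = p := by
  have hmem : ∀ k : Fin N, (k : ℕ) + 1 ∈ Finset.Icc 1 N := fun k => by
    have := k.2; simp only [Finset.mem_Icc]; omega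
  set c : ℕ → ℂ := cauchyWeight (Finset.Icc 1 N) (fun m => (α m : ℂ)) (fun m => β m) with hc
  set d : ℕ → ℂ := cauchyWeight (Finset.Icc 1 N) (fun m => (β m : ℂ)) (fun m => α m) with hd
  have hpos : ∀ i l : Fin N, 0 < α (i + 1) + β (l + 1) := fun i l =>
    add_pos (hα _ (hmem i)) (hβ _ (hmem l))
  have hposC : ∀ i l : Fin N, ((α (i + 1) : ℂ) + β (l + 1)) ≠ 0 := fun i l => by
    exact_mod_cast (hpos i l).ne'
  set φ : Fin N → ℝ → ℂ := fun i x => Complex.exp (-x * α (i + 1)) with hφ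
  set ψ : Fin N → ℝ → ℂ := fun i y => -∑ l : Fin N,
    c (i + 1) * d (l + 1) * hhatExt u (α (i + 1)) (β (l + 1)) * Complex.exp (-y * β (l + 1)) with hψ
  have hK : ∀ x y, -flatKernel N α β Γ₁ Γ₂ u x y = ∑ i, φ i x * ψ i y := fun x y => by
    rw [flatKernel_eq_sum hN hα hβ hαi hβi hΓ₁ hΓ₁_pos hΓ₂ hΓ₂_pos hΓ₁_right hΓ₂_right hΓ₁_encl
      hΓ₂_encl hΓ, sum_Icc_one_eq_sum_fin, ← Finset.sum_neg_distrib]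
    refine Finset.sum_congr rfl fun i _ => ?_
    rw [sum_Icc_one_eq_sum_fin, hφ, hψ]
    simp only [mul_neg, Finset.mul_sum]
    congr 1
    refine Finset.sum_congr rfl fun l _ => ?_
    ring
  have hre : ∀ i l : Fin N, (-((α (i + 1) : ℂ) + β (l + 1))).re < 0 := fun i l => by
    have := hpos i l
    simp only [Complex.neg_re, Complex.add_re, Complex.ofReal_re]
    linarith
  have hexp : ∀ (i l : Fin N) (x : ℝ), Complex.exp (-x * α (i + 1)) * Complex.exp (-x * β (l + 1)) =
      Complex.exp (-((α (i + 1) : ℂ) + β (l + 1)) * x) := fun i l x => by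
    rw [← Complex.exp_add]; ring_nf
  have hint1 : ∀ i l : Fin N, Integrable (fun x : ℝ =>
      Complex.exp (-((α (i + 1) : ℂ) + β (l + 1)) * x)) (volume.restrict (Ioi (0 : ℝ))) :=
    fun i l => integrableOn_exp_mul_complex_Ioi (hre i l) 0
  have hφψ : ∀ i j : Fin N, (fun x => φ i x * ψ j x) = fun x : ℝ => -∑ l : Fin N,
      c (j + 1) * d (l + 1) * hhatExt u (α (j + 1)) (β (l + 1)) *
        Complex.exp (-((α (i + 1) : ℂ) + β (l + 1)) * x) := fun i j => by
    funext x
    simp only [hφ, hψ, mul_neg, Finset.mul_sum, ← hexp]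
    congr 1
    exact Finset.sum_congr rfl fun l _ => by ring
  have hint : ∀ i j, Integrable (fun x => φ i x * ψ j x) (volume.restrict (Ioi (0 : ℝ))) :=
    fun i j => by
      rw [hφψ]
      exact (integrable_finsetSum _ fun l _ => (hint1 i l).const_mul _).neg
  have hG : ∀ i j, ∫ x in Ioi (0 : ℝ), φ i x * ψ j x = -∑ l : Fin N,
      1 / ((α (i + 1) : ℂ) + β (l + 1)) *
        (c (j + 1) * d (l + 1) * hhatExt u (α (j + 1)) (β (l + 1))) := fun i j => by
    rw [hφψ, integral_neg, integral_finsetSum _ fun l _ => (hint1 i l).const_mul _]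
    congr 1
    refine Finset.sum_congr rfl fun l _ => ?_
    rw [integral_const_mul, integral_exp_mul_complex_Ioi (hre i l), Complex.ofReal_zero, mul_zero,
      Complex.exp_zero, neg_div_neg_eq, mul_comm]
  obtain ⟨h0, hsum⟩ := sum_fredholmTerm_of_finite_rank (μ := volume.restrict (Ioi (0 : ℝ))) hK hint
  refine ⟨h0, hsum.trans ?_⟩
  set A : Matrix (Fin N) (Fin N) ℂ := Matrix.of fun i l => 1 / ((α (i + 1) : ℂ) + β (l + 1)) with hA
  set B : Matrix (Fin N) (Fin N) ℂ := Matrix.of fun j l =>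
    1 / ((α (j + 1) : ℂ) + β (l + 1)) - hhatExt u (α (j + 1)) (β (l + 1)) with hB
  have hscale : ∀ F : Matrix (Fin N) (Fin N) ℂ,
      (Matrix.of fun l j : Fin N => c (j + 1) * d (l + 1) * F j l).det =
        (∏ j : Fin N, c (j + 1)) * (∏ l : Fin N, d (l + 1)) * F.det := fun F => by
    have : (Matrix.of fun l j : Fin N => c (j + 1) * d (l + 1) * F j l) = Matrix.of fun l j : Fin N =>
        c (j + 1) * (Matrix.of fun l j : Fin N => d (l + 1) * F.transpose l j) l j := by
      ext l j; simp [mul_assoc]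
    rw [this, Matrix.det_mul_row, Matrix.det_mul_column, Matrix.det_transpose, mul_assoc]
  have hinv : A * (Matrix.of fun l j : Fin N => c (j + 1) * d (l + 1) * A j l) = 1 := by
    ext i j
    have h1 := sum_cauchy_mul_cauchyWeight (s := Finset.Icc 1 N) (x := fun m => (α m : ℂ))
      (y := fun m => (β m : ℂ)) (fun i hi j hj h => hαi hi hj (Complex.ofReal_injective h))
      (fun i hi j hj h => hβi hi hj (Complex.ofReal_injective h))
      (fun i hi j hj => by exact_mod_cast (add_pos (hα i hi) (hβ j hj)).ne') (hmem i) (hmem j)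
    rw [sum_Icc_one_eq_sum_fin] at h1
    rw [Matrix.mul_apply, Matrix.one_apply]
    simp only [add_left_inj, ← Fin.ext_iff] at h1
    rw [← h1]
    refine Finset.sum_congr rfl fun l _ => ?_
    simp only [hA, Matrix.of_apply, mul_one_div, hc, hd]
  have hfact : (1 + Matrix.of fun i j => ∫ x in Ioi (0 : ℝ), φ i x * ψ j x) =
      A * (Matrix.of fun l j : Fin N => c (j + 1) * d (l + 1) * B j l) := by
    have : (Matrix.of fun l j : Fin N => c (j + 1) * d (l + 1) * B j l) =
        (Matrix.of fun l j : Fin N => c (j + 1) * d (l + 1) * A j l) -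
        Matrix.of fun l j : Fin N => c (j + 1) * d (l + 1) *
          hhatExt u (α (j + 1)) (β (l + 1)) := by
      ext l j; simp [hA, hB, mul_sub]
    rw [this, Matrix.mul_sub, hinv, sub_eq_add_neg]
    congr 1
    ext i j
    rw [Matrix.of_apply, hG, Matrix.neg_apply, Matrix.mul_apply]
    rfl
  have hdetA := congrArg Matrix.det hinv
  rw [Matrix.det_mul, hscale, Matrix.det_one] at hdetA
  have hp' : (p : ℂ) * A.det = B.det := by
    have hA' : Complex.ofRealHom.mapMatrix
        (Matrix.of fun k j : Fin N => 1 / (α (k + 1) + β (j + 1))) = A := by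
      ext i j; simp [hA]
    have hB' : Complex.ofRealHom.mapMatrix (Matrix.of fun k j : Fin N =>
        1 / (α (k + 1) + β (j + 1)) - realHhat u (α (k + 1)) (β (j + 1))) = B := by
      ext i j
      simp [hB, ofReal_realHhat (hαβ _ (hmem i) _ (hmem j))]
    have h1 := congrArg (Complex.ofRealHom) hp
    rwa [map_mul, RingHom.map_det, RingHom.map_det, hA', hB'] at h1
  rw [hfact, Matrix.det_mul, hscale, ← hp']
  linear_combination (p : ℂ) * hdetA

end Contours

/-! ### Kernels with exponential decay -/

section Decay

variable {δ : ℝ}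

theorem memLp_exp_neg (hδ : 0 < δ) :
    MemLp (fun x : ℝ => (Real.exp (-(δ * x)) : ℂ)) 2 (volume.restrict (Ioi (0 : ℝ))) := by
  rw [memLp_two_iff_integrable_sq_norm (by fun_prop)]
  have := integrableOn_exp_mul_Ioi (a := -(2 * δ)) (by linarith) 0
  refine this.congr_fun (fun x _ => ?_) measurableSet_Ioi
  simp only [Complex.norm_real, Real.norm_eq_abs, Real.abs_exp]
  rw [← Real.exp_nat_mul]
  congr 1
  push_cast
  ring

/-- The Cauchy–Schwarz inequality against an exponential. -/
theorem integral_exp_mul_norm_le (hδ : 0 < δ) (h : Lp ℂ 2 (volume.restrict (Ioi (0 : ℝ)))) :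
    Integrable (fun y => Real.exp (-(δ * y)) * ‖h y‖) (volume.restrict (Ioi (0 : ℝ))) ∧
    ∫ y in Ioi (0 : ℝ), Real.exp (-(δ * y)) * ‖h y‖ ≤ ‖(memLp_exp_neg hδ).toLp‖ * ‖h‖ := by
  have hh : MemLp (fun y => (‖h y‖ : ℂ)) 2 (volume.restrict (Ioi (0 : ℝ))) :=
    (Lp.memLp h).norm.ofReal
  set e := (memLp_exp_neg hδ).toLp with he
  set g := hh.toLp with hg
  have hcoe : (fun y => inner ℂ (e y) (g y)) =ᵐ[volume.restrict (Ioi (0 : ℝ))]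
      fun y => ((Real.exp (-(δ * y)) * ‖h y‖ : ℝ) : ℂ) := by
    filter_upwards [(memLp_exp_neg hδ).coeFn_toLp, hh.coeFn_toLp] with y h1 h2
    rw [he, hg, h1, h2]
    rw [RCLike.inner_apply, Complex.conj_ofReal]
    push_cast
    ring
  have hint : Integrable (fun y => ((Real.exp (-(δ * y)) * ‖h y‖ : ℝ) : ℂ))
      (volume.restrict (Ioi (0 : ℝ))) := (L2.integrable_inner e g).congr hcoe
  have hint' : Integrable (fun y => Real.exp (-(δ * y)) * ‖h y‖)
      (volume.restrict (Ioi (0 : ℝ))) := by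
    simpa only [RCLike.re_to_complex, Complex.ofReal_re] using hint.re
  refine ⟨hint', ?_⟩
  have h1 : ((∫ y in Ioi (0 : ℝ), Real.exp (-(δ * y)) * ‖h y‖ : ℝ) : ℂ) = inner ℂ e g := by
    rw [L2.inner_def, integral_congr_ae hcoe]
    exact integral_ofReal.symm
  have h2 : ‖g‖ = ‖h‖ := by
    rw [hg, Lp.norm_toLp, Lp.norm_def]
    congr 1
    exact eLpNorm_congr_norm_ae (Filter.Eventually.of_forall fun y => by simp)
  calc ∫ y in Ioi (0 : ℝ), Real.exp (-(δ * y)) * ‖h y‖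
      ≤ ‖((∫ y in Ioi (0 : ℝ), Real.exp (-(δ * y)) * ‖h y‖ : ℝ) : ℂ)‖ := by
        rw [Complex.norm_real]; exact le_abs_self _
    _ ≤ ‖e‖ * ‖h‖ := by rw [h1, ← h2]; exact norm_inner_le_norm _ _

variable {K : ℝ → ℝ → ℂ} {C : ℝ}

/-- A measurable kernel with exponential decay defines a bounded operator on `L²(0, ∞)`. -/
theorem exists_isIntegralOperator (hδ : 0 < δ) (hC : 0 ≤ C)
    (hKm : Measurable (Function.uncurry K))
    (hK : ∀ x > 0, ∀ y > 0, ‖K x y‖ ≤ C * (Real.exp (-(δ * x)) * Real.exp (-(δ * y)))) :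
    ∃ T : Lp ℂ 2 (volume.restrict (Ioi (0 : ℝ))) →L[ℂ] Lp ℂ 2 (volume.restrict (Ioi (0 : ℝ))),
      IsIntegralOperator (volume.restrict (Ioi (0 : ℝ))) K T := by
  set μ := volume.restrict (Ioi (0 : ℝ)) with hμ
  set e := (memLp_exp_neg hδ).toLp with he
  have hpos : ∀ᵐ x ∂μ, 0 < x := ae_restrict_mem measurableSet_Ioi
  have hsm : ∀ h : Lp ℂ 2 μ, StronglyMeasurable (Function.uncurry fun x y => K x y * h y) :=
    fun h => hKm.stronglyMeasurable.mul ((Lp.stronglyMeasurable h).comp_measurable measurable_snd)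
  have hle : ∀ h : Lp ℂ 2 μ, ∀ x > 0, ∀ᵐ y ∂μ, ‖K x y * h y‖ ≤
      C * Real.exp (-(δ * x)) * (Real.exp (-(δ * y)) * ‖h y‖) := fun h x hx => by
    filter_upwards [hpos] with y hy
    rw [norm_mul]
    calc ‖K x y‖ * ‖h y‖ ≤ C * (Real.exp (-(δ * x)) * Real.exp (-(δ * y))) * ‖h y‖ :=
          mul_le_mul_of_nonneg_right (hK x hx y hy) (norm_nonneg _)
      _ = _ := by ring
  have hint : ∀ h : Lp ℂ 2 μ, ∀ x > 0, Integrable (fun y => K x y * h y) μ := fun h x hx =>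
    ((integral_exp_mul_norm_le hδ h).1.const_mul _).mono'
      ((hsm h).comp_measurable measurable_prodMk_left).aestronglyMeasurable (hle h x hx)
  have hbound : ∀ h : Lp ℂ 2 μ, ∀ x > 0, ‖∫ y, K x y * h y ∂μ‖ ≤
      (C * ‖e‖ * ‖h‖) * Real.exp (-(δ * x)) := fun h x hx => by
    calc ‖∫ y, K x y * h y ∂μ‖
        ≤ ∫ y, C * Real.exp (-(δ * x)) * (Real.exp (-(δ * y)) * ‖h y‖) ∂μ :=
          norm_integral_le_of_norm_le ((integral_exp_mul_norm_le hδ h).1.const_mul _) (hle h x hx)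
      _ = C * Real.exp (-(δ * x)) * ∫ y, Real.exp (-(δ * y)) * ‖h y‖ ∂μ := integral_const_mul _ _
      _ ≤ C * Real.exp (-(δ * x)) * (‖e‖ * ‖h‖) :=
          mul_le_mul_of_nonneg_left (integral_exp_mul_norm_le hδ h).2 (by positivity)
      _ = _ := by ring
  have hle' : ∀ h : Lp ℂ 2 μ, ∀ᵐ x ∂μ, ‖∫ y, K x y * h y ∂μ‖ ≤
      (C * ‖e‖ * ‖h‖) * ‖(Real.exp (-(δ * x)) : ℂ)‖ := fun h => by
    filter_upwards [hpos] with x hx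
    rw [Complex.norm_real, Real.norm_eq_abs, Real.abs_exp]
    exact hbound h x hx
  have hmem : ∀ h : Lp ℂ 2 μ, MemLp (fun x => ∫ y, K x y * h y ∂μ) 2 μ := fun h =>
    (memLp_exp_neg hδ).of_le_mul (hsm h).integral_prod_right.aestronglyMeasurable (hle' h)
  let T₀ : Lp ℂ 2 μ →ₗ[ℂ] Lp ℂ 2 μ :=
    { toFun := fun h => (hmem h).toLp
      map_add' := fun h g => by
        rw [← MemLp.toLp_add]
        refine MemLp.toLp_congr _ _ ?_
        filter_upwards [hpos] with x hx
        rw [Pi.add_apply, ← integral_add (hint h x hx) (hint g x hx)]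
        refine integral_congr_ae ?_
        filter_upwards [Lp.coeFn_add h g] with y hy
        rw [hy, Pi.add_apply, mul_add]
      map_smul' := fun c h => by
        rw [RingHom.id_apply, ← MemLp.toLp_const_smul]
        refine MemLp.toLp_congr _ _ ?_
        filter_upwards [hpos] with x hx
        rw [Pi.smul_apply, ← integral_smul]
        refine integral_congr_ae ?_
        filter_upwards [Lp.coeFn_smul c h] with y hy
        rw [hy, Pi.smul_apply, mul_smul_comm] }
  refine ⟨T₀.mkContinuous (C * ‖e‖ * ‖e‖) fun h => ?_, fun h => ⟨?_, (hmem h).coeFn_toLp⟩⟩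
  · have := Lp.norm_le_mul_norm_of_ae_le_mul (f := T₀ h) (g := e) (c := C * ‖e‖ * ‖h‖) (by
      filter_upwards [hle' h, (hmem h).coeFn_toLp, (memLp_exp_neg hδ).coeFn_toLp] with x h1 h2 h3
      rw [he, h3]
      refine le_trans (le_of_eq ?_) h1
      exact congrArg norm h2)
    refine this.trans (le_of_eq (by ring))
  · filter_upwards [hpos] with x hx using hint h x hx

theorem norm_det_le_of_decay {n : ℕ}
    (hK : ∀ x > 0, ∀ y > 0, ‖K x y‖ ≤ C * (Real.exp (-(δ * x)) * Real.exp (-(δ * y))))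
    {x : Fin n → ℝ} (hx : ∀ i, 0 < x i) :
    ‖(Matrix.of fun i j => K (x i) (x j)).det‖ ≤
      n.factorial * ∏ i, (C * Real.exp (-(2 * δ) * x i)) := by
  rw [Matrix.det_apply]
  refine (norm_sum_le _ _).trans ?_
  have hterm : ∀ σ : Equiv.Perm (Fin n),
      ‖Equiv.Perm.sign σ • ∏ i, (Matrix.of fun i j => K (x i) (x j)) (σ i) i‖ ≤
        ∏ i, (C * Real.exp (-(2 * δ) * x i)) := fun σ => by
    have h1 : ‖Equiv.Perm.sign σ • ∏ i, (Matrix.of fun i j => K (x i) (x j)) (σ i) i‖ =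
        ∏ i, ‖K (x (σ i)) (x i)‖ := by
      rcases Int.units_eq_one_or (Equiv.Perm.sign σ) with h | h <;> simp [h, norm_prod]
    rw [h1]
    refine (Finset.prod_le_prod (fun _ _ => norm_nonneg _) fun i _ =>
      hK _ (hx (σ i)) _ (hx i)).trans (le_of_eq ?_)
    simp only [Finset.prod_mul_distrib]
    rw [Equiv.prod_comp σ fun i => Real.exp (-(δ * x i)), ← Finset.prod_mul_distrib]
    congr 1
    refine Finset.prod_congr rfl fun i _ => ?_
    rw [← Real.exp_add]
    ring_nf
  refine (Finset.sum_le_card_nsmul _ _ _ fun σ _ => hterm σ).trans (le_of_eq ?_)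
  rw [Finset.card_univ, Fintype.card_perm, Fintype.card_fin, nsmul_eq_mul]

theorem integrable_prod_exp (hδ : 0 < δ) (n : ℕ) (C : ℝ) :
    Integrable (fun x : Fin n → ℝ => n.factorial * ∏ i, (C * Real.exp (-(2 * δ) * x i)))
      (Measure.pi fun _ => volume.restrict (Ioi (0 : ℝ))) :=
  (Integrable.fintype_prod (f := fun _ x => C * Real.exp (-(2 * δ) * x)) fun _ =>
    (integrableOn_exp_mul_Ioi (by linarith) 0).const_mul C).const_mul _

theorem ae_pi_pos (n : ℕ) :
    ∀ᵐ x : Fin n → ℝ ∂(Measure.pi fun _ => volume.restrict (Ioi (0 : ℝ))), ∀ i, 0 < x i :=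
  Filter.eventually_all.2 fun _ =>
    Measure.tendsto_eval_ae_ae.eventually (ae_restrict_mem measurableSet_Ioi)

theorem measurable_det_kernel (hKm : Measurable (Function.uncurry K)) (n : ℕ) :
    Measurable fun x : Fin n → ℝ => (Matrix.of fun i j => K (x i) (x j)).det := by
  simp only [Matrix.det_apply', Matrix.of_apply]
  refine Finset.measurable_sum _ fun σ _ => Measurable.const_mul ?_ _
  refine Finset.measurable_prod _ fun i _ => ?_
  have h : Measurable fun x : Fin n → ℝ => (x (σ i), x i) :=
    (measurable_pi_apply (σ i)).prodMk (measurable_pi_apply i)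
  exact hKm.comp h

theorem integrable_det_of_decay (hδ : 0 < δ) (hKm : Measurable (Function.uncurry K))
    (hK : ∀ x > 0, ∀ y > 0, ‖K x y‖ ≤ C * (Real.exp (-(δ * x)) * Real.exp (-(δ * y)))) (n : ℕ) :
    Integrable (fun x : Fin n → ℝ => (Matrix.of fun i j => K (x i) (x j)).det)
      (Measure.pi fun _ => volume.restrict (Ioi (0 : ℝ))) :=
  (integrable_prod_exp hδ n C).mono' (measurable_det_kernel hKm n).aestronglyMeasurable
    ((ae_pi_pos n).mono fun _ hx => norm_det_le_of_decay hK hx)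

/-- The terms of the Fredholm expansion are continuous along kernels with uniform decay. -/
theorem tendsto_fredholmTerm {ι : Type*} {l : Filter ι} [l.IsCountablyGenerated]
    {F : ι → ℝ → ℝ → ℂ} (hδ : 0 < δ) (hFm : ∀ᶠ ε in l, Measurable (Function.uncurry (F ε)))
    (hF : ∀ᶠ ε in l, ∀ x > 0, ∀ y > 0,
      ‖F ε x y‖ ≤ C * (Real.exp (-(δ * x)) * Real.exp (-(δ * y))))
    (hlim : ∀ x > 0, ∀ y > 0, Filter.Tendsto (fun ε => F ε x y) l (nhds (K x y))) (n : ℕ) :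
    Filter.Tendsto (fun ε => fredholmTerm (volume.restrict (Ioi (0 : ℝ))) (F ε) n) l
      (nhds (fredholmTerm (volume.restrict (Ioi (0 : ℝ))) K n)) := by
  refine Filter.Tendsto.const_mul _ ?_
  refine tendsto_integral_filter_of_dominated_convergence _
    (hFm.mono fun ε h => (measurable_det_kernel h n).aestronglyMeasurable)
    (hF.mono fun ε h => (ae_pi_pos n).mono fun x hx => norm_det_le_of_decay h hx)
    (integrable_prod_exp hδ n C) ((ae_pi_pos n).mono fun x hx => ?_)
  simp only [Matrix.det_apply', Matrix.of_apply]
  refine tendsto_finsetSum _ fun σ _ => Filter.Tendsto.const_mul _ ?_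
  exact tendsto_finsetProd _ fun i _ => hlim _ (hx _) _ (hx _)

end Decay

/-! ### Dependence of the kernel on the parameters -/

/-- Small perturbations of an enclosed point are enclosed. -/
theorem Encloses.eventually_nhds {γ : ℝ → ℂ} (hγ : IsSimpleClosedContour γ) {p : ℂ}
    (h : Encloses γ p) : ∀ᶠ q in nhds p, Encloses γ q := by
  have ho : IsOpen (contourTrace γ)ᶜ := hγ.isCompact_trace.isClosed.isOpen_compl
  filter_upwards [(ho.connectedComponentIn (x := p)).mem_nhds (mem_connectedComponentIn h.1)]
    with q hq
  refine ⟨connectedComponentIn_subset _ _ hq, ?_⟩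
  rw [← connectedComponentIn_eq hq]
  exact h.2

theorem IsSimpleClosedContour.continuousOn_contourIntegral {γ : ℝ → ℂ}
    (hγ : IsSimpleClosedContour γ) {Y : Type*} [TopologicalSpace Y] [FirstCountableTopology Y]
    {F : Y → ℂ → ℂ} {S : Set Y} (hS : IsCompact S)
    (hF : ContinuousOn (fun q : Y × ℂ => F q.1 q.2) (S ×ˢ contourTrace γ)) :
    ContinuousOn (fun s => contourIntegral γ (F s)) S := by
  obtain ⟨C, hC⟩ := (hS.prod hγ.isCompact_trace).exists_bound_of_continuousOn hF
  intro s hs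
  refine hγ.tendsto_contourIntegral (C := C) ?_ ?_ fun z hz => ?_
  · filter_upwards [self_mem_nhdsWithin] with r hr
    exact hF.comp (by fun_prop : Continuous fun z : ℂ => (r, z)).continuousOn
      fun z hz => ⟨hr, hz⟩
  · filter_upwards [self_mem_nhdsWithin] with r hr z hz using hC (r, z) ⟨hr, hz⟩
  · have h := hF (s, z) ⟨hs, hz⟩
    exact h.tendsto.comp (tendsto_nhdsWithin_of_tendsto_nhds_of_eventually_within _
      ((by fun_prop : Continuous fun r : Y => (r, z)).tendsto s |>.mono_left nhdsWithin_le_nhds)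
      (by filter_upwards [self_mem_nhdsWithin] with r hr using ⟨hr, hz⟩))

section Continuity

variable {N : ℕ} {Γ₁ Γ₂ : ℝ → ℂ} {X : Type*} [TopologicalSpace X] {A B : X → ℕ → ℝ} {f g : X → ℝ}
  {S : Set X}

theorem continuousOn_flatIntegrand
    (hΓ₁_right : ∀ z ∈ contourTrace Γ₁, 0 < z.re) (hΓ₂_right : ∀ w ∈ contourTrace Γ₂, 0 < w.re)
    (hΓ : ∀ z ∈ contourTrace Γ₁, z ∉ contourTrace Γ₂)
    (hA : ∀ m, Continuous fun s => A s m) (hB : ∀ m, Continuous fun s => B s m)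
    (hf : Continuous f) (hg : Continuous g)
    (hAS : ∀ s ∈ S, ∀ i ∈ Finset.Icc 1 N, (A s i : ℂ) ∉ contourTrace Γ₁)
    (hBS : ∀ s ∈ S, ∀ j ∈ Finset.Icc 1 N, (B s j : ℂ) ∉ contourTrace Γ₂) (u : ℝ) :
    ContinuousOn (fun q : (X × ℂ) × ℂ =>
      flatIntegrand N (A q.1.1) (B q.1.1) u (f q.1.1) (g q.1.1) q.1.2 q.2)
      ((S ×ˢ contourTrace Γ₁) ×ˢ contourTrace Γ₂) := by
  have hfst : Continuous fun q : (X × ℂ) × ℂ => q.1.1 := by fun_prop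
  have hfc : Continuous fun q : (X × ℂ) × ℂ => (f q.1.1 : ℂ) :=
    Complex.continuous_ofReal.comp (hf.comp hfst)
  have hgc : Continuous fun q : (X × ℂ) × ℂ => (g q.1.1 : ℂ) :=
    Complex.continuous_ofReal.comp (hg.comp hfst)
  have hsub : ∀ q ∈ (S ×ˢ contourTrace Γ₁) ×ˢ contourTrace Γ₂, q.2 - q.1.2 ≠ 0 := fun q hq h =>
    hΓ _ hq.1.2 (sub_eq_zero.1 h ▸ hq.2)
  unfold flatIntegrand flatHhat
  refine ContinuousOn.mul (ContinuousOn.mul (by fun_prop) ?_) ?_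
  · refine ContinuousOn.add (ContinuousOn.add ?_ ?_) ?_
    · exact ContinuousOn.div (by fun_prop) (by fun_prop) hsub
    · refine ContinuousOn.div (by fun_prop) (by fun_prop) fun q hq => ?_
      rw [← neg_sub]
      exact neg_ne_zero.2 (hsub q hq)
    · refine ContinuousOn.div (by fun_prop) (by fun_prop) fun q hq h => ?_
      have h1 := hΓ₁_right _ hq.1.2
      have h2 := hΓ₂_right _ hq.2
      have h3 : (q.1.2 + q.2).re = 0 := by rw [h]; rfl
      rw [Complex.add_re] at h3
      linarith
  · refine continuousOn_finsetProd _ fun m hm => ?_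
    have hAc : Continuous fun q : (X × ℂ) × ℂ => (A q.1.1 m : ℂ) :=
      Complex.continuous_ofReal.comp ((hA m).comp hfst)
    have hBc : Continuous fun q : (X × ℂ) × ℂ => (B q.1.1 m : ℂ) :=
      Complex.continuous_ofReal.comp ((hB m).comp hfst)
    refine ContinuousOn.div (by fun_prop) (by fun_prop) fun q hq => mul_ne_zero ?_ ?_
    · exact sub_ne_zero.2 fun h => hAS _ hq.1.1 m hm (h ▸ hq.1.2)
    · exact sub_ne_zero.2 fun h => hBS _ hq.1.1 m hm (h ▸ hq.2)

theorem continuousOn_flatKernel [FirstCountableTopology X] (hΓ₁ : IsSimpleClosedContour Γ₁)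
    (hΓ₂ : IsSimpleClosedContour Γ₂)
    (hΓ₁_right : ∀ z ∈ contourTrace Γ₁, 0 < z.re) (hΓ₂_right : ∀ w ∈ contourTrace Γ₂, 0 < w.re)
    (hΓ : ∀ z ∈ contourTrace Γ₁, z ∉ contourTrace Γ₂)
    (hA : ∀ m, Continuous fun s => A s m) (hB : ∀ m, Continuous fun s => B s m)
    (hf : Continuous f) (hg : Continuous g) (hS : IsCompact S)
    (hAS : ∀ s ∈ S, ∀ i ∈ Finset.Icc 1 N, (A s i : ℂ) ∉ contourTrace Γ₁)
    (hBS : ∀ s ∈ S, ∀ j ∈ Finset.Icc 1 N, (B s j : ℂ) ∉ contourTrace Γ₂) (u : ℝ) :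
    ContinuousOn (fun s => flatKernel N (A s) (B s) Γ₁ Γ₂ u (f s) (g s)) S :=
  continuousOn_const.mul <| hΓ₁.continuousOn_contourIntegral (F := fun s z =>
      contourIntegral Γ₂ (flatIntegrand N (A s) (B s) u (f s) (g s) z)) hS <|
    hΓ₂.continuousOn_contourIntegral (F := fun (q : X × ℂ) w =>
      flatIntegrand N (A q.1) (B q.1) u (f q.1) (g q.1) q.2 w) (hS.prod hΓ₁.isCompact_trace) <|
    continuousOn_flatIntegrand hΓ₁_right hΓ₂_right hΓ hA hB hf hg hAS hBS u

/-- The kernel decays exponentially, uniformly over compact sets of parameters. -/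
theorem exists_norm_flatKernel_le (hΓ₁ : IsSimpleClosedContour Γ₁)
    (hΓ₂ : IsSimpleClosedContour Γ₂)
    (hΓ₁_right : ∀ z ∈ contourTrace Γ₁, 0 < z.re) (hΓ₂_right : ∀ w ∈ contourTrace Γ₂, 0 < w.re)
    (hΓ : ∀ z ∈ contourTrace Γ₁, z ∉ contourTrace Γ₂)
    (hA : ∀ m, Continuous fun s => A s m) (hB : ∀ m, Continuous fun s => B s m) (hS : IsCompact S)
    (hAS : ∀ s ∈ S, ∀ i ∈ Finset.Icc 1 N, (A s i : ℂ) ∉ contourTrace Γ₁)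
    (hBS : ∀ s ∈ S, ∀ j ∈ Finset.Icc 1 N, (B s j : ℂ) ∉ contourTrace Γ₂) (u : ℝ) :
    ∃ δ > 0, ∃ C ≥ 0, ∀ s ∈ S, ∀ x > 0, ∀ y > 0, ‖flatKernel N (A s) (B s) Γ₁ Γ₂ u x y‖ ≤
      C * (Real.exp (-(δ * x)) * Real.exp (-(δ * y))) := by
  obtain ⟨δ₁, hδ₁, h₁⟩ := hΓ₁.isCompact_trace.exists_forall_le'
    Complex.continuous_re.continuousOn hΓ₁_right
  obtain ⟨δ₂, hδ₂, h₂⟩ := hΓ₂.isCompact_trace.exists_forall_le'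
    Complex.continuous_re.continuousOn hΓ₂_right
  obtain ⟨C, hC⟩ := ((hS.prod hΓ₁.isCompact_trace).prod
    hΓ₂.isCompact_trace).exists_bound_of_continuousOn (continuousOn_flatIntegrand hΓ₁_right
      hΓ₂_right hΓ hA hB continuous_const continuous_const hAS hBS u (f := fun _ => 0)
      (g := fun _ => 0))
  set L₁ := ∫ t in (0 : ℝ)..1, ‖deriv Γ₁ t‖ with hL₁
  set L₂ := ∫ t in (0 : ℝ)..1, ‖deriv Γ₂ t‖ with hL₂
  have hL₁0 : 0 ≤ L₁ := intervalIntegral.integral_nonneg zero_le_one fun _ _ => norm_nonneg _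
  have hL₂0 : 0 ≤ L₂ := intervalIntegral.integral_nonneg zero_le_one fun _ _ => norm_nonneg _
  set c := ‖1 / (2 * (Real.pi : ℂ) * Complex.I) ^ 2‖ with hc
  refine ⟨min δ₁ δ₂, lt_min hδ₁ hδ₂, c * (|C| * L₂ * L₁), by positivity,
    fun s hs x hx y hy => ?_⟩
  set E := Real.exp (-(min δ₁ δ₂ * x)) * Real.exp (-(min δ₁ δ₂ * y)) with hE
  have hexp : ∀ z ∈ contourTrace Γ₁, ∀ w ∈ contourTrace Γ₂,
      ‖Complex.exp (-x * z - y * w)‖ ≤ E := fun z hz w hw => by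
    rw [Complex.norm_exp, hE, ← Real.exp_add, Real.exp_le_exp]
    have e1 := mul_le_mul_of_nonneg_left ((min_le_left δ₁ δ₂).trans (h₁ z hz)) hx.le
    have e2 := mul_le_mul_of_nonneg_left ((min_le_right δ₁ δ₂).trans (h₂ w hw)) hy.le
    simp only [Complex.sub_re, Complex.mul_re, Complex.neg_re, Complex.neg_im, Complex.ofReal_re,
      Complex.ofReal_im]
    linarith
  have hint : ∀ z ∈ contourTrace Γ₁, ∀ w ∈ contourTrace Γ₂,
      ‖flatIntegrand N (A s) (B s) u x y z w‖ ≤ |C| * E := fun z hz w hw => by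
    have e1 : flatIntegrand N (A s) (B s) u x y z w =
        Complex.exp (-x * z - y * w) * flatIntegrand N (A s) (B s) u 0 0 z w := by
      simp [flatIntegrand, mul_assoc]
    rw [e1, norm_mul, mul_comm |C|]
    exact mul_le_mul (hexp z hz w hw) ((hC ((s, z), w) ⟨⟨hs, hz⟩, hw⟩).trans (le_abs_self C))
      (norm_nonneg _) (by positivity)
  calc ‖flatKernel N (A s) (B s) Γ₁ Γ₂ u x y‖
      = c * ‖contourIntegral Γ₁ fun z => contourIntegral Γ₂
          (flatIntegrand N (A s) (B s) u x y z)‖ := norm_mul _ _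
    _ ≤ c * ((|C| * E * L₂) * L₁) := by
        refine mul_le_mul_of_nonneg_left ?_ (norm_nonneg _)
        exact hΓ₁.norm_contourIntegral_le fun z hz =>
          hΓ₂.norm_contourIntegral_le fun w hw => hint z hz w hw
    _ = _ := by ring

end Continuity

/-! ### Equal parameters -/

theorem eventually_add_mul_ne {a b c d : ℝ} (h : c ≠ d) :
    ∀ᶠ ε in nhdsWithin (0 : ℝ) (Ioi 0), a + ε * c ≠ b + ε * d := by
  by_cases hab : a = b
  · filter_upwards [self_mem_nhdsWithin] with ε hε he
    have hε' : ε ≠ 0 := ne_of_gt hε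
    exact h (mul_left_cancel₀ hε' (by linarith))
  · have h1 : Filter.Tendsto (fun ε : ℝ => a + ε * c - (b + ε * d)) (nhds 0)
        (nhds (a + 0 * c - (b + 0 * d))) := (by fun_prop : Continuous _).tendsto 0
    have h2 := h1.eventually (isOpen_ne.mem_nhds
      (by simpa [sub_eq_zero] using hab : a + 0 * c - (b + 0 * d) ≠ 0))
    exact (h2.filter_mono nhdsWithin_le_nhds).mono fun ε => sub_ne_zero.1

/-- The perturbation `v i + ε (c + i)` of the parameters `v i`; for small `ε > 0` it makes them
distinct. -/
def perturb (c : ℕ) (v : ℕ → ℝ) (ε : ℝ) (i : ℕ) : ℝ := v i + ε * (c + i : ℕ)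

theorem perturb_zero (c : ℕ) (v : ℕ → ℝ) : perturb c v 0 = v := by
  funext i; simp [perturb]

theorem continuous_perturb (c : ℕ) (v : ℕ → ℝ) (i : ℕ) : Continuous fun ε => perturb c v ε i := by
  unfold perturb; fun_prop

theorem le_perturb (c : ℕ) (v : ℕ → ℝ) {ε : ℝ} (hε : 0 ≤ ε) (i : ℕ) : v i ≤ perturb c v ε i :=
  le_add_of_nonneg_right (by positivity)

theorem eventually_injOn_perturb (c : ℕ) (v : ℕ → ℝ) (s : Finset ℕ) :
    ∀ᶠ ε in nhdsWithin (0 : ℝ) (Ioi 0), InjOn (perturb c v ε) s := by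
  have h : ∀ i ∈ s, ∀ j ∈ s, ∀ᶠ ε in nhdsWithin (0 : ℝ) (Ioi 0),
      perturb c v ε i = perturb c v ε j → i = j := fun i _ j _ => by
    by_cases hij : i = j
    · exact Filter.Eventually.of_forall fun _ _ => hij
    · exact (eventually_add_mul_ne (by exact_mod_cast fun h => hij (by omega))).mono
        fun ε h1 h2 => absurd h2 h1
  have h' := (Filter.eventually_all_finset s).2 fun i hi =>
    (Filter.eventually_all_finset s).2 fun j hj => h i hi j hj
  exact h'.mono fun ε hε i hi j hj => hε i hi j hj

theorem eventually_perturb_ne (N : ℕ) (α β : ℕ → ℝ) :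
    ∀ᶠ ε in nhdsWithin (0 : ℝ) (Ioi 0), ∀ i ∈ Finset.Icc 1 N, ∀ j ∈ Finset.Icc 1 N,
      perturb 0 α ε i ≠ perturb N β ε j := by
  refine (Filter.eventually_all_finset _).2 fun i hi => (Filter.eventually_all_finset _).2
    fun j hj => eventually_add_mul_ne ?_
  rw [Finset.mem_Icc] at hi hj
  exact_mod_cast (by omega : 0 + i ≠ N + j)

theorem eventually_encloses_perturb {γ : ℝ → ℂ} (hγ : IsSimpleClosedContour γ) (c : ℕ) {v : ℕ → ℝ}
    {s : Finset ℕ} (hv : ∀ i ∈ s, Encloses γ (v i)) :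
    ∀ᶠ ε in nhds (0 : ℝ), ∀ i ∈ s, Encloses γ (perturb c v ε i) := by
  refine (Filter.eventually_all_finset _).2 fun i hi => ?_
  have h1 : Filter.Tendsto (fun ε : ℝ => (perturb c v ε i : ℂ)) (nhds 0)
      (nhds (perturb c v 0 i : ℂ)) :=
    (Complex.continuous_ofReal.comp (continuous_perturb c v i)).tendsto 0
  rw [perturb_zero] at h1
  exact h1.eventually ((hv i hi).eventually_nhds hγ)

/-- The Fredholm determinant of the kernel, as a limit of ratios of Cauchy-like determinants with
perturbed parameters. -/
theorem fredholmDet_flatKernel_of_tendsto {N : ℕ} {α β : ℕ → ℝ} {Γ₁ Γ₂ : ℝ → ℂ} (hN : 1 ≤ N)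
    (hα : ∀ i ∈ Finset.Icc 1 N, 0 < α i) (hβ : ∀ j ∈ Finset.Icc 1 N, 0 < β j)
    (hΓ₁ : IsSimpleClosedContour Γ₁) (hΓ₁_pos : IsPositivelyOriented Γ₁)
    (hΓ₂ : IsSimpleClosedContour Γ₂) (hΓ₂_pos : IsPositivelyOriented Γ₂)
    (hΓ₁_right : ∀ z ∈ contourTrace Γ₁, 0 < z.re) (hΓ₂_right : ∀ w ∈ contourTrace Γ₂, 0 < w.re)
    (hΓ₁_encl : ∀ i ∈ Finset.Icc 1 N, Encloses Γ₁ (α i))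
    (hΓ₂_encl : ∀ j ∈ Finset.Icc 1 N, Encloses Γ₂ (β j))
    (hΓ : ∀ z ∈ contourTrace Γ₁, z ∉ contourTrace Γ₂) (u : ℝ) {p : ℝ → ℝ} {p₀ : ℝ}
    (hp : ∀ ε > 0, InjOn (perturb 0 α ε) (Finset.Icc 1 N) →
      InjOn (perturb N β ε) (Finset.Icc 1 N) →
      (∀ i ∈ Finset.Icc 1 N, ∀ j ∈ Finset.Icc 1 N, perturb 0 α ε i ≠ perturb N β ε j) →
      p ε * (Matrix.of fun k j : Fin N =>
          1 / (perturb 0 α ε (k + 1) + perturb N β ε (j + 1))).det =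
        (Matrix.of fun k j : Fin N => 1 / (perturb 0 α ε (k + 1) + perturb N β ε (j + 1)) -
          realHhat u (perturb 0 α ε (k + 1)) (perturb N β ε (j + 1))).det)
    (hlim : Filter.Tendsto p (nhdsWithin 0 (Ioi 0)) (nhds p₀)) :
    (∃ T : Lp ℂ 2 (volume.restrict (Ioi (0 : ℝ))) →L[ℂ] Lp ℂ 2 (volume.restrict (Ioi (0 : ℝ))),
      IsIntegralOperator (volume.restrict (Ioi (0 : ℝ))) (flatKernel N α β Γ₁ Γ₂ u) T) ∧
    FredholmConverges (volume.restrict (Ioi (0 : ℝ))) (fun x y => -flatKernel N α β Γ₁ Γ₂ u x y) ∧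
    (p₀ : ℂ) =
      fredholmDet (volume.restrict (Ioi (0 : ℝ))) (fun x y => -flatKernel N α β Γ₁ Γ₂ u x y) := by
  set A := perturb 0 α
  set B := perturb N β
  have hA0 : A 0 = α := perturb_zero 0 α
  have hB0 : B 0 = β := perturb_zero N β
  obtain ⟨r, hr, hS⟩ := Metric.nhds_basis_closedBall.eventually_iff.1
    ((eventually_encloses_perturb hΓ₁ 0 hΓ₁_encl).and (eventually_encloses_perturb hΓ₂ N hΓ₂_encl))
  set S := Metric.closedBall (0 : ℝ) r with hSdef
  have hSc : IsCompact S := isCompact_closedBall 0 r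
  have h0S : (0 : ℝ) ∈ S := Metric.mem_closedBall_self hr.le
  have hSl : ∀ᶠ ε in nhdsWithin (0 : ℝ) (Ioi 0), ε ∈ S :=
    nhdsWithin_le_nhds (Metric.closedBall_mem_nhds 0 hr)
  have hAS : ∀ ε ∈ S, ∀ i ∈ Finset.Icc 1 N, (A ε i : ℂ) ∉ contourTrace Γ₁ := fun ε hε i hi =>
    ((hS hε).1 i hi).1
  have hBS : ∀ ε ∈ S, ∀ j ∈ Finset.Icc 1 N, (B ε j : ℂ) ∉ contourTrace Γ₂ := fun ε hε j hj =>
    ((hS hε).2 j hj).1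
  have hAc : ∀ m, Continuous fun ε => A ε m := continuous_perturb 0 α
  have hBc : ∀ m, Continuous fun ε => B ε m := continuous_perturb N β
  obtain ⟨δ, hδ, C, hC, hdecay⟩ := exists_norm_flatKernel_le hΓ₁ hΓ₂ hΓ₁_right hΓ₂_right hΓ hAc hBc
    hSc hAS hBS u
  have hmeas : ∀ ε ∈ S, Measurable (Function.uncurry (flatKernel N (A ε) (B ε) Γ₁ Γ₂ u)) :=
    fun ε hε => by
      refine Continuous.measurable (continuous_iff_continuousAt.2 fun q => ?_)
      exact (continuousOn_flatKernel (f := Prod.fst) (g := Prod.snd) (A := fun _ : ℝ × ℝ => A ε)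
        (B := fun _ : ℝ × ℝ => B ε) hΓ₁ hΓ₂ hΓ₁_right hΓ₂_right hΓ (fun _ => continuous_const)
        (fun _ => continuous_const) continuous_fst continuous_snd (isCompact_closedBall q 1)
        (fun _ _ => hAS ε hε) (fun _ _ => hBS ε hε) u).continuousAt
        (Metric.closedBall_mem_nhds q one_pos)
  have hpt : ∀ x y : ℝ, Filter.Tendsto (fun ε => -flatKernel N (A ε) (B ε) Γ₁ Γ₂ u x y)
      (nhdsWithin 0 (Ioi 0)) (nhds (-flatKernel N α β Γ₁ Γ₂ u x y)) := fun x y => by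
    have h1 := (continuousOn_flatKernel (f := fun _ => x) (g := fun _ => y) hΓ₁ hΓ₂ hΓ₁_right
      hΓ₂_right hΓ hAc hBc continuous_const continuous_const hSc hAS hBS u).continuousAt
      (Metric.closedBall_mem_nhds 0 hr)
    have h2 : Filter.Tendsto (fun ε => -flatKernel N (A ε) (B ε) Γ₁ Γ₂ u x y) (nhds 0)
        (nhds (-flatKernel N (A 0) (B 0) Γ₁ Γ₂ u x y)) := h1.neg
    rw [hA0, hB0] at h2
    exact h2.mono_left nhdsWithin_le_nhds
  have hdecay' : ∀ ε ∈ S, ∀ x > 0, ∀ y > 0, ‖-flatKernel N (A ε) (B ε) Γ₁ Γ₂ u x y‖ ≤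
      C * (Real.exp (-(δ * x)) * Real.exp (-(δ * y))) := fun ε hε x hx y hy => by
    rw [norm_neg]; exact hdecay ε hε x hx y hy
  have hmeas' : ∀ ε ∈ S,
      Measurable (Function.uncurry fun x y => -flatKernel N (A ε) (B ε) Γ₁ Γ₂ u x y) :=
    fun ε hε => (hmeas ε hε).neg
  have hterm := tendsto_fredholmTerm hδ (hSl.mono hmeas') (hSl.mono hdecay')
    (fun x _ y _ => hpt x y)
  have hdist : ∀ᶠ ε in nhdsWithin (0 : ℝ) (Ioi 0),
      (∀ n, N < n → fredholmTerm (volume.restrict (Ioi (0 : ℝ)))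
        (fun x y => -flatKernel N (A ε) (B ε) Γ₁ Γ₂ u x y) n = 0) ∧
      ∑ n ∈ Finset.range (N + 1), fredholmTerm (volume.restrict (Ioi (0 : ℝ)))
        (fun x y => -flatKernel N (A ε) (B ε) Γ₁ Γ₂ u x y) n = p ε := by
    filter_upwards [hSl, self_mem_nhdsWithin, eventually_injOn_perturb 0 α (Finset.Icc 1 N),
      eventually_injOn_perturb N β (Finset.Icc 1 N), eventually_perturb_ne N α β]
      with ε hε hpos hinjA hinjB hne
    have hpos' : 0 ≤ ε := le_of_lt hpos
    exact fredholmTerm_flatKernel hN (fun i hi => (hα i hi).trans_le (le_perturb 0 α hpos' i))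
      (fun j hj => (hβ j hj).trans_le (le_perturb N β hpos' j)) hinjA hinjB hne hΓ₁ hΓ₁_pos hΓ₂
      hΓ₂_pos hΓ₁_right hΓ₂_right (hS hε).1 (hS hε).2 hΓ u (hp ε hpos hinjA hinjB hne)
  have hzero : ∀ n, N < n → fredholmTerm (volume.restrict (Ioi (0 : ℝ)))
      (fun x y => -flatKernel N α β Γ₁ Γ₂ u x y) n = 0 := fun n hn =>
    tendsto_nhds_unique (hterm n)
      (tendsto_const_nhds.congr' (hdist.mono fun ε h => (h.1 n hn).symm))
  have hsum : ∑ n ∈ Finset.range (N + 1), fredholmTerm (volume.restrict (Ioi (0 : ℝ)))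
      (fun x y => -flatKernel N α β Γ₁ Γ₂ u x y) n = p₀ :=
    tendsto_nhds_unique (tendsto_finsetSum _ fun n _ => hterm n)
      (((Complex.continuous_ofReal.tendsto _).comp hlim).congr' (hdist.mono fun ε h => h.2.symm))
  have hout : ∀ n ∉ Finset.range (N + 1), fredholmTerm (volume.restrict (Ioi (0 : ℝ)))
      (fun x y => -flatKernel N α β Γ₁ Γ₂ u x y) n = 0 := fun n hn => hzero n (by
    rw [Finset.mem_range] at hn; omega)
  have hm0 := hmeas 0 h0S
  have hd0 := hdecay 0 h0S
  have hm0' := hmeas' 0 h0S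
  have hd0' := hdecay' 0 h0S
  rw [hA0, hB0] at hm0 hd0 hm0' hd0'
  refine ⟨exists_isIntegralOperator hδ hC hm0 hd0,
    ⟨fun n => integrable_det_of_decay hδ hm0' hd0' n, summable_of_ne_finset_zero hout⟩, ?_⟩
  rw [fredholmDet, tsum_eq_sum hout, hsum]

/-! ### Coupling last passage times with different rates -/

theorem lppTime_mono {w w' : ℕ × ℕ → ℝ} (h : ∀ q, w q ≤ w' q) (n : ℕ) (p : ℕ × ℕ) :
    lppTime n w p ≤ lppTime n w' p := by
  induction n generalizing p with
  | zero => exact le_rfl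
  | succ n ih => exact add_le_add (h p) (max_le_max (ih _) (ih _))

theorem tendsto_lppTime {ι : Type*} {l : Filter ι} {w : ι → ℕ × ℕ → ℝ} {w₀ : ℕ × ℕ → ℝ}
    (h : ∀ q, Filter.Tendsto (fun i => w i q) l (nhds (w₀ q))) (n : ℕ) (p : ℕ × ℕ) :
    Filter.Tendsto (fun i => lppTime n (w i) p) l (nhds (lppTime n w₀ p)) := by
  induction n generalizing p with
  | zero => exact tendsto_const_nhds
  | succ n ih => exact (h p).add ((ih _).max (ih _))

theorem expMeasure_real_Iic {r : ℝ} (hr : 0 < r) (x : ℝ) :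
    (expMeasure r).real (Iic x) = if 0 ≤ x then 1 - Real.exp (-(r * x)) else 0 := by
  have := isProbabilityMeasure_expMeasure hr
  rw [← cdf_eq_real, cdf_expMeasure_eq hr]

theorem ae_expMeasure_nonneg {r : ℝ} (hr : 0 < r) : ∀ᵐ x ∂(expMeasure r), 0 ≤ x := by
  have := isProbabilityMeasure_expMeasure hr
  have h := expMeasure_real_Iic hr 0
  rw [if_pos le_rfl, mul_zero, neg_zero, Real.exp_zero, sub_self, measureReal_eq_zero_iff] at h
  refine (measure_eq_zero_iff_ae_notMem.1 h).mono fun x hx => ?_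
  exact (not_le.1 hx).le

theorem map_mul_expMeasure {r s : ℝ} (hr : 0 < r) (hs : 0 < s) :
    (expMeasure r).map (fun x => x * (r / s)) = expMeasure s := by
  have := isProbabilityMeasure_expMeasure hr
  have := isProbabilityMeasure_expMeasure hs
  have hm : Measurable fun x : ℝ => x * (r / s) := by fun_prop
  have : IsProbabilityMeasure ((expMeasure r).map fun x => x * (r / s)) :=
    Measure.isProbabilityMeasure_map hm.aemeasurable
  refine Measure.eq_of_cdf _ _ ?_
  ext x
  have h1 : (fun x : ℝ => x * (r / s)) ⁻¹' Iic x = Iic (x / (r / s)) := by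
    ext y
    exact (le_div_iff₀ (div_pos hr hs)).symm
  have h2 : 0 ≤ x / (r / s) ↔ 0 ≤ x := by
    rw [le_div_iff₀ (div_pos hr hs), zero_mul]
  have h3 : r * (x / (r / s)) = s * x := by field_simp
  rw [cdf_eq_real, cdf_eq_real, map_measureReal_apply hm measurableSet_Iic, h1,
    expMeasure_real_Iic hr, expMeasure_real_Iic hs]
  simp only [h2, h3]

theorem weightRate_pos {N : ℕ} {α β : ℕ → ℝ} (hα : ∀ i ∈ Finset.Icc 1 N, 0 < α i)
    (hβ : ∀ j ∈ Finset.Icc 1 N, 0 < β j) {p : ℕ × ℕ} (hp : p ∈ triangle N) :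
    0 < weightRate N α β p := by
  obtain ⟨h1, h2, h3⟩ := hp
  unfold weightRate
  split_ifs with h4 h5 <;> refine add_pos ?_ ?_ <;>
    first
      | exact hα _ (Finset.mem_Icc.2 (by omega))
      | exact hβ _ (Finset.mem_Icc.2 (by omega))

theorem weightRate_le_perturb (N : ℕ) (α β : ℕ → ℝ) {ε : ℝ} (hε : 0 ≤ ε) (p : ℕ × ℕ) :
    weightRate N α β p ≤ weightRate N (perturb 0 α ε) (perturb N β ε) p := by
  unfold weightRate
  split_ifs <;> exact add_le_add (le_perturb _ _ hε _) (le_perturb _ _ hε _)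

theorem continuous_weightRate_perturb (N : ℕ) (α β : ℕ → ℝ) (p : ℕ × ℕ) :
    Continuous fun ε => weightRate N (perturb 0 α ε) (perturb N β ε) p := by
  unfold weightRate
  split_ifs <;> exact (continuous_perturb _ _ _).add (continuous_perturb _ _ _)

/-- The weights may be taken measurable and nonnegative everywhere, and zero off the triangle. -/
theorem exists_regular_weights {Ω : Type*} [MeasurableSpace Ω] {P : Measure Ω} {N : ℕ}
    {α β : ℕ → ℝ} (hα : ∀ i ∈ Finset.Icc 1 N, 0 < α i) (hβ : ∀ j ∈ Finset.Icc 1 N, 0 < β j)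
    {W : ℕ × ℕ → Ω → ℝ}
    (hW_law : ∀ p ∈ triangle N, HasLaw (W p) (expMeasure (weightRate N α β p)) P) :
    ∃ V : ℕ × ℕ → Ω → ℝ, (∀ p, Measurable (V p)) ∧ (∀ p ω, 0 ≤ V p ω) ∧
      (∀ p ∉ triangle N, ∀ ω, V p ω = 0) ∧ ∀ p ∈ triangle N, W p =ᵐ[P] V p := by
  have h : ∀ p, ∃ v : Ω → ℝ, Measurable v ∧ (∀ ω, 0 ≤ v ω) ∧ (p ∉ triangle N → ∀ ω, v ω = 0) ∧
      (p ∈ triangle N → W p =ᵐ[P] v) := fun p => by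
    by_cases hp : p ∈ triangle N
    · have hl := hW_law p hp
      refine ⟨fun ω => max (hl.aemeasurable.mk (W p) ω) 0,
        hl.aemeasurable.measurable_mk.max measurable_const, fun ω => le_max_right _ _,
        fun h => absurd hp h, fun _ => ?_⟩
      have h0 : ∀ᵐ ω ∂P, 0 ≤ W p ω := ae_of_ae_map hl.aemeasurable (p := fun x => 0 ≤ x) (by
        rw [hl.map_eq]; exact ae_expMeasure_nonneg (weightRate_pos hα hβ hp))
      filter_upwards [h0, hl.aemeasurable.ae_eq_mk] with ω h1 h2
      rw [← h2, max_eq_left h1]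
    · exact ⟨fun _ => 0, measurable_const, fun _ => le_rfl, fun _ _ => rfl, fun h => absurd h hp⟩
  choose V h1 h2 h3 h4 using h
  exact ⟨V, h1, h2, h3, h4⟩

/-- Scaling the weights couples last passage percolations with different rates; along the perturbed
rates, the distribution function of the last passage time converges. The perturbed passage times
converge from below, so that this holds at every threshold `u`. -/
theorem exists_tendsto_measureReal_pointToLineTime {Ω : Type*} [MeasurableSpace Ω] {P : Measure Ω}
    [IsProbabilityMeasure P] {N : ℕ} (hN : 1 ≤ N)
    {α β : ℕ → ℝ} (hα : ∀ i ∈ Finset.Icc 1 N, 0 < α i) (hβ : ∀ j ∈ Finset.Icc 1 N, 0 < β j)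
    {W : ℕ × ℕ → Ω → ℝ}
    (hW_indep : iIndepFun (fun p : triangle N => W p) P)
    (hW_law : ∀ p ∈ triangle N, HasLaw (W p) (expMeasure (weightRate N α β p)) P) (u : ℝ) :
    ∃ V : ℝ → ℕ × ℕ → Ω → ℝ, (∀ ε p, Measurable (V ε p)) ∧
      (∀ ε > 0, ∀ p ω, 0 ≤ V ε p ω) ∧
      (∀ ε > 0, iIndepFun (fun p : triangle N => V ε p) P) ∧
      (∀ ε > 0, ∀ p ∈ triangle N, P.map (V ε p) =
        expMeasure (weightRate N (perturb 0 α ε) (perturb N β ε) p)) ∧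
      Filter.Tendsto (fun ε => P.real {ω | pointToLineTime (2 * N) (fun p => V ε p ω) ≤ u})
        (nhdsWithin 0 (Ioi 0))
        (nhds (P.real {ω | pointToLineTime (2 * N) (fun p => W p ω) ≤ u})) := by
  obtain ⟨V, hVm, hV0, hVout, hVW⟩ := exists_regular_weights hα hβ hW_law
  set c : ℝ → ℕ × ℕ → ℝ := fun ε p =>
    weightRate N α β p / weightRate N (perturb 0 α ε) (perturb N β ε) p with hc
  have hr : ∀ p ∈ triangle N, 0 < weightRate N α β p := fun p hp => weightRate_pos hα hβ hp
  have hr' : ∀ ε > 0, ∀ p ∈ triangle N,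
      0 < weightRate N (perturb 0 α ε) (perturb N β ε) p := fun ε hε p hp =>
    (hr p hp).trans_le (weightRate_le_perturb N α β (le_of_lt hε) p)
  have hm : ∀ ε p, Measurable fun ω => V p ω * c ε p := fun ε p => (hVm p).mul_const _
  have hind : iIndepFun (fun p : triangle N => V p) P := hW_indep.congr fun p => hVW p p.2
  have h2N : 1 ≤ 2 * N := by omega
  refine ⟨fun ε p ω => V p ω * c ε p, hm, fun ε hε p ω => ?_, fun ε hε => ?_, fun ε hε p hp => ?_,
    ?_⟩
  · by_cases hp : p ∈ triangle N
    · exact mul_nonneg (hV0 p ω) (div_nonneg (hr p hp).le (hr' ε hε p hp).le)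
    · exact le_of_eq (by simp only [hVout p hp, zero_mul])
  · exact hind.comp (fun p x => x * c ε p) fun p => measurable_id.mul_const _
  · have h1 : P.map (V p) = expMeasure (weightRate N α β p) := by
      rw [← (hW_law p hp).map_eq]
      exact Measure.map_congr (hVW p hp).symm
    have h2 : P.map (fun ω => V p ω * c ε p) = (P.map (V p)).map fun x => x * c ε p :=
      (Measure.map_map (measurable_id.mul_const _) (hVm p)).symm
    rw [h2, h1]
    exact map_mul_expMeasure (hr p hp) (hr' ε hε p hp)
  · simp only [pointToLineTime_eq_lppTime h2N]
    have hWV : P.real {ω | lppTime (2 * N) (fun p => W p ω) (1, 1) ≤ u} =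
        P.real {ω | lppTime (2 * N) (fun p => V p ω) (1, 1) ≤ u} := by
      have hae : ∀ᵐ ω ∂P, ∀ p ∈ triangle N, W p ω = V p ω :=
        (ae_ball_iff (finite_staircase (2 * N)).countable).2 fun p hp => hVW p hp
      refine measureReal_congr ?_
      filter_upwards [hae] with ω hω
      refine propext ?_
      show lppTime _ _ _ ≤ u ↔ lppTime _ _ _ ≤ u
      rw [lppTime_congr (w' := fun p => V p ω) (2 * N) (1, 1) fun q h1 h2 h3 =>
        hω q ⟨h1, h2, by simp only at h3; omega⟩]
    rw [hWV]
    refine (ENNReal.tendsto_toReal (measure_ne_top P _)).comp ?_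
    refine tendsto_measure_of_ae_tendsto_indicator_of_isFiniteMeasure _
      (measurableSet_le (measurable_lppTime (fun p => hVm p) _ _) measurable_const)
      (fun ε => measurableSet_le (measurable_lppTime (fun p => hm ε p) _ _) measurable_const)
      (Filter.Eventually.of_forall fun ω => ?_)
    have hle : ∀ ε > 0, ∀ q, V q ω * c ε q ≤ V q ω := fun ε hε q => by
      by_cases hq : q ∈ triangle N
      · exact mul_le_of_le_one_right (hV0 q ω)
          (div_le_one_of_le₀ (weightRate_le_perturb N α β (le_of_lt hε) q) (hr' ε hε q hq).le)
      · rw [hVout q hq, zero_mul]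
    have hlim : ∀ q, Filter.Tendsto (fun ε => V q ω * c ε q) (nhdsWithin 0 (Ioi 0))
        (nhds (V q ω)) := fun q => by
      by_cases hq : q ∈ triangle N
      · have h1 := (continuous_weightRate_perturb N α β q).tendsto 0
        rw [perturb_zero, perturb_zero] at h1
        have h2 : Filter.Tendsto (fun ε => V q ω * c ε q) (nhds 0)
            (nhds (V q ω * (weightRate N α β q / weightRate N α β q))) :=
          (tendsto_const_nhds.div h1 (hr q hq).ne').const_mul (V q ω)
        rw [div_self (hr q hq).ne', mul_one] at h2
        exact h2.mono_left nhdsWithin_le_nhds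
      · simp only [hVout q hq, zero_mul]
        exact tendsto_const_nhds
    by_cases hu : lppTime (2 * N) (fun p => V p ω) (1, 1) ≤ u
    · filter_upwards [self_mem_nhdsWithin] with ε hε
      exact ⟨fun _ => hu, fun _ => (lppTime_mono (hle ε hε) _ _).trans hu⟩
    · filter_upwards [(tendsto_lppTime hlim (2 * N) (1, 1)).eventually_const_lt (not_le.1 hu)]
        with ε hε
      exact ⟨fun h => absurd h (not_le.2 hε), fun h => absurd h hu⟩

theorem theorem4p2 {Ω : Type*} [MeasurableSpace Ω] (P : Measure Ω) [IsProbabilityMeasure P]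
    (N : ℕ) (hN : 1 ≤ N)
    (α β : ℕ → ℝ) (hα : ∀ i ∈ Finset.Icc 1 N, 0 < α i) (hβ : ∀ j ∈ Finset.Icc 1 N, 0 < β j)
    (W : ℕ × ℕ → Ω → ℝ)
    (hW_indep : iIndepFun (fun p : triangle N => W p) P)
    (hW_law : ∀ p ∈ triangle N, HasLaw (W p) (expMeasure (weightRate N α β p)) P)
    (Γ₁ Γ₂ : ℝ → ℂ)
    (hΓ₁ : IsSimpleClosedContour Γ₁) (hΓ₁_pos : IsPositivelyOriented Γ₁)
    (hΓ₂ : IsSimpleClosedContour Γ₂) (hΓ₂_pos : IsPositivelyOriented Γ₂)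
    (hΓ₁_right : ∀ z ∈ contourTrace Γ₁, 0 < z.re) (hΓ₂_right : ∀ w ∈ contourTrace Γ₂, 0 < w.re)
    (hΓ₁_encl : ∀ i ∈ Finset.Icc 1 N, Encloses Γ₁ (α i))
    (hΓ₂_encl : ∀ j ∈ Finset.Icc 1 N, Encloses Γ₂ (β j))
    (hΓ₂_encl_Γ₁ : ∀ z ∈ contourTrace Γ₁, Encloses Γ₂ z)
    (u : ℝ) (hu : 0 < u) :
    (∃ T : Lp ℂ 2 (volume.restrict (Ioi (0 : ℝ))) →L[ℂ] Lp ℂ 2 (volume.restrict (Ioi (0 : ℝ))),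
      IsIntegralOperator (volume.restrict (Ioi (0 : ℝ))) (flatKernel N α β Γ₁ Γ₂ u) T) ∧
    FredholmConverges (volume.restrict (Ioi (0 : ℝ))) (fun x y => -flatKernel N α β Γ₁ Γ₂ u x y) ∧
    ((P.real {ω | pointToLineTime (2 * N) (fun p => W p ω) ≤ u} : ℝ) : ℂ) =
      fredholmDet (volume.restrict (Ioi (0 : ℝ))) (fun x y => -flatKernel N α β Γ₁ Γ₂ u x y) := by
  have hΓ : ∀ z ∈ contourTrace Γ₁, z ∉ contourTrace Γ₂ := fun z hz => (hΓ₂_encl_Γ₁ z hz).1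
  obtain ⟨V, hVm, hV0, hVind, hVlaw, hVlim⟩ :=
    exists_tendsto_measureReal_pointToLineTime hN hα hβ hW_indep hW_law u
  refine fredholmDet_flatKernel_of_tendsto hN hα hβ hΓ₁ hΓ₁_pos hΓ₂ hΓ₂_pos hΓ₁_right hΓ₂_right
    hΓ₁_encl hΓ₂_encl hΓ u (fun ε hε hinjA hinjB hne => ?_) hVlim
  exact measureReal_pointToLineTime_mul_det hN
    (fun i hi => (hα i hi).trans_le (le_perturb 0 α (le_of_lt hε) i))
    (fun j hj => (hβ j hj).trans_le (le_perturb N β (le_of_lt hε) j)) hinjA hinjB hne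
    (hVm ε) (hV0 ε hε) (hVind ε hε) (hVlaw ε hε) hu.le
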